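/- Let $G$ be a finite simple connected graph with $n$ vertices and $m$ edges such that no separator of $G$ consists only of vertices of degree $2$ (a separator is a vertex set $S$ for which $G-S$ is disconnected). For a tree $T$, let $L(T)$ be its set of leaves (vertices of degree $1$; the vertex of a one-vertex tree also counts as a leaf). Call a spanning tree $T$ of $G$ *good* if, for every collection $\mathcal C$ of pairwise vertex-disjoint cycles in the induced subgraph $G[L(T)]$, $$|L(T)|\ \ge\ \frac{n+3|\mathcal C|}{4}.$$ Then $G$ has a good spanning tree, and one can be found in linear time: there are a RAM program and a constant $c$ such that, for every such $G$ given by adjacency lists, the program halts after at most $c\,(n+m)$ steps and outputs (as parent pointers) a good spanning tree of $G$. Moreover, unless $G$ is a triangle, good trees are found by the following algorithm BRANCHING, and the tree output by the program is one that BRANCHING can produce. Let $\tilde G$ be obtained from $G$ by deleting all edges between two vertices of degree $2$. Start with the tree $T=\{r\}$ for an arbitrary vertex $r$. To *expand* a vertex $v$ of $T$ is to add all vertices of $N_{\tilde G}(v)\setminus V(T)$ to $T$ as children of $v$. Perform the following operations as long as one applies. - (O1) If $v\in V(T)$ has $|N_{\tilde G}(v)\setminus V(T)|\ge 2$, expand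 $v$. - (O2) If $v\in V(T)$ has $N_{\tilde G}(v)\setminus V(T)=\{x\}$, and $N_{\tilde G}(x)\subseteq V(T)$ or $|N_{\tilde G}(x)\cap V(T)|\ge 2$, expand $v$. - (O3) If $v\in V(T)$ has $N_{\tilde G}(v)\setminus V(T)=\{x\}$ and $|N_{\tilde G}(x)\setminus V(T)|\ge 2$, expand $v$ and then $x$. Operation O1 has precedence over O2 and O3. If O1 applies at several vertices, one that adds the largest number of vertices is chosen, and among these one that was added to $T$ last; if O1 does not apply, then among the vertices at which O2 or O3 applies one that was added to $T$ last is chosen; remaining ties (vertices added by the same expansion count as added simultaneously) are broken arbitrarily. For every root $r$ an execution of BRANCHING that runs to its end exists, and every such execution ends with a good spanning tree of $G$. -/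

import Mathlib

universe u

/-! ### Leaves, separators, disjoint cycles -/

section Graphs

variable {V : Type u}

/-- The degree of `v` in `G` (all graphs considered are finite). -/
noncomputable def deg (G : SimpleGraph V) (v : V) : ℕ := (G.neighborSet v).ncard

/-- The set `L(T)` of leaves of a tree `T`. A vertex of a tree with at least two vertices is a leaf
iff its degree is `1`; the only vertex of a one-vertex tree counts as a leaf. -/
def leaves (T : SimpleGraph V) : Set V := {v | deg T v ≤ 1}

/-- `S` is a separator of `G`: two vertices outside `S` are not connected in `G - S`. -/
def IsSeparator (G : SimpleGraph V) (S : Set V) : Prop := ¬ (G.induce Sᶜ).Preconnected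

/-- No separator of `G` consists of vertices of degree `2` only. -/
def NoTwoVertexSeparator (G : SimpleGraph V) : Prop :=
  ∀ S : Set V, (∀ v ∈ S, deg G v = 2) → ¬ IsSeparator G S

/-- `H` contains a collection of `k` pairwise vertex-disjoint cycles. -/
def HasDisjointCycles {W : Type u} (H : SimpleGraph W) (k : ℕ) : Prop :=
  ∃ (a : Fin k → W) (c : ∀ i, H.Walk (a i) (a i)),
    (∀ i, (c i).IsCycle) ∧ ∀ i j, i ≠ j → List.Disjoint (c i).support (c j).support

/-- `T` is a spanning tree of `G` such that `|L(T)| ≥ (n + 3|C|)/4` for every collection `C` of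
vertex-disjoint cycles in `G[L(T)]`. -/
def IsManyLeafTree [Fintype V] (G T : SimpleGraph V) : Prop :=
  T ≤ G ∧ T.IsTree ∧
    ∀ k : ℕ, HasDisjointCycles (G.induce (leaves T)) k →
      ((leaves T).ncard : ℝ) ≥ ((Fintype.card V : ℝ) + 3 * (k : ℝ)) / 4

/-- The graph obtained from `G` by deleting all edges whose two ends both have degree `2`. -/
def simplify (G : SimpleGraph V) : SimpleGraph V where
  Adj a b := G.Adj a b ∧ ¬ (deg G a = 2 ∧ deg G b = 2)
  symm := ⟨fun _ _ h => ⟨h.1.symm, fun h' => h.2 ⟨h'.2, h'.1⟩⟩⟩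
  loopless := ⟨fun _ h => h.1.ne rfl⟩

/-- `G` is a triangle. -/
def IsTriangle [Fintype V] (G : SimpleGraph V) : Prop := Fintype.card V = 3 ∧ G = ⊤

/-- The graph whose edges join each vertex `v` to `p v`, where `p v = v` gives no edge. -/
def parentGraph (p : V → V) : SimpleGraph V := SimpleGraph.fromRel (fun a b => p a = b)

end Graphs

/-! ### The algorithm BRANCHING -/

namespace Branching

variable {V : Type u}

/-- A rooted tree `T` under construction. -/
structure State (V : Type u) where
  /-- the vertex set of `T` -/
  verts : Set V
  /-- the parent of each vertex; the root and the vertices outside `T` are their own parents -/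
  parent : V → V
  /-- the time at which a vertex was added to `T` -/
  stamp : V → ℕ
  /-- the number of expansions made so far -/
  clock : ℕ

/-- The one-vertex tree with root `r`. -/
def init (r : V) : State V := ⟨{r}, id, fun _ => 0, 0⟩

/-- The set `N_G(v) \ V(T)`. -/
def outer (G : SimpleGraph V) (s : State V) (v : V) : Set V := G.neighborSet v \ s.verts

open Classical in
/-- Expand `v`: all vertices of `N_G(v) \ V(T)` are added to `T` as children of `v`. They are all
added at the same time. -/
noncomputable def expand (G : SimpleGraph V) (s : State V) (v : V) : State V where
  verts := s.verts ∪ outer G s v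
  parent w := if w ∈ outer G s v then v else s.parent w
  stamp w := if w ∈ outer G s v then s.clock + 1 else s.stamp w
  clock := s.clock + 1

/-- Operation O1 applies at `v`. (In O1, O2 and O3, `v` is automatically a leaf of `T`: a vertex
that was expanded has no neighbours outside `T`.) -/
def O1 (G : SimpleGraph V) (s : State V) (v : V) : Prop :=
  v ∈ s.verts ∧ 2 ≤ (outer G s v).ncard

/-- Operation O2 applies at `v`, with new vertex `x`. -/
def O2 (G : SimpleGraph V) (s : State V) (v x : V) : Prop :=
  v ∈ s.verts ∧ outer G s v = {x} ∧
    (outer G s x = ∅ ∨ 2 ≤ (G.neighborSet x ∩ s.verts).ncard)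

/-- Operation O3 applies at `v`, with new vertex `x`, which is to be expanded after `v`. -/
def O3 (G : SimpleGraph V) (s : State V) (v x : V) : Prop :=
  v ∈ s.verts ∧ outer G s v = {x} ∧ 2 ≤ (outer G s x).ncard

/-- The DFS rule when O1 applies nowhere: `v` was added no earlier than any vertex at which O2
or O3 applies. -/
def Latest (G : SimpleGraph V) (s : State V) (v : V) : Prop :=
  ∀ w y, O2 G s w y ∨ O3 G s w y → s.stamp w ≤ s.stamp v

/-- One operation of BRANCHING. O1 has precedence; among the vertices at which O1 applies, one with
the largest number of new vertices is expanded, and among these one that was added to `T` last. If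
O1 does not apply, then O2 or O3 is performed at a vertex that was added last among those at which
O2 or O3 applies. Remaining ties are broken arbitrarily. -/
inductive Step (G : SimpleGraph V) : State V → State V → Prop
  | o1 (s : State V) (v : V) (h : O1 G s v)
      (largest : ∀ w, O1 G s w → (outer G s w).ncard ≤ (outer G s v).ncard)
      (dfs : ∀ w, O1 G s w → (outer G s w).ncard = (outer G s v).ncard → s.stamp w ≤ s.stamp v) :
      Step G s (expand G s v)
  | o2 (s : State V) (v x : V) (noO1 : ∀ w, ¬ O1 G s w) (h : O2 G s v x) (dfs : Latest G s v) :
      Step G s (expand G s v)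
  | o3 (s : State V) (v x : V) (noO1 : ∀ w, ¬ O1 G s w) (h : O3 G s v x) (dfs : Latest G s v) :
      Step G s (expand G (expand G s v) x)

/-- `s` is a possible final state of BRANCHING on `G` with root `r`: it is reached from the
one-vertex tree by operations, and no further operation applies. -/
def IsResult (G : SimpleGraph V) (r : V) (s : State V) : Prop :=
  Relation.ReflTransGen (Step G) (init r) s ∧ ∀ s', ¬ Step G s s'

end Branching

/-! ### Random access machines

Programs for a machine with registers and arrays of natural numbers, with indirect addressing and
with unit cost for each elementary instruction and each test. The only arithmetic is successor and
predecessor, so the numbers in memory exceed the numbers in the input and in the program by at most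
the number of steps: a computation of linear length handles words of logarithmic length only. -/

namespace RAM

/-- The memory: registers `reg x` and arrays `arr a`, with entries `arr a i`. -/
structure Store where
  reg : ℕ → ℕ
  arr : ℕ → ℕ → ℕ

def Store.setReg (s : Store) (x k : ℕ) : Store := { s with reg := Function.update s.reg x k }

def Store.setArr (s : Store) (a i k : ℕ) : Store :=
  { s with arr := Function.update s.arr a (Function.update (s.arr a) i k) }

/-- Elementary instructions. -/
inductive Instr
  /-- `reg x := k` -/
  | const (x k : ℕ)
  /-- `reg x := reg y` -/
  | copy (x y : ℕ)
  /-- `reg x := reg x + 1` -/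
  | succ (x : ℕ)
  /-- `reg x := reg x - 1`, truncated at `0` -/
  | pred (x : ℕ)
  /-- `reg x := arr a (reg y)` -/
  | load (x a y : ℕ)
  /-- `arr a (reg y) := reg x` -/
  | store (a y x : ℕ)

def Instr.run : Instr → Store → Store
  | .const x k, s => s.setReg x k
  | .copy x y, s => s.setReg x (s.reg y)
  | .succ x, s => s.setReg x (s.reg x + 1)
  | .pred x, s => s.setReg x (s.reg x - 1)
  | .load x a y, s => s.setReg x (s.arr a (s.reg y))
  | .store a y x, s => s.setArr a (s.reg y) (s.reg x)

/-- Tests: comparison of two registers. -/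
inductive Test
  | eq (x y : ℕ)
  | lt (x y : ℕ)

def Test.holds : Test → Store → Prop
  | .eq x y, s => s.reg x = s.reg y
  | .lt x y, s => s.reg x < s.reg y

/-- Programs. -/
inductive Prog
  | skip
  | instr (i : Instr)
  | seq (p q : Prog)
  | cond (b : Test) (p q : Prog)
  | loop (b : Test) (p : Prog)

/-- `Exec p s s' t`: the program `p`, started with memory `s`, halts with memory `s'` after `t`
steps. (`loop b p` repeats `p` while `b` holds.) -/
inductive Exec : Prog → Store → Store → ℕ → Prop
  | skip (s : Store) : Exec .skip s s 1
  | instr (i : Instr) (s : Store) : Exec (.instr i) s (i.run s) 1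
  | seq {p q : Prog} {s s' s'' : Store} {t t' : ℕ} :
      Exec p s s' t → Exec q s' s'' t' → Exec (.seq p q) s s'' (t + t')
  | condTrue {b : Test} {p q : Prog} {s s' : Store} {t : ℕ} :
      b.holds s → Exec p s s' t → Exec (.cond b p q) s s' (t + 1)
  | condFalse {b : Test} {p q : Prog} {s s' : Store} {t : ℕ} :
      ¬ b.holds s → Exec q s s' t → Exec (.cond b p q) s s' (t + 1)
  | loopTrue {b : Test} {p : Prog} {s s' s'' : Store} {t t' : ℕ} :
      b.holds s → Exec p s s' t → Exec (.loop b p) s' s'' t' → Exec (.loop b p) s s'' (t + t' + 1)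
  | loopFalse {b : Test} {p : Prog} {s : Store} :
      ¬ b.holds s → Exec (.loop b p) s s 1

/-- `L` is an adjacency-list representation of `G`: the list `L v` contains every neighbour of `v`
exactly once, in any order. -/
def IsAdjLists {n : ℕ} (G : SimpleGraph (Fin n)) (L : Fin n → List (Fin n)) : Prop :=
  ∀ v, (L v).Nodup ∧ ∀ w, w ∈ L v ↔ G.Adj v w

/-- The memory that holds the adjacency lists `L`: register `0` is the number `n` of vertices,
array `1` is the concatenation of the lists `L 0, …, L (n-1)`, and for `i ≤ n` entry `i` of array
`0` is the total length of the first `i` lists (so that `L v` occupies the positions from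
`arr 0 v` up to but not including `arr 0 (v+1)` of array `1`); everything else is `0`. -/
def inputStore {n : ℕ} (L : Fin n → List (Fin n)) : Store where
  reg x := if x = 0 then n else 0
  arr a i :=
    if a = 0 then (if i ≤ n then ((List.ofFn L).take i).flatten.length else 0)
    else if a = 1 then ((List.ofFn L).flatten.map Fin.val).getD i 0
    else 0

/-- The memory `s` holds the function `p` as output, in array `2`. -/
def Outputs {n : ℕ} (s : Store) (p : Fin n → Fin n) : Prop := ∀ v : Fin n, s.arr 2 v = p v

end RAM

/-!
Fix a set `K` of vertices of the final tree that were never expanded and are covered by disjoint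
cycles. Follow the execution with the potential `6 l - 2 |T| + ∑ weight`, where `l` is the number of
childless vertices of the current tree `T` and the sum is over these vertices. The weight of a
childless vertex outside `K` is `2` if it is doomed, that is, will certainly stay childless, and `0`
otherwise; the weight of a vertex of `K` is smaller by `2`, or by `1` if it is not doomed and one of
its neighbours on the cycle is still missing. At the end every leaf is doomed and the potential is
`8 |L(T)| - 2 n - 2 |K|`; as the cycles have at least `3 |𝒞|` vertices, it is enough that the
potential is nonnegative whenever O1 applies nowhere.

O2 does not decrease the potential unless it enables O1. Then, or after O3, a series of operations
O1 follows, in which the potential is not monotone. Counting the vertices added in the series with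
weight `-2` gives the balance, which is at least `-4`, and larger unless all expansions are as small
as possible. The deficit is made up by the last group of vertices added: either all of them are
doomed, or, since the depth-first rule makes BRANCHING continue there, one of them lies outside `K`;
and a cycle of `K` with new vertices cannot consist of new vertices only, so that weight is gained
at both ends of a path of new vertices.

In linear time, stack `j ≥ 1` holds the vertices of the tree with at least `j` neighbours outside,
the last added on top; a vertex is entered into stack `j` for each `j` up to its number of such
neighbours, so that the total length of the stacks is at most the sum of the degrees. Entries that
are out of date are discarded when they come to the top. The top of stack `1` is tested for O2 and
O3; if neither applies, then the vertex is doomed and discarded for good.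
-/

namespace Branching

variable {V : Type u} {H : SimpleGraph V} {s t : State V} {r v w x y : V}

/-! ### Expansions and executions -/

lemma mem_outer : w ∈ outer H s v ↔ H.Adj v w ∧ w ∉ s.verts := Iff.rfl

lemma notMem_outer (hw : w ∈ s.verts) : w ∉ outer H s v := fun h => h.2 hw

lemma outer_anti (hst : s.verts ⊆ t.verts) : outer H t v ⊆ outer H s v :=
  Set.sdiff_subset_sdiff_right hst

lemma mem_expand_verts : w ∈ (expand H s v).verts ↔ w ∈ s.verts ∨ w ∈ outer H s v := Iff.rfl

lemma verts_subset_expand : s.verts ⊆ (expand H s v).verts := Set.subset_union_left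

lemma outer_expand : outer H (expand H s v) w = outer H s w \ outer H s v :=
  Set.sdiff_sdiff.symm

lemma outer_expand_self : outer H (expand H s v) v = ∅ := by
  rw [outer_expand, Set.sdiff_self]

lemma outer_expand_of_eq_singleton (hx : outer H s v = {x}) :
    outer H (expand H s v) x = outer H s x := by
  rw [outer_expand, hx, Set.sdiff_singleton_eq_self fun h => h.1.ne rfl]

lemma expand_parent_of_mem (hw : w ∈ outer H s v) : (expand H s v).parent w = v := if_pos hw

lemma expand_parent_of_notMem (hw : w ∉ outer H s v) :
    (expand H s v).parent w = s.parent w := if_neg hw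

lemma expand_stamp_of_mem (hw : w ∈ outer H s v) : (expand H s v).stamp w = s.clock + 1 :=
  if_pos hw

lemma expand_stamp_of_notMem (hw : w ∉ outer H s v) : (expand H s v).stamp w = s.stamp w :=
  if_neg hw

@[simp] lemma expand_clock : (expand H s v).clock = s.clock + 1 := rfl

/-- `s` is a tree with root `r` in `H`, grown by expansions: a vertex that has a child has no
neighbour outside, and the root is expanded first. -/
structure Valid (H : SimpleGraph V) (r : V) (s : State V) : Prop where
  root_mem : r ∈ s.verts
  root_parent : s.parent r = r
  parent_of_notMem : ∀ w, w ∉ s.verts → s.parent w = w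
  parent_mem : ∀ w ∈ s.verts, w ≠ r → s.parent w ∈ s.verts
  parent_adj : ∀ w ∈ s.verts, w ≠ r → H.Adj (s.parent w) w
  stamp_parent_lt : ∀ w ∈ s.verts, w ≠ r → s.stamp (s.parent w) < s.stamp w
  stamp_le : ∀ w ∈ s.verts, s.stamp w ≤ s.clock
  outer_parent : ∀ w, s.parent w ≠ w → outer H s (s.parent w) = ∅
  root_children : s.verts = {r} ∨ ∀ w, H.Adj r w → s.parent w = r

lemma valid_init (H : SimpleGraph V) (r : V) : Valid H r (init r) where
  root_mem := rfl
  root_parent := rfl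
  parent_of_notMem _ _ := rfl
  parent_mem _ hw hr := absurd hw hr
  parent_adj _ hw hr := absurd hw hr
  stamp_parent_lt _ hw hr := absurd hw hr
  stamp_le _ _ := le_rfl
  outer_parent _ hw := absurd rfl hw
  root_children := Or.inl rfl

lemma Valid.mem_of_parent_ne (hs : Valid H r s) (hw : s.parent w ≠ w) : w ∈ s.verts :=
  not_not.1 (mt (hs.parent_of_notMem w) hw)

lemma Valid.parent_notMem_outer (hs : Valid H r s) (hw : w ∈ s.verts) :
    s.parent w ∉ outer H s v := by
  by_cases hwr : w = r
  · rw [hwr, hs.root_parent]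
    exact notMem_outer hs.root_mem
  · exact notMem_outer (hs.parent_mem w hw hwr)

lemma Valid.expand_root_children (hs : Valid H r s) (hv : v ∈ s.verts) :
    (expand H s v).verts = {r} ∨ ∀ w, H.Adj r w → (expand H s v).parent w = r := by
  rcases hs.root_children with hroot | hchildren
  · obtain rfl : v = r := by simpa [hroot] using hv
    exact Or.inr fun w hw => expand_parent_of_mem ⟨hw, by simpa [hroot] using hw.ne'⟩
  · refine Or.inr fun w hw => ?_
    have hmem : w ∈ s.verts := hs.mem_of_parent_ne (by rw [hchildren w hw]; exact hw.ne)
    rw [expand_parent_of_notMem (notMem_outer hmem), hchildren w hw]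

protected lemma Valid.expand (hs : Valid H r s) (hv : v ∈ s.verts) : Valid H r (expand H s v) where
  root_mem := verts_subset_expand hs.root_mem
  root_parent := by rw [expand_parent_of_notMem (notMem_outer hs.root_mem), hs.root_parent]
  parent_of_notMem w hw := by
    rw [mem_expand_verts, not_or] at hw
    rw [expand_parent_of_notMem hw.2, hs.parent_of_notMem w hw.1]
  parent_mem w hw hr := by
    by_cases hwo : w ∈ outer H s v
    · rw [expand_parent_of_mem hwo]
      exact verts_subset_expand hv
    · rw [expand_parent_of_notMem hwo]
      exact verts_subset_expand (hs.parent_mem w (hw.resolve_right hwo) hr)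
  parent_adj w hw hr := by
    by_cases hwo : w ∈ outer H s v
    · rw [expand_parent_of_mem hwo]
      exact hwo.1
    · rw [expand_parent_of_notMem hwo]
      exact hs.parent_adj w (hw.resolve_right hwo) hr
  stamp_parent_lt w hw hr := by
    by_cases hwo : w ∈ outer H s v
    · rw [expand_parent_of_mem hwo, expand_stamp_of_mem hwo,
        expand_stamp_of_notMem (notMem_outer hv)]
      exact Nat.lt_succ_of_le (hs.stamp_le v hv)
    · have hws := hw.resolve_right hwo
      rw [expand_parent_of_notMem hwo, expand_stamp_of_notMem hwo,
        expand_stamp_of_notMem (hs.parent_notMem_outer hws)]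
      exact hs.stamp_parent_lt w hws hr
  stamp_le w hw := by
    by_cases hwo : w ∈ outer H s v
    · exact (expand_stamp_of_mem hwo).le
    · rw [expand_stamp_of_notMem hwo]
      exact (hs.stamp_le w (hw.resolve_right hwo)).trans (Nat.le_succ _)
  outer_parent w hw := by
    by_cases hwo : w ∈ outer H s v
    · rw [expand_parent_of_mem hwo]
      exact outer_expand_self
    · rw [expand_parent_of_notMem hwo] at hw ⊢
      rw [outer_expand, hs.outer_parent w hw, Set.empty_sdiff]
  root_children := hs.expand_root_children hv

lemma O3.mem_verts_expand (h : O3 H s v x) : x ∈ (expand H s v).verts :=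
  Or.inr (h.2.1 ▸ rfl)

lemma Step.valid (hst : Step H s t) (hs : Valid H r s) : Valid H r t := by
  cases hst with
  | o1 v hv => exact hs.expand hv.1
  | o2 v x _ hv => exact hs.expand hv.1
  | o3 v x _ hv => exact (hs.expand hv.1).expand hv.mem_verts_expand

lemma Valid.of_reflTransGen (hs : Valid H r s) (hst : Relation.ReflTransGen (Step H) s t) :
    Valid H r t := by
  induction hst with
  | refl => exact hs
  | tail _ hlast ih => exact hlast.valid ih

/-- `t` arises from `s` by adding vertices: `s` is a subtree of `t`. -/
def Extends (s t : State V) : Prop :=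
  s.verts ⊆ t.verts ∧ ∀ w ∈ s.verts, t.parent w = s.parent w

lemma Extends.refl (s : State V) : Extends s s := ⟨subset_rfl, fun _ _ => rfl⟩

lemma Extends.trans {t' : State V} (hst : Extends s t) (htt' : Extends t t') : Extends s t' :=
  ⟨hst.1.trans htt'.1, fun w hw => (htt'.2 w (hst.1 hw)).trans (hst.2 w hw)⟩

lemma extends_expand : Extends s (expand H s v) :=
  ⟨verts_subset_expand, fun _ hw => expand_parent_of_notMem (notMem_outer hw)⟩

lemma Step.extends (hst : Step H s t) : Extends s t := by
  cases hst with
  | o1 => exact extends_expand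
  | o2 => exact extends_expand
  | o3 => exact extends_expand.trans extends_expand

lemma extends_of_reflTransGen (hst : Relation.ReflTransGen (Step H) s t) : Extends s t := by
  induction hst with
  | refl => exact .refl s
  | tail _ hlast ih => exact ih.trans hlast.extends

lemma Extends.exists_child (hst : Extends (expand H s v) t) (hv : v ∈ s.verts)
    (hne : (outer H s v).Nonempty) : ∃ w, t.parent w = v ∧ w ≠ v := by
  obtain ⟨w, hw⟩ := hne
  refine ⟨w, ?_, fun hwv => hw.2 (hwv ▸ hv)⟩
  rw [hst.2 w (Or.inr hw), expand_parent_of_mem hw]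

lemma outer_nonempty_of_eq_singleton (hx : outer H s v = {x}) : (outer H s v).Nonempty :=
  hx ▸ Set.singleton_nonempty x

lemma outer_nonempty_of_two_le (h : 2 ≤ (outer H s v).ncard) : (outer H s v).Nonempty :=
  Set.nonempty_of_ncard_ne_zero (by omega)

/-- Operation O1 applies nowhere. -/
def NoO1 (H : SimpleGraph V) (s : State V) : Prop := ∀ w, ¬ O1 H s w

lemma NoO1.ncard_le_one (h : NoO1 H s) (hv : v ∈ s.verts) : (outer H s v).ncard ≤ 1 :=
  not_lt.1 fun hlt => h v ⟨hv, hlt⟩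

variable [Finite V]

lemma ncard_outer_anti (hst : s.verts ⊆ t.verts) : (outer H t v).ncard ≤ (outer H s v).ncard :=
  Set.ncard_le_ncard (outer_anti hst) (Set.toFinite _)

lemma ncard_verts_expand :
    (expand H s v).verts.ncard = s.verts.ncard + (outer H s v).ncard :=
  Set.ncard_union_eq Set.disjoint_sdiff_right (Set.toFinite _) (Set.toFinite _)

lemma Step.ncard_verts_lt (hst : Step H s t) : s.verts.ncard < t.verts.ncard := by
  cases hst with
  | o1 v hv =>
    rw [ncard_verts_expand]
    have := hv.2
    omega
  | o2 v x _ hv =>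
    rw [ncard_verts_expand, hv.2.1, Set.ncard_singleton]
    omega
  | o3 v x _ hv =>
    rw [ncard_verts_expand, ncard_verts_expand, hv.2.1, Set.ncard_singleton]
    omega

lemma exists_isResult (H : SimpleGraph V) (r : V) : ∃ s, IsResult H r s := by
  obtain ⟨t, ht, hmin⟩ := (measure fun t : State V => t.vertsᶜ.ncard).wf.has_min
    {t | Relation.ReflTransGen (Step H) (init r) t} ⟨_, .refl⟩
  refine ⟨t, ht, fun t' htt' => hmin t' (ht.tail htt') ?_⟩
  exact Set.ncard_lt_ncard (compl_lt_compl_iff_lt.2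
    (htt'.extends.1.ssubset_of_ne fun h => htt'.ncard_verts_lt.ne (h ▸ rfl))) (Set.toFinite _)

lemma noO1_of_final (hfinal : ∀ t, ¬ Step H s t) : NoO1 H s := by
  intro w hw
  obtain ⟨v, hv, hmax⟩ := Set.exists_max_image {v | O1 H s v}
    (fun v => toLex ((outer H s v).ncard, s.stamp v)) (Set.toFinite _) ⟨w, hw⟩
  have hlex : ∀ y, O1 H s y → (outer H s y).ncard < (outer H s v).ncard ∨
      (outer H s y).ncard = (outer H s v).ncard ∧ s.stamp y ≤ s.stamp v :=
    fun y hy => (Prod.Lex.toLex_le_toLex).1 (hmax y hy)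
  refine hfinal _ (Step.o1 s v hv (fun y hy => ?_) (fun y hy heq => ?_))
  · exact (hlex y hy).elim le_of_lt fun h => h.1.le
  · exact (hlex y hy).elim (fun h => absurd heq h.ne) And.right

lemma no_O2_O3_of_final (hfinal : ∀ t, ¬ Step H s t) : ¬ (O2 H s v x ∨ O3 H s v x) := by
  intro hvx
  obtain ⟨w, ⟨y, hw⟩, hmax⟩ := Set.exists_max_image {v | ∃ x, O2 H s v x ∨ O3 H s v x}
    s.stamp (Set.toFinite _) ⟨v, x, hvx⟩
  have hlatest : Latest H s w := fun z y hz => hmax z ⟨y, hz⟩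
  rcases hw with hw | hw
  · exact hfinal _ (Step.o2 s w y (noO1_of_final hfinal) hw hlatest)
  · exact hfinal _ (Step.o3 s w y (noO1_of_final hfinal) hw hlatest)

end Branching

namespace Branching

variable {V : Type u} {H : SimpleGraph V} {s t : State V} {r v w x y : V}

/-! ### Doomed vertices -/

/-- A vertex `y` of the tree is doomed if it has no neighbour outside, or only one, `z`, which has
degree `2`, and the other neighbour of `z` is outside or was added later than `y`. The depth-first
rule never lets BRANCHING expand a doomed vertex, so that it remains a leaf. -/
def Doomed (H : SimpleGraph V) (s : State V) (y : V) : Prop :=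
  outer H s y = ∅ ∨ ∃ z w, outer H s y = {z} ∧ H.neighborSet z = {y, w} ∧ w ≠ y ∧
    (w ∉ s.verts ∨ s.stamp y < s.stamp w)

protected lemma Doomed.expand (hd : Doomed H s y) (hy : y ∈ s.verts) (hst : s.stamp y ≤ s.clock) :
    Doomed H (expand H s v) y := by
  rcases hd with hd | ⟨z, w, hz, hnbrs, hwy, hw⟩
  · exact Or.inl (by rw [outer_expand, hd, Set.empty_sdiff])
  rcases Set.subset_singleton_iff_eq.1 (hz ▸ outer_anti verts_subset_expand :
    outer H (expand H s v) y ⊆ {z}) with hempty | hsingle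
  · exact Or.inl hempty
  refine Or.inr ⟨z, w, hsingle, hnbrs, hwy, ?_⟩
  rw [expand_stamp_of_notMem (notMem_outer hy)]
  by_cases hwo : w ∈ outer H s v
  · rw [expand_stamp_of_mem hwo]
    exact Or.inr (Nat.lt_succ_of_le hst)
  · rw [expand_stamp_of_notMem hwo, mem_expand_verts, not_or]
    exact hw.imp_left fun hws => ⟨hws, hwo⟩

lemma Doomed.neighborSet_eq (hd : Doomed H s y) (hx : outer H s y = {x}) :
    ∃ w, H.neighborSet x = {y, w} ∧ w ≠ y ∧ (w ∉ s.verts ∨ s.stamp y < s.stamp w) := by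
  rcases hd with hd | ⟨z, w, hz, hw⟩
  · exact absurd (hx.symm.trans hd) (Set.singleton_ne_empty x)
  · obtain rfl : z = x := Set.singleton_injective (hz.symm.trans hx)
    exact ⟨w, hw⟩

section Finite

variable [Finite V]

lemma NoO1.eq_singleton (hN : NoO1 H s) (hv : v ∈ s.verts) (hx : x ∈ outer H s v) :
    outer H s v = {x} :=
  Set.Subset.antisymm
    (fun _ hz => (Set.ncard_le_one (Set.toFinite _)).1 (hN.ncard_le_one hv) _ hz _ hx)
    (Set.singleton_subset_iff.2 hx)

lemma NoO1.eq_empty (hN : NoO1 H s) (hv : v ∈ s.verts) (hx : x ∈ outer H s v)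
    (hst : s.verts ⊆ t.verts) (hxt : x ∈ t.verts) : outer H t v = ∅ := by
  refine Set.eq_empty_of_forall_notMem fun z hz => hz.2 ?_
  have hzx : z ∈ ({x} : Set V) := hN.eq_singleton hv hx ▸ outer_anti hst hz
  exact hzx ▸ hxt

lemma NoO1.exists_O2_or_O3 (hN : NoO1 H s) (hy : y ∈ s.verts) (hd : ¬ Doomed H s y) :
    ∃ x, O2 H s y x ∨ O3 H s y x := by
  obtain ⟨x, hx⟩ := Set.nonempty_iff_ne_empty.2 fun h => hd (Or.inl h)
  have hyx := hN.eq_singleton hy hx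
  refine ⟨x, or_iff_not_imp_left.2 fun hO2 => ⟨hy, hyx, ?_⟩⟩
  by_contra! hlt
  obtain ⟨hne, hinner_lt⟩ := not_or.1 fun h => hO2 ⟨hy, hyx, h⟩
  obtain ⟨w, hw⟩ := ((Set.ncard_le_one_iff_eq (Set.toFinite _)).1
    (Nat.le_of_lt_succ hlt)).resolve_left hne
  have hinner : H.neighborSet x ∩ s.verts = {y} :=
    Set.Subset.antisymm (fun _ hz => (Set.ncard_le_one (Set.toFinite _)).1
      (Nat.le_of_lt_succ (not_le.1 hinner_lt)) _ hz _ ⟨hx.1.symm, hy⟩)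
      (Set.singleton_subset_iff.2 ⟨hx.1.symm, hy⟩)
  have hwx : w ∈ outer H s x := hw ▸ rfl
  refine hd (Or.inr ⟨x, w, hyx, ?_, fun hwy => hwx.2 (hwy ▸ hy), Or.inl hwx.2⟩)
  rw [← Set.inter_union_sdiff (H.neighborSet x) s.verts, hinner,
    show H.neighborSet x \ s.verts = {w} from hw, Set.singleton_union]

lemma O3.not_doomed (h : O3 H s v x) : ¬ Doomed H s v := by
  intro hd
  obtain ⟨w, hnbrs, -⟩ := hd.neighborSet_eq h.2.1
  have hsub : outer H s x ⊆ {w} := fun z hz =>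
    (hnbrs ▸ hz.1 : z ∈ ({v, w} : Set V)).resolve_left fun hzv => hz.2 (hzv ▸ h.1)
  have hcard := Set.ncard_le_ncard hsub (Set.toFinite _)
  rw [Set.ncard_singleton] at hcard
  exact absurd (h.2.2.trans hcard) (by decide)

lemma O2.mem_verts_of_neighborSet_eq (h : O2 H s v x) (hx : H.neighborSet x = {v, w}) :
    w ∈ s.verts := by
  by_contra hw
  rcases h.2.2 with hempty | hinner
  · have hwx : w ∈ H.neighborSet x := hx ▸ Or.inr rfl
    exact (hempty ▸ ⟨hwx, hw⟩ : w ∈ (∅ : Set V))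
  · have hsub : H.neighborSet x ∩ s.verts ⊆ {v} := fun z hz =>
      (hx ▸ hz.1 : z ∈ ({v, w} : Set V)).resolve_right fun hzw => hw (hzw ▸ hz.2)
    have hcard := Set.ncard_le_ncard hsub (Set.toFinite _)
    rw [Set.ncard_singleton] at hcard
    exact absurd (hinner.trans hcard) (by decide)

lemma O2.exists_later (h : O2 H s v x) (hN : NoO1 H s) (hd : Doomed H s v) :
    ∃ w, O2 H s w x ∧ s.stamp v < s.stamp w ∧ ¬ Doomed H s w := by
  obtain ⟨w, hnbrs, hwv, hlater⟩ := hd.neighborSet_eq h.2.1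
  have hw := h.mem_verts_of_neighborSet_eq hnbrs
  have hlt := hlater.resolve_left (not_not_intro hw)
  have hxw : H.Adj x w := (hnbrs ▸ Or.inr rfl : w ∈ H.neighborSet x)
  have hvx : x ∈ outer H s v := h.2.1 ▸ rfl
  have hwx := hN.eq_singleton hw (⟨hxw.symm, hvx.2⟩ : x ∈ outer H s w)
  refine ⟨w, ⟨hw, hwx, h.2.2⟩, hlt, fun hdw => ?_⟩
  obtain ⟨w', hnbrs', -, hlater'⟩ := hdw.neighborSet_eq hwx
  obtain rfl : v = w' := (hnbrs' ▸ hvx.1.symm : v ∈ ({w, w'} : Set V)).resolve_left hwv.symm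
  exact hlater'.elim (· h.1) hlt.not_gt

lemma O2.not_doomed (h : O2 H s v x) (hN : NoO1 H s) (hlatest : Latest H s v) :
    ¬ Doomed H s v := by
  intro hd
  obtain ⟨w, hw, hlt, -⟩ := h.exists_later hN hd
  exact hlt.not_ge (hlatest w x (Or.inl hw))

end Finite

/-! ### Vertices without children -/

section Tips

variable [Fintype V]

open Classical in
/-- The vertices of the tree without children. -/
noncomputable def tips (s : State V) : Finset V :=
  {u | u ∈ s.verts ∧ ∀ w, s.parent w = u → w = u}

lemma mem_tips : v ∈ tips s ↔ v ∈ s.verts ∧ ∀ w, s.parent w = v → w = v := by simp [tips]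

lemma Valid.mem_tips_of_outer_nonempty (hs : Valid H r s) (hv : v ∈ s.verts)
    (hne : (outer H s v).Nonempty) : v ∈ tips s := by
  refine mem_tips.2 ⟨hv, fun w hw => ?_⟩
  by_contra hwv
  exact hne.ne_empty (hw ▸ hs.outer_parent w (hw ▸ Ne.symm hwv))

lemma mem_tips_expand_of_mem_tips (hw : w ∈ tips s) (hwv : w ≠ v) :
    w ∈ tips (expand H s v) := by
  obtain ⟨hws, hchild⟩ := mem_tips.1 hw
  refine mem_tips.2 ⟨Or.inl hws, fun u hu => ?_⟩
  by_cases huo : u ∈ outer H s v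
  · exact absurd ((expand_parent_of_mem huo).symm.trans hu).symm hwv
  · exact hchild u ((expand_parent_of_notMem huo).symm.trans hu)

lemma Valid.mem_tips_expand_of_mem_outer (hs : Valid H r s) (hv : v ∈ s.verts)
    (hw : w ∈ outer H s v) : w ∈ tips (expand H s v) := by
  refine mem_tips.2 ⟨Or.inr hw, fun u hu => ?_⟩
  by_cases huo : u ∈ outer H s v
  · rw [expand_parent_of_mem huo] at hu
    exact absurd (hu ▸ hv) hw.2
  · rw [expand_parent_of_notMem huo] at hu
    by_cases hus : u ∈ s.verts
    · exact absurd (hu ▸ hw) (hs.parent_notMem_outer hus)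
    · exact (hs.parent_of_notMem u hus).symm.trans hu

open Classical in
lemma Valid.tips_expand (hs : Valid H r s) (hv : v ∈ s.verts) (hne : (outer H s v).Nonempty) :
    tips (expand H s v) = (tips s).erase v ∪ (outer H s v).toFinset := by
  ext u
  rw [Finset.mem_union, Finset.mem_erase, Set.mem_toFinset]
  constructor
  · intro hu
    obtain ⟨hus | huo, hchild⟩ := mem_tips.1 hu
    · refine Or.inl ⟨?_, mem_tips.2 ⟨hus, fun w hw => ?_⟩⟩
      · rintro rfl
        obtain ⟨w, hw⟩ := hne
        exact hw.2 (hchild w (expand_parent_of_mem hw) ▸ hv)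
      · by_cases hwo : w ∈ outer H s v
        · exact (hs.parent_of_notMem w hwo.2).symm.trans hw
        · exact hchild w ((expand_parent_of_notMem hwo).trans hw)
    · exact Or.inr huo
  · rintro (⟨huv, hu⟩ | hu)
    · exact mem_tips_expand_of_mem_tips hu huv
    · exact hs.mem_tips_expand_of_mem_outer hv hu

open Classical in
lemma Valid.sum_tips_expand (hs : Valid H r s) (hv : v ∈ s.verts) (hne : (outer H s v).Nonempty)
    (g : V → ℤ) : ∑ u ∈ tips (expand H s v), g u =
      ∑ u ∈ (tips s).erase v, g u + ∑ u ∈ (outer H s v).toFinset, g u := by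
  rw [hs.tips_expand hv hne, Finset.sum_union]
  refine Finset.disjoint_left.2 fun a ha hao => ?_
  exact (Set.mem_toFinset.1 hao).2 (mem_tips.1 (Finset.mem_of_mem_erase ha)).1

lemma Valid.sum_tips_expand_const (hs : Valid H r s) (hv : v ∈ s.verts)
    (hne : (outer H s v).Nonempty) (g : V → ℤ) (c : ℤ) (hg : ∀ u ∈ outer H s v, g u = c) :
    ∑ u ∈ tips (expand H s v), g u =
      ∑ u ∈ tips s, g u - g v + (outer H s v).ncard * c := by
  classical
  rw [hs.sum_tips_expand hv hne, ← Finset.sum_erase_eq_sub (hs.mem_tips_of_outer_nonempty hv hne),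
    Finset.sum_congr rfl (fun u hu => hg u (Set.mem_toFinset.1 hu)), Finset.sum_const,
    Set.ncard_eq_toFinset_card', nsmul_eq_mul]

lemma Valid.card_tips_expand (hs : Valid H r s) (hv : v ∈ s.verts)
    (hne : (outer H s v).Nonempty) :
    ((tips (expand H s v)).card : ℤ) = (tips s).card - 1 + (outer H s v).ncard := by
  simpa using hs.sum_tips_expand_const hv hne (fun _ => 1) 1 (fun _ _ => rfl)

end Tips

end Branching

namespace Branching

variable {V : Type u} {H : SimpleGraph V} {K : Finset V} {s s₀ t : State V} {r u v w x y z : V}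

/-! ### The potential -/

/-- No vertex of `K` has a child in the tree, that is, no vertex of `K` was expanded. -/
def Childless (K : Finset V) (s : State V) : Prop := ∀ w, s.parent w ∈ K → s.parent w = w

lemma Childless.notMem (hK : Childless K t) (hst : Extends (expand H s v) t) (hv : v ∈ s.verts)
    (hne : (outer H s v).Nonempty) : v ∉ K := by
  intro hvK
  obtain ⟨w, rfl, hw⟩ := hst.exists_child hv hne
  exact hw (hK w hvK).symm

lemma Childless.of_extends (hK : Childless K t) (hs : Valid H r s) (hst : Extends s t) :
    Childless K s := by
  intro w hw
  by_cases hws : w ∈ s.verts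
  · rw [← hst.2 w hws] at hw ⊢
    exact hK w hw
  · exact hs.parent_of_notMem w hws

lemma Childless.mem_tips [Fintype V] (hK : Childless K s) (huK : u ∈ K) (hu : u ∈ s.verts) :
    u ∈ tips s :=
  Branching.mem_tips.2 ⟨hu, fun w hw => by rw [← hw, hK w (hw ▸ huK)]⟩

/-- Some execution continues from `s` to its end without ever expanding a vertex of `K`. -/
def CompletesAvoiding (H : SimpleGraph V) (K : Finset V) (s : State V) : Prop :=
  ∃ f, Relation.ReflTransGen (Step H) s f ∧ (∀ t, ¬ Step H f t) ∧ Childless K f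

lemma CompletesAvoiding.childless (h : CompletesAvoiding H K s) (hs : Valid H r s) :
    Childless K s :=
  let ⟨_, hsf, _, hK⟩ := h
  hK.of_extends hs (extends_of_reflTransGen hsf)

lemma CompletesAvoiding.of_step (h : CompletesAvoiding H K t) (hst : Step H s t) :
    CompletesAvoiding H K s :=
  let ⟨f, htf, hf⟩ := h
  ⟨f, htf.head hst, hf⟩

lemma CompletesAvoiding.exists_later [Finite V] (h : CompletesAvoiding H K s) (hs : Valid H r s)
    (hN : NoO1 H s) (hy : y ∈ s.verts) (hd : ¬ Doomed H s y) :
    ∃ v ∈ s.verts, v ∉ K ∧ s.stamp y ≤ s.stamp v := by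
  obtain ⟨x, hx⟩ := hN.exists_O2_or_O3 hy hd
  obtain ⟨f, hsf, hfinal, hKf⟩ := h
  rcases hsf.cases_head with rfl | ⟨t, hst, htf⟩
  · exact absurd hx (no_O2_O3_of_final hfinal)
  have hK : Childless K t := hKf.of_extends (hst.valid hs) (extends_of_reflTransGen htf)
  cases hst with
  | o1 v hv => exact absurd hv (hN v)
  | o2 v z _ hv hlatest =>
    exact ⟨v, hv.1, hK.notMem (.refl _) hv.1 (outer_nonempty_of_eq_singleton hv.2.1),
      hlatest y x hx⟩
  | o3 v z _ hv hlatest =>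
    exact ⟨v, hv.1, hK.notMem extends_expand hv.1 (outer_nonempty_of_eq_singleton hv.2.1),
      hlatest y x hx⟩

/-- A set of vertices covered by disjoint cycles of `H`, given by the successor and the
predecessor of each vertex, such that every covered vertex has a neighbour that is not covered. -/
structure CycleCover (H : SimpleGraph V) where
  support : Finset V
  next : V → V
  prev : V → V
  next_mem : ∀ u ∈ support, next u ∈ support
  prev_mem : ∀ u ∈ support, prev u ∈ support
  adj_next : ∀ u ∈ support, H.Adj u (next u)
  adj_prev : ∀ u ∈ support, H.Adj u (prev u)
  next_prev : ∀ u ∈ support, next (prev u) = u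
  prev_next : ∀ u ∈ support, prev (next u) = u
  next_ne_prev : ∀ u ∈ support, next u ≠ prev u
  exists_adj_notMem : ∀ u ∈ support, ∃ p, p ∉ support ∧ H.Adj u p

namespace CycleCover

variable (C : CycleCover H)

/-- The same cycles, traversed in the opposite direction. -/
def reverse : CycleCover H where
  support := C.support
  next := C.prev
  prev := C.next
  next_mem := C.prev_mem
  prev_mem := C.next_mem
  adj_next := C.adj_prev
  adj_prev := C.adj_next
  next_prev := C.prev_next
  prev_next := C.next_prev
  next_ne_prev u hu := (C.next_ne_prev u hu).symm
  exists_adj_notMem := C.exists_adj_notMem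

lemma prev_mem_of_next_mem {A : Finset V} (hA : A ⊆ C.support) (hnext : ∀ u ∈ A, C.next u ∈ A) :
    ∀ u ∈ A, C.prev u ∈ A := by
  intro u hu
  have hinv : Set.LeftInvOn C.prev C.next A := fun a ha => C.prev_next a (hA ha)
  obtain ⟨a, ha, rfl⟩ := Finset.surjOn_of_injOn_of_card_le C.next hnext hinv.injOn le_rfl hu
  rwa [hinv ha]

lemma neighborSet_ne (hz : z ∈ C.support) : H.neighborSet z ≠ {y, w} := by
  intro hnbrs
  obtain ⟨p, hp, hzp⟩ := C.exists_adj_notMem z hz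
  have hsub : ({p, C.next z, C.prev z} : Set V) ⊆ {y, w} := by
    rw [← hnbrs]
    rintro a (rfl | rfl | rfl)
    exacts [hzp, C.adj_next z hz, C.adj_prev z hz]
  have hcard := (Set.ncard_le_ncard hsub (Set.toFinite _)).trans (Set.ncard_insert_le y {w})
  rw [Set.ncard_singleton, Set.ncard_eq_three.2 ⟨p, C.next z, C.prev z,
    fun h => hp (h ▸ C.next_mem z hz), fun h => hp (h ▸ C.prev_mem z hz),
    C.next_ne_prev z hz, rfl⟩] at hcard
  exact absurd hcard (by decide)

lemma notMem_of_doomed (hd : Doomed H s u) (hx : x ∈ outer H s u) : x ∉ C.support := by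
  intro hxC
  rcases hd with hempty | ⟨z, w, hz, hnbrs, -⟩
  · exact Set.notMem_empty x (hempty ▸ hx)
  · obtain rfl : x = z := Set.mem_singleton_iff.1 (hz ▸ hx)
    exact C.neighborSet_ne hxC hnbrs

open Classical in
/-- The contribution of a childless vertex to the potential. -/
noncomputable def weight (s : State V) (u : V) : ℤ :=
  if u ∈ C.support then
    if Doomed H s u then 0 else if C.next u ∈ s.verts ∧ C.prev u ∈ s.verts then -2 else -1
  else if Doomed H s u then 2 else 0

lemma weight_reverse (s : State V) (u : V) : C.reverse.weight s u = C.weight s u := by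
  classical
  exact if_congr Iff.rfl (if_congr Iff.rfl rfl (if_congr and_comm rfl rfl)) rfl

lemma neg_two_le_weight (s : State V) (u : V) : -2 ≤ C.weight s u := by
  unfold weight; split_ifs <;> norm_num

lemma weight_nonneg (hu : u ∉ C.support) : 0 ≤ C.weight s u := by
  unfold weight; split_ifs <;> norm_num

lemma weight_nonneg_of_doomed (hd : Doomed H s u) : 0 ≤ C.weight s u := by
  simp only [weight, hd, if_true]; split_ifs <;> norm_num

lemma weight_eq_zero (hu : u ∉ C.support) (hd : ¬ Doomed H s u) : C.weight s u = 0 := by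
  simp only [weight, hu, hd, if_false]

lemma weight_eq_two (hu : u ∉ C.support) (hd : Doomed H s u) : C.weight s u = 2 := by
  simp only [weight, hu, hd, if_false, if_true]

lemma weight_eq_neg_one (hu : u ∈ C.support) (hd : ¬ Doomed H s u)
    (h : C.next u ∉ s.verts ∨ C.prev u ∉ s.verts) : C.weight s u = -1 := by
  simp only [weight, hu, hd, if_true, if_false, if_neg (not_and_or.2 h)]

lemma weight_eq_neg_two (hu : u ∈ C.support) (hd : ¬ Doomed H s u)
    (hnext : C.next u ∈ s.verts) (hprev : C.prev u ∈ s.verts) : C.weight s u = -2 := by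
  simp only [weight, hu, hd, hnext, hprev, if_true, if_false, and_self]

lemma weight_le_weight_expand [Finite V] (hs : Valid H r s) (hu : u ∈ s.verts)
    (hcard : (outer H s u).ncard ≤ 1) : C.weight s u ≤ C.weight (expand H s v) u := by
  classical
  by_cases hd : Doomed H s u
  · simp only [weight, hd, hd.expand (v := v) hu (hs.stamp_le u hu), if_true, le_refl]
  by_cases hd' : Doomed H (expand H s v) u
  · simp only [weight, hd, hd', if_true, if_false]
    split_ifs <;> norm_num
  have houter : outer H (expand H s v) u = outer H s u := by
    have hne : (outer H (expand H s v) u).Nonempty :=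
      Set.nonempty_iff_ne_empty.2 fun h => hd' (Or.inl h)
    exact Set.eq_of_subset_of_ncard_le (outer_anti verts_subset_expand)
      (hcard.trans (hne.ncard_pos (Set.toFinite _))) (Set.toFinite _)
  have hmem : ∀ z, H.Adj u z → (z ∈ (expand H s v).verts ↔ z ∈ s.verts) := by
    intro z hz
    have hiff : z ∈ outer H (expand H s v) u ↔ z ∈ outer H s u := by rw [houter]
    simpa only [mem_outer, hz, true_and, not_iff_not] using hiff
  by_cases huC : u ∈ C.support
  · simp only [weight, hd, hd', huC, if_true, if_false]
    exact (if_congr (and_congr (hmem _ (C.adj_next u huC)) (hmem _ (C.adj_prev u huC))) rfl rfl).ge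
  · simp only [weight, hd, hd', huC, if_false, le_refl]

open Classical in
/-- The contribution of a childless vertex to the balance since the state `s₀`. -/
noncomputable def oldWeight (s₀ : State V) (u : V) : ℤ :=
  if u ∈ s₀.verts then C.weight s₀ u else -2

lemma oldWeight_of_mem (hu : u ∈ s₀.verts) : C.oldWeight s₀ u = C.weight s₀ u := if_pos hu

lemma oldWeight_of_notMem (hu : u ∉ s₀.verts) : C.oldWeight s₀ u = -2 := if_neg hu

lemma oldWeight_reverse (s₀ : State V) (u : V) : C.reverse.oldWeight s₀ u = C.oldWeight s₀ u := by
  simp only [oldWeight, weight_reverse]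

/-- What a vertex that is childless in `s` contributes to the potential of `s` in excess of its
contribution to the balance since `s₀`. -/
noncomputable def gain (s₀ s : State V) (u : V) : ℤ := C.weight s u - C.oldWeight s₀ u

lemma gain_reverse (s₀ s : State V) (u : V) : C.reverse.gain s₀ s u = C.gain s₀ s u := by
  simp only [gain, weight_reverse, oldWeight_reverse]

lemma two_le_gain (hu : u ∉ s₀.verts) (h : u ∉ C.support ∨ Doomed H s u) :
    2 ≤ C.gain s₀ s u := by
  have hweight : 0 ≤ C.weight s u := h.elim C.weight_nonneg C.weight_nonneg_of_doomed
  rw [gain, C.oldWeight_of_notMem hu]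
  linarith

/-- The neighbours of `w` that were not in the tree when the vertices of the tree added together
with `w` were added, and the covered ones that were added together with `w`. -/
def later (s : State V) (w : V) : Set V :=
  {u | H.Adj w u ∧ (u ∉ s.verts ∨ s.stamp w < s.stamp u ∨ s.stamp u = s.stamp w ∧ u ∈ C.support)}

lemma later_expand (hs : Valid H r s) (hw : w ∈ s.verts) :
    C.later (expand H s v) w = C.later s w := by
  ext u
  simp only [later, Set.mem_ofPred_eq]
  refine and_congr_right fun _ => ?_
  rw [expand_stamp_of_notMem (notMem_outer hw), mem_expand_verts]
  by_cases huo : u ∈ outer H s v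
  · rw [expand_stamp_of_mem huo]
    exact iff_of_true (Or.inr (Or.inl (Nat.lt_succ_of_le (hs.stamp_le w hw)))) (Or.inl huo.2)
  · rw [expand_stamp_of_notMem huo, or_iff_left huo]

variable [Fintype V]

/-- The potential of a state in which O1 applies nowhere. -/
noncomputable def potential (s : State V) : ℤ :=
  6 * (tips s).card - 2 * s.verts.ncard + ∑ u ∈ tips s, C.weight s u

/-- The potential during a series of operations that started from the state `s₀`. -/
noncomputable def balance (s₀ s : State V) : ℤ :=
  6 * (tips s).card - 2 * s.verts.ncard + ∑ u ∈ tips s, C.oldWeight s₀ u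

lemma potential_nonneg_of_card (h : s.verts.ncard ≤ 2 * (tips s).card) : 0 ≤ C.potential s := by
  have hweights : ∑ u ∈ tips s, (-2 : ℤ) ≤ ∑ u ∈ tips s, C.weight s u :=
    Finset.sum_le_sum fun u _ => C.neg_two_le_weight s u
  rw [Finset.sum_const, nsmul_eq_mul] at hweights
  unfold potential
  zify at h
  linarith

lemma potential_eq_balance_add_gain (s₀ s : State V) :
    C.potential s = C.balance s₀ s + ∑ u ∈ tips s, C.gain s₀ s u := by
  simp only [gain, Finset.sum_sub_distrib, potential, balance]
  ring

lemma balance_self (s : State V) : C.balance s s = C.potential s := by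
  rw [balance, potential, Finset.sum_congr rfl fun u hu => C.oldWeight_of_mem (mem_tips.1 hu).1]

lemma balance_reverse (s₀ s : State V) : C.reverse.balance s₀ s = C.balance s₀ s := by
  simp only [balance, oldWeight_reverse]

lemma balance_expand (hs : Valid H r s) (hsub : s₀.verts ⊆ s.verts) (hv : v ∈ s.verts)
    (hne : (outer H s v).Nonempty) :
    C.balance s₀ (expand H s v) =
      C.balance s₀ s + 2 * (outer H s v).ncard - 6 - C.oldWeight s₀ v := by
  rw [balance, balance, hs.card_tips_expand hv hne, ncard_verts_expand,
    hs.sum_tips_expand_const hv hne (C.oldWeight s₀) (-2)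
      fun u hu => C.oldWeight_of_notMem fun h => hu.2 (hsub h)]
  push_cast
  ring

end CycleCover

/-- The vertices added by the last expansion. -/
def lastGroup (s : State V) : Set V := {u | u ∈ s.verts ∧ s.stamp u = s.clock}

lemma Valid.mem_lastGroup_of_le (hs : Valid H r s) (hu : u ∈ s.verts) (h : s.clock ≤ s.stamp u) :
    u ∈ lastGroup s :=
  ⟨hu, (hs.stamp_le u hu).antisymm h⟩

lemma Valid.lastGroup_expand (hs : Valid H r s) : lastGroup (expand H s v) = outer H s v := by
  ext u
  refine ⟨fun ⟨hu, hstamp⟩ => ?_, fun hu => ⟨Or.inr hu, expand_stamp_of_mem hu⟩⟩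
  by_contra huo
  rw [expand_stamp_of_notMem huo, expand_clock] at hstamp
  exact (hs.stamp_le u (hu.resolve_right huo)).not_gt (hstamp ▸ Nat.lt_succ_self _)

/-! ### Series of operations between two states in which O1 applies nowhere -/

section Finite

variable [Finite V]

lemma NoO1.ncard_outer_le_one (hN : NoO1 H s₀) (hsub : s₀.verts ⊆ s.verts) (hu : u ∈ s₀.verts) :
    (outer H s u).ncard ≤ 1 :=
  (ncard_outer_anti hsub).trans (hN.ncard_le_one hu)

lemma CycleCover.ncard_later_le (C : CycleCover H) (hs : Valid H r s) (hw : w ∈ lastGroup s) :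
    (C.later s w).ncard ≤
      (outer H s w).ncard + ({u ∈ lastGroup s | u ∈ C.support} \ {w}).ncard := by
  refine (Set.ncard_le_ncard ?_ (Set.toFinite _)).trans (Set.ncard_union_le _ _)
  rintro u ⟨hadj, hu⟩
  by_cases hus : u ∈ s.verts
  · rcases hu with hu | hu | ⟨hstamp, huC⟩
    · exact absurd hus hu
    · exact absurd (hs.stamp_le u hus) (hw.2 ▸ hu).not_ge
    · exact Or.inr ⟨⟨⟨hus, hstamp.trans hw.2⟩, huC⟩, hadj.ne'⟩
  · exact Or.inl ⟨hadj, hus⟩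

/- If the expanded vertex `v` belongs to the last group, then `w` is the only covered vertex of the
group; otherwise the depth-first rule prefers `v` only if O1 does not apply at `w`. -/
lemma CycleCover.ncard_later_le_two (C : CycleCover H) (hs : Valid H r s)
    (hlast : (lastGroup s).ncard = 2) (hv : v ∈ s.verts) (hvC : v ∉ C.support)
    (hcard : (outer H s v).ncard = 2)
    (largest : ∀ w, O1 H s w → (outer H s w).ncard ≤ (outer H s v).ncard)
    (dfs : ∀ w, O1 H s w → (outer H s w).ncard = (outer H s v).ncard → s.stamp w ≤ s.stamp v)
    (hwC : w ∈ C.support) (hw : w ∈ lastGroup s) : (C.later s w).ncard ≤ 2 := by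
  have hle := C.ncard_later_le hs hw
  have houter : (outer H s w).ncard ≤ 2 := by
    by_contra! hlt
    exact (hcard ▸ largest w ⟨hw.1, hlt.le⟩).not_gt hlt
  have hothers : (lastGroup s \ {w}).ncard = 1 := by
    rw [Set.ncard_sdiff_singleton_of_mem hw, hlast]
  by_cases hvlast : v ∈ lastGroup s
  · have hempty : {u ∈ lastGroup s | u ∈ C.support} \ {w} = ∅ := by
      refine Set.eq_empty_of_forall_notMem fun a ⟨⟨ha, haC⟩, haw⟩ => hvC ?_
      have hvw : v ∈ lastGroup s \ {w} := ⟨hvlast, fun h => hvC (h ▸ hwC)⟩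
      rwa [(Set.ncard_le_one (Set.toFinite _)).1 hothers.le v hvw a ⟨ha, haw⟩]
    rw [hempty, Set.ncard_empty] at hle
    exact hle.trans houter
  · have houter_le_one : (outer H s w).ncard ≤ 1 := by
      by_contra! hlt
      exact hvlast (hs.mem_lastGroup_of_le hv
        (hw.2 ▸ dfs w ⟨hw.1, hlt⟩ ((houter.antisymm hlt).trans hcard.symm)))
    have hcovered : ({u ∈ lastGroup s | u ∈ C.support} \ {w}).ncard ≤ 1 :=
      (Set.ncard_le_ncard (Set.sdiff_subset_sdiff_left (Set.sep_subset _ _))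
        (Set.toFinite _)).trans hothers.le
    omega

end Finite

variable [Fintype V]

/-- The state `s` was reached from `s₀`, where O1 applies nowhere, by an operation that expanded
two vertices in succession and operations O1. -/
structure InSeries (C : CycleCover H) (s₀ s : State V) : Prop where
  noO1 : NoO1 H s₀
  verts_subset : s₀.verts ⊆ s.verts
  weight_le : ∀ u ∈ s₀.verts, C.weight s₀ u ≤ C.weight s u
  notMem_of_mem_lastGroup : ∀ u ∈ lastGroup s, u ∉ s₀.verts
  mem_tips_of_mem_lastGroup : ∀ u ∈ lastGroup s, u ∈ tips s
  two_le_ncard_lastGroup : 2 ≤ (lastGroup s).ncard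
  balance_ge : -2 ≤ C.balance s₀ s ∨ -4 ≤ C.balance s₀ s ∧ (lastGroup s).ncard = 2 ∧
    ∀ w ∈ C.support, w ∈ s.verts → w ∉ s₀.verts → s.stamp w < s.clock → (C.later s w).ncard ≤ 2

lemma InSeries.reverse {C : CycleCover H} (h : InSeries C s₀ s) : InSeries C.reverse s₀ s where
  noO1 := h.noO1
  verts_subset := h.verts_subset
  weight_le u hu := by simpa only [C.weight_reverse] using h.weight_le u hu
  notMem_of_mem_lastGroup := h.notMem_of_mem_lastGroup
  mem_tips_of_mem_lastGroup := h.mem_tips_of_mem_lastGroup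
  two_le_ncard_lastGroup := h.two_le_ncard_lastGroup
  balance_ge := by
    rw [C.balance_reverse]
    exact h.balance_ge

lemma Valid.mem_tips_of_mem_lastGroup_expand (hs : Valid H r s) (hv : v ∈ s.verts)
    (hu : u ∈ lastGroup (expand H s v)) : u ∈ tips (expand H s v) :=
  hs.mem_tips_expand_of_mem_outer hv (hs.lastGroup_expand ▸ hu)

lemma CycleCover.balance_expand_expand (C : CycleCover H) (hs : Valid H r s) (hv : v ∈ s.verts)
    (hvC : v ∉ C.support) (hd : ¬ Doomed H s v) (hx : outer H s v = {x})
    (hne : (outer H s x).Nonempty) :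
    C.balance s (expand H (expand H s v) x) = C.potential s + 2 * (outer H s x).ncard - 8 := by
  have hxv : x ∈ outer H s v := hx ▸ rfl
  have houter := outer_expand_of_eq_singleton hx
  rw [C.balance_expand (hs.expand hv) verts_subset_expand (Or.inr hxv) (houter ▸ hne),
    C.balance_expand hs subset_rfl hv ⟨x, hxv⟩, C.balance_self, C.oldWeight_of_notMem hxv.2,
    C.oldWeight_of_mem hv, C.weight_eq_zero hvC hd, houter, hx, Set.ncard_singleton]
  push_cast
  ring

lemma InSeries.start (C : CycleCover H) (hs : Valid H r s) (hN : NoO1 H s)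
    (hpot : 0 ≤ C.potential s) (hv : v ∈ s.verts) (hvC : v ∉ C.support) (hd : ¬ Doomed H s v)
    (hx : outer H s v = {x}) (hxC : x ∉ C.support) (hcard : 2 ≤ (outer H s x).ncard) :
    InSeries C s (expand H (expand H s v) x) := by
  have hxv : x ∈ outer H s v := hx ▸ rfl
  have hs' := hs.expand hv
  have hlast : lastGroup (expand H (expand H s v) x) = outer H s x := by
    rw [hs'.lastGroup_expand, outer_expand_of_eq_singleton hx]
  have hbalance := C.balance_expand_expand hs hv hvC hd hx (outer_nonempty_of_two_le hcard)
  refine ⟨hN, verts_subset_expand.trans verts_subset_expand, fun u hu => ?_, fun u hu => ?_,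
    fun u hu => hs'.mem_tips_of_mem_lastGroup_expand (Or.inr hxv) hu, hlast ▸ hcard, ?_⟩
  · exact (C.weight_le_weight_expand hs hu (hN.ncard_le_one hu)).trans
      (C.weight_le_weight_expand hs' (verts_subset_expand hu)
        (hN.ncard_outer_le_one verts_subset_expand hu))
  · exact notMem_outer.mt (not_not_intro (hlast ▸ hu))
  rcases hcard.lt_or_eq with hlt | heq
  · exact Or.inl (by omega)
  refine Or.inr ⟨by omega, hlast ▸ heq.symm, fun w hwC hw hws hstamp => ?_⟩
  rcases hw with (hw | hw) | hw
  · exact absurd hw hws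
  · rw [hx, Set.mem_singleton_iff] at hw
    exact absurd (hw ▸ hwC) hxC
  · exact absurd hstamp (by rw [expand_stamp_of_mem hw]; exact lt_irrefl _)

protected lemma InSeries.expand {C : CycleCover H} (h : InSeries C s₀ s) (hs : Valid H r s)
    (hvC : v ∉ C.support) (hv : O1 H s v)
    (largest : ∀ w, O1 H s w → (outer H s w).ncard ≤ (outer H s v).ncard)
    (dfs : ∀ w, O1 H s w → (outer H s w).ncard = (outer H s v).ncard → s.stamp w ≤ s.stamp v) :
    InSeries C s₀ (expand H s v) := by
  have hvs₀ : v ∉ s₀.verts := fun hmem =>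
    (h.noO1.ncard_outer_le_one h.verts_subset hmem).not_gt hv.2
  have hlast : lastGroup (expand H s v) = outer H s v := hs.lastGroup_expand
  have hbalance := C.balance_expand hs h.verts_subset hv.1 (outer_nonempty_of_two_le hv.2)
  rw [C.oldWeight_of_notMem hvs₀] at hbalance
  have hcard := hv.2
  refine ⟨h.noO1, h.verts_subset.trans verts_subset_expand, fun u hu => ?_, fun u hu hmem => ?_,
    fun u hu => hs.mem_tips_of_mem_lastGroup_expand hv.1 hu, hlast ▸ hcard, ?_⟩
  · exact (h.weight_le u hu).trans (C.weight_le_weight_expand hs (h.verts_subset hu)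
      (h.noO1.ncard_outer_le_one h.verts_subset hu))
  · exact (hlast ▸ hu : u ∈ outer H s v).2 (h.verts_subset hmem)
  rcases h.balance_ge with hbal | ⟨hbal, hprevLast, hlater⟩
  · exact Or.inl (by omega)
  rcases hcard.lt_or_eq with hlt | heq
  · exact Or.inl (by omega)
  refine Or.inr ⟨by omega, hlast ▸ heq.symm, fun w hwC hw hws₀ hstamp => ?_⟩
  have hwo : w ∉ outer H s v := fun hwo => (expand_stamp_of_mem hwo ▸ hstamp).false
  have hws := hw.resolve_right hwo
  rw [C.later_expand hs hws]
  rw [expand_stamp_of_notMem hwo, expand_clock] at hstamp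
  rcases (hs.stamp_le w hws).lt_or_eq with hlt | hclock
  · exact hlater w hwC hws hws₀ hlt
  · exact C.ncard_later_le_two hs hprevLast hv.1 hvC heq.symm largest dfs hwC ⟨hws, hclock⟩

end Branching

namespace Branching

variable {V : Type u} {H : SimpleGraph V} {C : CycleCover H} {s s₀ t : State V} {r u v w x y z : V}

/-! ### The potential at the end of a series -/

namespace CycleCover

variable (C)

open Classical in
/-- The covered vertices that were added to the tree between the states `s₀` and `s`. -/
noncomputable def newCovered (s₀ s : State V) : Finset V :=
  {u ∈ C.support | u ∈ s.verts ∧ u ∉ s₀.verts}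

variable {C} in
lemma mem_newCovered :
    u ∈ C.newCovered s₀ s ↔ u ∈ C.support ∧ u ∈ s.verts ∧ u ∉ s₀.verts := by
  simp only [newCovered, Finset.mem_filter]

variable [Finite V]

lemma three_le_ncard_later (hwC : w ∈ C.support)
    (hne : (outer H s w).Nonempty) (hnext : C.next w ∈ s.verts)
    (hnext_stamp : s.stamp w ≤ s.stamp (C.next w)) (hprev : C.prev w ∈ s.verts)
    (hprev_stamp : s.stamp w ≤ s.stamp (C.prev w)) : 3 ≤ (C.later s w).ncard := by
  have hlater : ∀ a ∈ C.support, H.Adj w a → s.stamp w ≤ s.stamp a → a ∈ C.later s w :=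
    fun a haC ha hstamp => ⟨ha, Or.inr (hstamp.lt_or_eq.imp_right fun heq => ⟨heq.symm, haC⟩)⟩
  obtain ⟨x, hx⟩ := hne
  have hsub : ({x, C.next w, C.prev w} : Set V) ⊆ C.later s w := by
    rintro a (rfl | rfl | rfl)
    · exact ⟨hx.1, Or.inl hx.2⟩
    · exact hlater _ (C.next_mem w hwC) (C.adj_next w hwC) hnext_stamp
    · exact hlater _ (C.prev_mem w hwC) (C.adj_prev w hwC) hprev_stamp
  exact (Set.ncard_eq_three.2 ⟨x, C.next w, C.prev w, fun h => hx.2 (h ▸ hnext),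
    fun h => hx.2 (h ▸ hprev), C.next_ne_prev w hwC, rfl⟩).ge.trans
      (Set.ncard_le_ncard hsub (Set.toFinite _))

/- If the new covered vertices formed whole cycles, then the earliest of them would have two cycle
neighbours that are not older and one neighbour outside the tree. -/
lemma exists_next_notMem (hs : Valid H r s)
    (hlater : ∀ w ∈ C.support, w ∈ s.verts → w ∉ s₀.verts → s.stamp w < s.clock →
      (C.later s w).ncard ≤ 2)
    (hcard : (lastGroup s).ncard = 2) (hv : v ∈ lastGroup s) (hvC : v ∉ C.support)
    (hne : (C.newCovered s₀ s).Nonempty) (hd : ∀ u ∈ C.newCovered s₀ s, ¬ Doomed H s u) :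
    ∃ u ∈ C.newCovered s₀ s, C.next u ∉ C.newCovered s₀ s := by
  by_contra! hnext
  have hprev := C.prev_mem_of_next_mem (fun u hu => (mem_newCovered.1 hu).1) hnext
  obtain ⟨w, hwA, hmin⟩ := Finset.exists_min_image _ s.stamp hne
  obtain ⟨hwC, hw, hws₀⟩ := mem_newCovered.1 hwA
  obtain ⟨hnC, hn, -⟩ := mem_newCovered.1 (hnext w hwA)
  obtain ⟨-, hp, -⟩ := mem_newCovered.1 (hprev w hwA)
  have hstamp : s.stamp w < s.clock := by
    by_contra! hclock
    have hsub : ({v, w, C.next w} : Set V) ⊆ lastGroup s := by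
      rintro a (rfl | rfl | rfl)
      · exact hv
      · exact hs.mem_lastGroup_of_le hw hclock
      · exact hs.mem_lastGroup_of_le hn (hclock.trans (hmin _ (hnext w hwA)))
    have hle := Set.ncard_le_ncard hsub (Set.toFinite _)
    rw [hcard, Set.ncard_eq_three.2 ⟨v, w, C.next w, fun hvw => hvC (hvw ▸ hwC),
      fun hvn => hvC (hvn ▸ hnC), (C.adj_next w hwC).ne, rfl⟩] at hle
    exact absurd hle (by decide)
  have houter : (outer H s w).Nonempty :=
    Set.nonempty_iff_ne_empty.2 fun hempty => hd w hwA (Or.inl hempty)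
  exact absurd ((C.three_le_ncard_later hwC houter hn (hmin _ (hnext w hwA)) hp
    (hmin _ (hprev w hwA))).trans (hlater w hwC hw hws₀ hstamp)) (by decide)

end CycleCover

section Finite

variable [Finite V]

lemma NoO1.doomed_expand (hN : NoO1 H s) (hx : x ∈ outer H s v) (hu : u ∈ s.verts)
    (hux : H.Adj u x) : Doomed H (expand H s v) u :=
  Or.inl (hN.eq_empty hu ⟨hux, hx.2⟩ verts_subset_expand (Or.inr hx))

/- The depth-first rule would continue at `x`, the vertex added last. -/
lemma CompletesAvoiding.doomed_expand {K : Finset V} (hs : Valid H r s) (hv : v ∈ s.verts)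
    (hx : outer H s v = {x}) (hxK : x ∈ K) (hN : NoO1 H (expand H s v))
    (hA : CompletesAvoiding H K (expand H s v)) : Doomed H (expand H s v) x := by
  by_contra hd
  have hxv : x ∈ outer H s v := hx ▸ rfl
  have hs' := hs.expand hv
  obtain ⟨w, hw, hwK, hstamp⟩ := hA.exists_later hs' hN (Or.inr hxv) hd
  rw [expand_stamp_of_mem hxv] at hstamp
  have hwlast := hs'.mem_lastGroup_of_le hw hstamp
  rw [hs.lastGroup_expand, hx, Set.mem_singleton_iff] at hwlast
  exact hwK (hwlast ▸ hxK)

lemma O2.exists_adj_not_doomed (h : O2 H s v x) (hN : NoO1 H s)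
    (hxd : ¬ Doomed H (expand H s v) x) : ∃ u ∈ s.verts, H.Adj u x ∧ u ≠ v ∧ ¬ Doomed H s u := by
  obtain ⟨hv, hx, hinner⟩ := h
  have hne : outer H s x ≠ ∅ := fun hempty =>
    hxd (Or.inl ((outer_expand_of_eq_singleton hx).trans hempty))
  have hxv : x ∈ outer H s v := hx ▸ rfl
  obtain ⟨u, ⟨hxu, hu⟩, huv⟩ := Set.exists_ne_of_one_lt_ncard (hinner.resolve_left hne) v
  refine ⟨u, hu, hxu.symm, huv, fun hd => hne ?_⟩
  obtain ⟨w, hnbrs, -⟩ := hd.neighborSet_eq (hN.eq_singleton hu ⟨hxu.symm, hxv.2⟩)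
  have hvw : v = w := (hnbrs ▸ hxv.1.symm : v ∈ ({u, w} : Set V)).resolve_left huv.symm
  refine Set.eq_empty_of_forall_notMem fun z hz => hz.2 ?_
  rcases (hnbrs ▸ hz.1 : z ∈ ({u, w} : Set V)) with rfl | hzw
  · exact hu
  · exact Set.mem_singleton_iff.1 hzw ▸ hvw ▸ hv

lemma two_le_weight_expand_sub (C : CycleCover H) (hN : NoO1 H s) (hx : x ∈ outer H s v)
    (hxC : x ∉ C.support) (hu : u ∈ s.verts) (hux : H.Adj u x) (hd : ¬ Doomed H s u) :
    2 ≤ C.weight (expand H s v) u - C.weight s u := by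
  have hd' := hN.doomed_expand hx hu hux
  by_cases huC : u ∈ C.support
  · have hmem : ∀ z ∈ C.support, H.Adj u z → z ∈ s.verts := by
      intro z hzC huz
      by_contra hzs
      have hzx : z ∈ ({x} : Set V) := hN.eq_singleton hu ⟨hux, hx.2⟩ ▸ ⟨huz, hzs⟩
      exact hxC (Set.mem_singleton_iff.1 hzx ▸ hzC)
    rw [C.weight_eq_neg_two huC hd (hmem _ (C.next_mem u huC) (C.adj_next u huC))
      (hmem _ (C.prev_mem u huC) (C.adj_prev u huC))]
    linarith [C.weight_nonneg_of_doomed hd']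
  · linarith [C.weight_eq_two huC hd', C.weight_eq_zero huC hd]

end Finite

variable [Fintype V]

namespace InSeries

lemma gain_nonneg (h : InSeries C s₀ s) (u : V) : 0 ≤ C.gain s₀ s u := by
  rw [CycleCover.gain]
  by_cases hu : u ∈ s₀.verts
  · rw [C.oldWeight_of_mem hu]
    linarith [h.weight_le u hu]
  · rw [C.oldWeight_of_notMem hu]
    linarith [C.neg_two_le_weight s u]

lemma balance_add_sum_gain_le_potential (h : InSeries C s₀ s) {A : Finset V} (hA : A ⊆ tips s) :
    C.balance s₀ s + ∑ u ∈ A, C.gain s₀ s u ≤ C.potential s := by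
  rw [C.potential_eq_balance_add_gain s₀ s]
  gcongr
  exact fun u _ _ => h.gain_nonneg u

lemma neg_four_le_balance (h : InSeries C s₀ s) : -4 ≤ C.balance s₀ s :=
  h.balance_ge.elim (fun hbal => by linarith) And.left

lemma potential_nonneg_of_pair (h : InSeries C s₀ s) (hxy : x ≠ y) (hx : x ∈ tips s)
    (hy : y ∈ tips s) (hgx : 2 ≤ C.gain s₀ s x) (hgy : 2 ≤ C.gain s₀ s y) :
    0 ≤ C.potential s := by
  classical
  have hle := h.balance_add_sum_gain_le_potential
    (Finset.insert_subset hx (Finset.singleton_subset_iff.2 hy))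
  rw [Finset.sum_pair hxy] at hle
  linarith [h.neg_four_le_balance]

/- The alternatives at the end show that the witnesses found in the two directions of the cycles
are distinct. -/
lemma exists_gain (h : InSeries C s₀ s) (huC : u ∈ C.support) (hu : u ∈ s.verts)
    (hu₀ : u ∉ s₀.verts) (hd : ¬ Doomed H s u)
    (hnext : ¬ (C.next u ∈ s.verts ∧ C.next u ∉ s₀.verts)) :
    ∃ a ∈ C.support, a ∈ s.verts ∧ 1 ≤ C.gain s₀ s a ∧
      (a ∉ s₀.verts ∧ C.next a ∉ s.verts ∨ a ∈ s₀.verts ∧ C.prev a ∉ s₀.verts) := by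
  by_cases hns : C.next u ∈ s.verts
  · have hns₀ : C.next u ∈ s₀.verts := not_not.1 fun hn => hnext ⟨hns, hn⟩
    have hprev : C.prev (C.next u) ∉ s₀.verts := by rwa [C.prev_next u huC]
    have hout : u ∈ outer H s₀ (C.next u) := ⟨(C.adj_next u huC).symm, hu₀⟩
    have hdoomed : Doomed H s (C.next u) :=
      Or.inl (h.noO1.eq_empty hns₀ hout h.verts_subset hu)
    refine ⟨C.next u, C.next_mem u huC, hns, ?_, Or.inr ⟨hns₀, hprev⟩⟩
    rw [CycleCover.gain, C.oldWeight_of_mem hns₀, C.weight_eq_neg_one (C.next_mem u huC)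
      (fun hd₀ => C.notMem_of_doomed hd₀ hout huC) (Or.inr hprev)]
    linarith [C.weight_nonneg_of_doomed hdoomed]
  · refine ⟨u, huC, hu, ?_, Or.inl ⟨hu₀, hns⟩⟩
    rw [CycleCover.gain, C.oldWeight_of_notMem hu₀, C.weight_eq_neg_one huC hd (Or.inl hns)]
    norm_num

lemma exists_two_gains (h : InSeries C s₀ s) (hN : NoO1 H s)
    (hd : ∀ u ∈ C.newCovered s₀ s, ¬ Doomed H s u)
    (hnext : ∃ u ∈ C.newCovered s₀ s, C.next u ∉ C.newCovered s₀ s)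
    (hprev : ∃ u ∈ C.newCovered s₀ s, C.prev u ∉ C.newCovered s₀ s) :
    ∃ a ∈ C.support, ∃ b ∈ C.support, a ≠ b ∧ a ∈ s.verts ∧ b ∈ s.verts ∧
      1 ≤ C.gain s₀ s a ∧ 1 ≤ C.gain s₀ s b := by
  obtain ⟨e, he, hne⟩ := hnext
  obtain ⟨e', he', hpe'⟩ := hprev
  obtain ⟨heC, hes, hes₀⟩ := CycleCover.mem_newCovered.1 he
  obtain ⟨he'C, he's, he's₀⟩ := CycleCover.mem_newCovered.1 he'
  obtain ⟨a, haC, ha, hga, hcase_a⟩ := h.exists_gain heC hes hes₀ (hd e he)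
    fun hn => hne (CycleCover.mem_newCovered.2 ⟨C.next_mem e heC, hn⟩)
  obtain ⟨b, hbC, hb, hgb, hcase_b⟩ := h.reverse.exists_gain he'C he's he's₀ (hd e' he')
    fun hp => hpe' (CycleCover.mem_newCovered.2 ⟨C.prev_mem e' he'C, hp⟩)
  rw [C.gain_reverse] at hgb
  refine ⟨a, haC, b, hbC, ?_, ha, hb, hga, hgb⟩
  rintro rfl
  have not_both : ∀ s' : State V, NoO1 H s' → a ∈ s'.verts → C.next a ∉ s'.verts →
      C.prev a ∉ s'.verts → False := fun s' hN' has' hn hp => by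
    have hsingle := hN'.eq_singleton has' (⟨C.adj_next a haC, hn⟩ : C.next a ∈ outer H s' a)
    have hp' : C.prev a ∈ outer H s' a := ⟨C.adj_prev a haC, hp⟩
    rw [hsingle] at hp'
    exact C.next_ne_prev a haC hp'.symm
  rcases hcase_a with ⟨ha₀, hna⟩ | ⟨ha₀, hpa⟩ <;> rcases hcase_b with ⟨hb₀, hpb⟩ | ⟨hb₀, hnb⟩
  · exact not_both s hN ha hna hpb
  · exact ha₀ hb₀
  · exact hb₀ ha₀
  · exact not_both s₀ h.noO1 ha₀ hnb hpa

lemma exists_lastGroup_notMem (h : InSeries C s₀ s) (hs : Valid H r s) (hN : NoO1 H s)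
    (hA : CompletesAvoiding H C.support s) (hd : ∃ y ∈ lastGroup s, ¬ Doomed H s y) :
    ∃ v ∈ lastGroup s, v ∉ C.support ∧ 2 ≤ C.gain s₀ s v := by
  obtain ⟨y, hy, hyd⟩ := hd
  obtain ⟨v, hv, hvC, hstamp⟩ := hA.exists_later hs hN hy.1 hyd
  have hvlast := hs.mem_lastGroup_of_le hv (hy.2 ▸ hstamp)
  exact ⟨v, hvlast, hvC, C.two_le_gain (h.notMem_of_mem_lastGroup v hvlast) (Or.inl hvC)⟩

lemma potential_nonneg (h : InSeries C s₀ s) (hs : Valid H r s) (hN : NoO1 H s)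
    (hA : CompletesAvoiding H C.support s) : 0 ≤ C.potential s := by
  classical
  have htips : ∀ u ∈ C.support, u ∈ s.verts → u ∈ tips s := fun u => (hA.childless hs).mem_tips
  by_cases hall : ∀ y ∈ lastGroup s, Doomed H s y
  · have hgain : ∀ y ∈ lastGroup s, 2 ≤ C.gain s₀ s y := fun y hy =>
      C.two_le_gain (h.notMem_of_mem_lastGroup y hy) (Or.inr (hall y hy))
    obtain ⟨a, b, ha, hb, hab⟩ := (Set.one_lt_ncard_iff (Set.toFinite _)).1 h.two_le_ncard_lastGroup
    exact h.potential_nonneg_of_pair hab (h.mem_tips_of_mem_lastGroup a ha)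
      (h.mem_tips_of_mem_lastGroup b hb) (hgain a ha) (hgain b hb)
  push Not at hall
  obtain ⟨v, hv, hvC, hgv⟩ := h.exists_lastGroup_notMem hs hN hA hall
  have hvtips := h.mem_tips_of_mem_lastGroup v hv
  rcases h.balance_ge with hbal | ⟨hbal, hcard, hlater⟩
  · have hle := h.balance_add_sum_gain_le_potential (Finset.singleton_subset_iff.2 hvtips)
    rw [Finset.sum_singleton] at hle
    linarith
  obtain ⟨y, hy, hyv⟩ := Set.exists_ne_of_one_lt_ncard h.two_le_ncard_lastGroup v
  have hys₀ := h.notMem_of_mem_lastGroup y hy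
  by_cases hyC : y ∈ C.support
  swap
  · exact h.potential_nonneg_of_pair hyv (h.mem_tips_of_mem_lastGroup y hy) hvtips
      (C.two_le_gain hys₀ (Or.inl hyC)) hgv
  by_cases hd : ∃ u ∈ C.newCovered s₀ s, Doomed H s u
  · obtain ⟨u, hu, hud⟩ := hd
    obtain ⟨huC, hus, hus₀⟩ := CycleCover.mem_newCovered.1 hu
    exact h.potential_nonneg_of_pair (by rintro rfl; exact hvC huC) (htips u huC hus) hvtips
      (C.two_le_gain hus₀ (Or.inr hud)) hgv
  push Not at hd
  have hne : (C.newCovered s₀ s).Nonempty := ⟨y, CycleCover.mem_newCovered.2 ⟨hyC, hy.1, hys₀⟩⟩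
  obtain ⟨a, haC, b, hbC, hab, ha, hb, hga, hgb⟩ := h.exists_two_gains hN hd
    (C.exists_next_notMem hs hlater hcard hv hvC hne hd)
    (C.reverse.exists_next_notMem hs hlater hcard hv hvC hne hd)
  have hle := h.balance_add_sum_gain_le_potential (Finset.insert_subset hvtips
    (Finset.insert_subset (htips a haC ha) (Finset.singleton_subset_iff.2 (htips b hbC hb))))
  rw [Finset.sum_insert, Finset.sum_pair hab] at hle
  · linarith
  · rw [Finset.mem_insert, Finset.mem_singleton]
    rintro (rfl | rfl) <;> contradiction

end InSeries

/-! ### The potential under a single expansion -/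

lemma potential_le_potential_expand (C : CycleCover H) (hs : Valid H r s) (hN : NoO1 H s)
    (hv : v ∈ s.verts) (hvC : v ∉ C.support) (hd : ¬ Doomed H s v) (hx : outer H s v = {x})
    {A : Finset V} (hA : ∀ u ∈ A, u ∈ tips s ∧ u ≠ v)
    (hgain : 2 ≤ C.weight (expand H s v) x +
      ∑ u ∈ A, (C.weight (expand H s v) u - C.weight s u)) :
    C.potential s ≤ C.potential (expand H s v) := by
  classical
  have hne := outer_nonempty_of_eq_singleton hx
  have hnew : (outer H s v).toFinset = {x} := by simp only [hx, Set.toFinset_singleton]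
  have hmono : ∑ u ∈ A, (C.weight (expand H s v) u - C.weight s u) ≤
      ∑ u ∈ (tips s).erase v, (C.weight (expand H s v) u - C.weight s u) := by
    refine Finset.sum_le_sum_of_subset_of_nonneg
      (fun u hu => Finset.mem_erase.2 (hA u hu).symm) fun u hu _ => sub_nonneg.2 ?_
    have hus := (mem_tips.1 (Finset.mem_of_mem_erase hu)).1
    exact C.weight_le_weight_expand hs hus (hN.ncard_le_one hus)
  simp only [Finset.sum_sub_distrib] at hmono hgain
  rw [Finset.sum_erase_eq_sub (f := C.weight s)
    (hs.mem_tips_of_outer_nonempty hv hne), C.weight_eq_zero hvC hd] at hmono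
  rw [CycleCover.potential, CycleCover.potential, hs.card_tips_expand hv hne,
    hs.sum_tips_expand hv hne, hnew, Finset.sum_singleton, ncard_verts_expand, hx,
    Set.ncard_singleton]
  push_cast
  linarith

lemma potential_le_expand_of_mem (C : CycleCover H) (hs : Valid H r s) (hN : NoO1 H s)
    (hv : v ∈ s.verts) (hvC : v ∉ C.support) (hd : ¬ Doomed H s v) (hx : outer H s v = {x})
    (hxC : x ∈ C.support) (hxd : Doomed H (expand H s v) x) :
    C.potential s ≤ C.potential (expand H s v) := by
  classical
  have hxv : x ∈ outer H s v := hx ▸ rfl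
  have hcovered : ∀ z ∈ C.support, H.Adj x z → (C.next z = x ∨ C.prev z = x) →
      (z ∈ tips s ∧ z ≠ v) ∧ 1 ≤ C.weight (expand H s v) z - C.weight s z := by
    intro z hzC hxz hzx
    have hzs : z ∈ s.verts := by
      by_contra hzs
      exact C.notMem_of_doomed hxd (outer_expand_of_eq_singleton hx ▸ ⟨hxz, hzs⟩) hzC
    have hxz' : x ∈ outer H s z := ⟨hxz.symm, hxv.2⟩
    refine ⟨⟨hs.mem_tips_of_outer_nonempty hzs ⟨x, hxz'⟩, fun hzv => hvC (hzv ▸ hzC)⟩, ?_⟩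
    rw [C.weight_eq_neg_one hzC (fun hzd => C.notMem_of_doomed hzd hxz' hxC)
      (hzx.imp (fun h => by rw [h]; exact hxv.2) fun h => by rw [h]; exact hxv.2)]
    linarith [C.weight_nonneg_of_doomed (hN.doomed_expand hxv hzs hxz.symm)]
  obtain ⟨hnext, hgnext⟩ := hcovered _ (C.next_mem x hxC) (C.adj_next x hxC)
    (Or.inr (C.prev_next x hxC))
  obtain ⟨hprev, hgprev⟩ := hcovered _ (C.prev_mem x hxC) (C.adj_prev x hxC)
    (Or.inl (C.next_prev x hxC))
  refine potential_le_potential_expand C hs hN hv hvC hd hx (A := {C.next x, C.prev x}) ?_ ?_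
  · intro u hu
    rcases Finset.mem_insert.1 hu with rfl | hu
    · exact hnext
    · rwa [Finset.mem_singleton.1 hu]
  · rw [Finset.sum_pair (C.next_ne_prev x hxC)]
    linarith [C.weight_nonneg_of_doomed hxd]

lemma potential_le_expand (C : CycleCover H) (hs : Valid H r s) (hN : NoO1 H s)
    (hvC : v ∉ C.support) (hO2 : O2 H s v x) (hd : ¬ Doomed H s v)
    (hN' : NoO1 H (expand H s v)) (hA : CompletesAvoiding H C.support (expand H s v)) :
    C.potential s ≤ C.potential (expand H s v) := by
  have hv := hO2.1
  have hx := hO2.2.1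
  have hxv : x ∈ outer H s v := hx ▸ rfl
  by_cases hxC : x ∈ C.support
  · exact potential_le_expand_of_mem C hs hN hv hvC hd hx hxC (hA.doomed_expand hs hv hx hxC hN')
  by_cases hxd : Doomed H (expand H s v) x
  · refine potential_le_potential_expand C hs hN hv hvC hd hx (A := ∅) (by simp) ?_
    rw [Finset.sum_empty, C.weight_eq_two hxC hxd, add_zero]
  · obtain ⟨u, hu, hux, huv, hud⟩ := hO2.exists_adj_not_doomed hN hxd
    refine potential_le_potential_expand C hs hN hv hvC hd hx (A := {u}) ?_ ?_
    · simpa using ⟨hs.mem_tips_of_outer_nonempty hu ⟨x, hux, hxv.2⟩, huv⟩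
    · rw [Finset.sum_singleton]
      linarith [two_le_weight_expand_sub C hN hxv hxC hu hux hud,
        C.weight_nonneg (s := expand H s v) hxC]

/-! ### The number of leaves -/

/-- The invariant of executions that never expand a vertex of the support of `C`. -/
inductive Invariant (C : CycleCover H) (r : V) : State V → Prop
  /-- only O1 has been applied so far -/
  | opening {s : State V} (hcard : s.verts.ncard ≤ 2 * (tips s).card) : Invariant C r s
  /-- O1 applies nowhere -/
  | settled {s : State V} (hpot : 0 ≤ C.potential s) (hN : NoO1 H s) : Invariant C r s
  | series {s₀ s : State V} (h : InSeries C s₀ s) : Invariant C r s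
  /-- O2 was applied and O1 applies next -/
  | single {s : State V} {v x : V} (hs : Valid H r s) (hN : NoO1 H s) (hpot : 0 ≤ C.potential s)
      (hv : v ∈ s.verts) (hvC : v ∉ C.support) (hd : ¬ Doomed H s v) (hx : outer H s v = {x})
      (hO1 : ¬ NoO1 H (expand H s v)) : Invariant C r (expand H s v)

lemma invariant_init (C : CycleCover H) (r : V) : Invariant C r (init r) := by
  have hr : r ∈ tips (init r) := mem_tips.2 ⟨rfl, fun _ hw => hw⟩
  have hcard : (init r).verts.ncard = 1 := Set.ncard_singleton r
  have hpos := Finset.card_pos.2 ⟨r, hr⟩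
  exact .opening (by omega)

lemma Invariant.potential_nonneg (h : Invariant C r s) (hs : Valid H r s) (hN : NoO1 H s)
    (hA : CompletesAvoiding H C.support s) : 0 ≤ C.potential s := by
  cases h with
  | opening hcard => exact C.potential_nonneg_of_card hcard
  | settled hpot => exact hpot
  | series h => exact h.potential_nonneg hs hN hA
  | single _ _ _ _ _ _ _ hO1 => exact absurd hN hO1

lemma Invariant.expand_of_O1 (h : Invariant C r s) (hs : Valid H r s) (hvC : v ∉ C.support)
    (hv : O1 H s v) (largest : ∀ w, O1 H s w → (outer H s w).ncard ≤ (outer H s v).ncard)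
    (dfs : ∀ w, O1 H s w → (outer H s w).ncard = (outer H s v).ncard → s.stamp w ≤ s.stamp v) :
    Invariant C r (expand H s v) := by
  cases h with
  | opening hcard =>
    have htips := hs.card_tips_expand hv.1 (outer_nonempty_of_two_le hv.2)
    have hverts := ncard_verts_expand (H := H) (s := s) (v := v)
    have htwo := hv.2
    exact .opening (by omega)
  | settled _ hN => exact absurd hv (hN v)
  | series h => exact .series (h.expand hs hvC hv largest dfs)
  | @single s₀ v' x hs₀ hN hpot hv' hv'C hd hx =>
    obtain rfl : v = x := by
      rcases hv.1 with hvs₀ | hvx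
      · exact absurd hv.2 (hN.ncard_outer_le_one verts_subset_expand hvs₀).not_gt
      · exact Set.mem_singleton_iff.1 (hx ▸ hvx)
    exact .series (.start C hs₀ hN hpot hv' hv'C hd hx hvC
      (outer_expand_of_eq_singleton hx ▸ hv.2))

lemma Invariant.step (h : Invariant C r s) (hs : Valid H r s) (hst : Step H s t)
    (hA : CompletesAvoiding H C.support t) : Invariant C r t := by
  have hAs := hA.of_step hst
  have hK := hA.childless (hst.valid hs)
  cases hst with
  | o1 v hv largest dfs =>
    exact h.expand_of_O1 hs (hK.notMem (.refl _) hv.1 (outer_nonempty_of_two_le hv.2))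
      hv largest dfs
  | o2 v x hN hv hlatest =>
    have hpot := h.potential_nonneg hs hN hAs
    have hvC := hK.notMem (.refl _) hv.1 (outer_nonempty_of_eq_singleton hv.2.1)
    have hd := hv.not_doomed hN hlatest
    by_cases hN' : NoO1 H (expand H s v)
    · exact .settled (hpot.trans (potential_le_expand C hs hN hvC hv hd hN' hA)) hN'
    · exact .single hs hN hpot hv.1 hvC hd hv.2.1 hN'
  | o3 v x hN hv =>
    have hvC := hK.notMem extends_expand hv.1 (outer_nonempty_of_eq_singleton hv.2.1)
    have hxC := hK.notMem (.refl _) hv.mem_verts_expand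
      (outer_expand_of_eq_singleton hv.2.1 ▸ outer_nonempty_of_two_le hv.2.2)
    exact .series (.start C hs hN (h.potential_nonneg hs hN hAs) hv.1 hvC hv.not_doomed hv.2.1
      hxC hv.2.2)

lemma Invariant.of_reflTransGen (hrs : Relation.ReflTransGen (Step H) (init r) s)
    (hA : CompletesAvoiding H C.support s) : Invariant C r s := by
  induction hrs with
  | refl => exact invariant_init C r
  | tail hrs hst ih =>
    exact (ih (hA.of_step hst)).step ((valid_init H r).of_reflTransGen hrs) hst hA

lemma CycleCover.potential_of_verts_eq_univ (C : CycleCover H) (huniv : s.verts = Set.univ)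
    (hC : C.support ⊆ tips s) :
    C.potential s = 8 * (tips s).card - 2 * Fintype.card V - 2 * C.support.card := by
  classical
  have hd : ∀ u, Doomed H s u := fun u => Or.inl (by rw [outer, huniv, Set.sdiff_univ])
  have hweight : ∀ u, C.weight s u = 2 - if u ∈ C.support then 2 else 0 := by
    intro u
    split_ifs with hu
    · simp only [weight, hu, hd u, if_true, sub_self]
    · rw [C.weight_eq_two hu (hd u), sub_zero]
  simp only [potential, hweight, Finset.sum_sub_distrib, Finset.sum_ite_mem,
    Finset.inter_eq_right.2 hC, Finset.sum_const, nsmul_eq_mul, huniv, Set.ncard_univ,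
    Nat.card_eq_fintype_card]
  ring

theorem card_add_card_le_four_mul {f : State V} (hf : IsResult H r f) (huniv : f.verts = Set.univ)
    (C : CycleCover H) (hC : C.support ⊆ tips f) :
    Fintype.card V + C.support.card ≤ 4 * (tips f).card := by
  have hA : CompletesAvoiding H C.support f :=
    ⟨f, .refl, hf.2, fun w hw => ((mem_tips.1 (hC hw)).2 w rfl).symm⟩
  have hpot := (Invariant.of_reflTransGen hf.1 hA).potential_nonneg
    ((valid_init H r).of_reflTransGen hf.1) (noO1_of_final hf.2) hA
  rw [C.potential_of_verts_eq_univ huniv hC] at hpot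
  omega

end Branching

section Simplify

variable {V : Type u} {G : SimpleGraph V} {a b u v : V}

/-! ### Deleting the edges between vertices of degree 2 -/

lemma simplify_le (G : SimpleGraph V) : simplify G ≤ G := fun _ _ h => h.1

lemma neighborSet_simplify (h : deg G v ≠ 2) : (simplify G).neighborSet v = G.neighborSet v :=
  Set.ext fun _ => ⟨fun hw => hw.1, fun hw => ⟨hw, fun hdeg => h hdeg.1⟩⟩

lemma deg_eq_two_of_deg_simplify (h : deg (simplify G) v = 2) : deg G v = 2 := by
  by_contra hdeg
  rw [deg, neighborSet_simplify hdeg] at h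
  exact hdeg h

lemma exists_adj_mem_notMem (h : G.Reachable a b) {S : Set V} (ha : a ∈ S) (hb : b ∉ S) :
    ∃ x ∈ S, ∃ y ∉ S, G.Adj x y := by
  obtain ⟨p⟩ := h
  obtain ⟨d, -, hfst, hsnd⟩ := p.exists_boundary_dart S ha hb
  exact ⟨d.fst, hfst, d.snd, hsnd, d.adj⟩

lemma NoTwoVertexSeparator.preconnected (hG : NoTwoVertexSeparator G) {S : Set V}
    (hS : ∀ v ∈ S, deg G v = 2) : (G.induce Sᶜ).Preconnected := not_not.1 (hG S hS)

lemma NoTwoVertexSeparator.eq_or_eq_or_eq (hG : NoTwoVertexSeparator G)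
    (hu : G.neighborSet u = {a, b}) (ha : deg G a = 2) (hb : deg G b = 2) (v : V) :
    v = u ∨ v = a ∨ v = b := by
  have hconn := hG.preconnected (S := {a, b}) (by rintro w (rfl | rfl); exacts [ha, hb])
  have hu_notMem : u ∉ ({a, b} : Set V) := fun h => G.irrefl (hu.superset h)
  by_contra hv
  rw [not_or] at hv
  obtain ⟨x, rfl, y, -, hadj⟩ := exists_adj_mem_notMem (hconn ⟨u, hu_notMem⟩ ⟨v, hv.2⟩)
    (S := {⟨u, hu_notMem⟩}) rfl fun h => hv.1 (congrArg Subtype.val h)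
  exact y.2 (hu.subset hadj)

lemma exists_adj_deg_ne_two [Fintype V] (hG : NoTwoVertexSeparator G) (ht : ¬ IsTriangle G)
    (hu : deg G u = 2) : ∃ w, G.Adj u w ∧ deg G w ≠ 2 := by
  by_contra! hdeg
  obtain ⟨a, b, hab, hnbrs⟩ := Set.ncard_eq_two.1 hu
  have hua : G.Adj u a := (hnbrs ▸ Or.inl rfl : a ∈ G.neighborSet u)
  have hub : G.Adj u b := (hnbrs ▸ Or.inr rfl : b ∈ G.neighborSet u)
  have hall := hG.eq_or_eq_or_eq hnbrs (hdeg a hua) (hdeg b hub)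
  have hadj : G.Adj a b := by
    obtain ⟨w, hw, hwu⟩ := Set.exists_ne_of_one_lt_ncard
      (one_lt_two.trans_eq (hdeg a hua).symm) u
    obtain rfl := ((hall w).resolve_left hwu).resolve_left (G.ne_of_adj hw).symm
    exact hw
  refine ht ⟨?_, ?_⟩
  · classical
    refine Finset.card_eq_three.2 ⟨u, a, b, hua.ne, hub.ne, hab, ?_⟩
    ext v
    simpa using hall v
  · ext x y
    rw [SimpleGraph.top_adj]
    refine ⟨fun h => h.ne, fun h => ?_⟩
    rcases hall x with rfl | rfl | rfl <;> rcases hall y with rfl | rfl | rfl <;>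
      first | exact absurd rfl h | assumption | (apply SimpleGraph.Adj.symm; assumption)

lemma simplify_induce_preconnected [Fintype V] (hG : NoTwoVertexSeparator G)
    (ht : ¬ IsTriangle G) {X : Set V} (hX : ∀ x ∈ X, deg G x = 2) :
    ((simplify G).induce Xᶜ).Preconnected := by
  have hconn := hG.preconnected (S := {v | deg G v = 2}) fun _ hv => hv
  have hnotMem : ∀ w, deg G w ≠ 2 → w ∈ Xᶜ := fun w hw hwX => hw (hX w hwX)
  let φ : G.induce {v | deg G v = 2}ᶜ →g (simplify G).induce Xᶜ :=
    ⟨fun w => ⟨w.1, hnotMem w.1 w.2⟩, fun {x _} h => ⟨h, fun hdeg => x.2 hdeg.1⟩⟩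
  have hexists : ∀ a, ∃ b, ((simplify G).induce Xᶜ).Reachable a (φ b) := by
    intro a
    by_cases ha : deg G a = 2
    · obtain ⟨b, hab, hb⟩ := exists_adj_deg_ne_two hG ht ha
      exact ⟨⟨b, hb⟩, SimpleGraph.Adj.reachable ⟨hab, fun hdeg => hb hdeg.2⟩⟩
    · exact ⟨⟨a, ha⟩, .refl _⟩
  intro a b
  obtain ⟨a', ha⟩ := hexists a
  obtain ⟨b', hb⟩ := hexists b
  exact (ha.trans ((hconn a' b').map φ)).trans hb.symm

lemma parentGraph_adj {p : V → V} : (parentGraph p).Adj a b ↔ a ≠ b ∧ (p a = b ∨ p b = a) :=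
  SimpleGraph.fromRel_adj _ a b

section Leaves

variable [Finite V] {T : SimpleGraph V} {b c : V}

lemma eq_of_mem_leaves (ha : a ∈ leaves T) (hb : T.Adj a b) (hc : T.Adj a c) : b = c :=
  (Set.ncard_le_one (Set.toFinite _)).1 ha b hb c hc

lemma not_adj_of_mem_leaves (hT : T.Connected) (ha : a ∈ leaves T) (hb : b ∈ leaves T)
    (hca : c ≠ a) (hcb : c ≠ b) : ¬ T.Adj a b := by
  intro hab
  obtain ⟨x, hx, y, hy, hxy⟩ := exists_adj_mem_notMem (hT.preconnected a c) (S := {a, b})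
    (Or.inl rfl) (by simp [hca, hcb])
  rcases hx with rfl | rfl
  · exact hy (Or.inr (eq_of_mem_leaves ha hxy hab))
  · exact hy (Or.inl (eq_of_mem_leaves hb hxy hab.symm))

/- If the edge `uv` were deleted, then the leaf `w` would be the only neighbour of the leaf `u`. -/
lemma simplify_adj_of_mem_leaves {v w : V} (hT : T.Connected) (hle : T ≤ simplify G)
    (hu : u ∈ leaves T) (hw : w ∈ leaves T) (huv : G.Adj u v) (huw : G.Adj u w) (hvw : v ≠ w) :
    (simplify G).Adj u v := by
  refine ⟨huv, fun hdeg => ?_⟩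
  have hnbrs : {v, w} = G.neighborSet u :=
    Set.eq_of_subset_of_ncard_le (Set.insert_subset huv (Set.singleton_subset_iff.2 huw))
      (hdeg.1.trans (Set.ncard_pair hvw).symm).le (Set.toFinite _)
  obtain ⟨x, rfl, y, -, huy⟩ := exists_adj_mem_notMem (hT.preconnected u v) (S := {u}) rfl
    huv.ne'
  rcases (hnbrs ▸ (hle huy).1 : y ∈ ({v, w} : Set V)) with rfl | rfl
  · exact (hle huy).2 hdeg
  · exact not_adj_of_mem_leaves hT hu hw huv.ne' hvw huy

end Leaves

end Simplify

namespace Branching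

variable {V : Type u} {G H : SimpleGraph V} {s f : State V} {r u v w x y : V}

lemma Valid.parentGraph_le (hs : Valid H r s) : parentGraph s.parent ≤ H := by
  have hadj : ∀ a, s.parent a ≠ a → H.Adj (s.parent a) a := fun a ha =>
    hs.parent_adj a (hs.mem_of_parent_ne ha) fun har => ha (har ▸ hs.root_parent)
  intro a b hab
  obtain ⟨hne, rfl | rfl⟩ := parentGraph_adj.1 hab
  · exact (hadj a hne.symm).symm
  · exact hadj b hne

section Finite

variable [Finite V]

/-! ### BRANCHING ends with a spanning tree -/

lemma IsResult.deg_eq_two (hf : IsResult H r f) (hv : v ∈ f.verts) (hx : x ∈ outer H f v) :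
    deg H x = 2 ∧ (outer H f x).Nonempty := by
  have hN := noO1_of_final hf.2
  have hsingle := hN.eq_singleton hv hx
  have hd : Doomed H f v := by
    by_contra hd
    obtain ⟨z, hz⟩ := hN.exists_O2_or_O3 hv hd
    exact no_O2_O3_of_final hf.2 hz
  obtain ⟨w, hnbrs, hwv, -⟩ := hd.neighborSet_eq hsingle
  refine ⟨by rw [deg, hnbrs, Set.ncard_pair hwv.symm], Set.nonempty_iff_ne_empty.2 fun hempty => ?_⟩
  exact no_O2_O3_of_final hf.2 (Or.inl ⟨hv, hsingle, Or.inl hempty⟩)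

end Finite

/- A vertex left over has degree 2 if it is adjacent to the tree. So the tree is reached from every
other vertex that is left over only through vertices of degree 2, which do not separate. -/
lemma IsResult.verts_eq_univ [Fintype V] (hG : NoTwoVertexSeparator G) (ht : ¬ IsTriangle G)
    (hf : IsResult (simplify G) r f) : f.verts = Set.univ := by
  have hroot := ((valid_init (simplify G) r).of_reflTransGen hf.1).root_mem
  let X : Set V := {x | ∃ v ∈ f.verts, x ∈ outer (simplify G) f v}
  have hdeg : ∀ x ∈ X, deg G x = 2 := fun x ⟨_, hv, hx⟩ =>
    deg_eq_two_of_deg_simplify (hf.deg_eq_two hv hx).1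
  have hall : ∀ y ∉ f.verts, y ∈ X := by
    by_contra! hy
    obtain ⟨y, hy, hyX⟩ := hy
    have hrX : r ∉ X := fun ⟨_, _, hr⟩ => hr.2 hroot
    obtain ⟨a, ha, b, hb, hab⟩ := exists_adj_mem_notMem
      (simplify_induce_preconnected hG ht hdeg ⟨r, hrX⟩ ⟨y, hyX⟩) (S := {z | z.1 ∈ f.verts})
      hroot hy
    exact b.2 ⟨a.1, ha, hab, hb⟩
  refine Set.eq_univ_iff_forall.2 fun x => not_not.1 fun hx => ?_
  obtain ⟨v, hv, hxv⟩ := hall x hx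
  obtain ⟨y, hxy, hy⟩ := (hf.deg_eq_two hv hxv).2
  exact hxy.2 ⟨hdeg x (hall x hx), hdeg y (hall y hy)⟩

/-! ### The spanning tree given by the parents -/

lemma Valid.parentGraph_adj_parent (hs : Valid H r s) (hv : v ∈ s.verts) (hvr : v ≠ r) :
    (parentGraph s.parent).Adj v (s.parent v) :=
  parentGraph_adj.2 ⟨(hs.parent_adj v hv hvr).ne', Or.inl rfl⟩

lemma Valid.reachable_root (hs : Valid H r s) (hv : v ∈ s.verts) :
    (parentGraph s.parent).Reachable v r := by
  induction hk : s.stamp v using Nat.strong_induction_on generalizing v with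
  | _ k ih =>
    by_cases hvr : v = r
    · rw [hvr]
    · exact (hs.parentGraph_adj_parent hv hvr).reachable.trans
        (ih _ (hk ▸ hs.stamp_parent_lt v hv hvr) (hs.parent_mem v hv hvr) rfl)

lemma edgeSet_parentGraph_subset {p : V → V} (hr : p r = r) :
    (parentGraph p).edgeSet ⊆ (fun v => s(v, p v)) '' {r}ᶜ := by
  have hne : ∀ c, c ≠ p c → c ∈ ({r}ᶜ : Set V) := fun c hc hcr => hc (by rw [hcr, hr])
  intro e he
  induction e using Sym2.ind with
  | _ a b =>
    rw [SimpleGraph.mem_edgeSet, parentGraph_adj] at he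
    obtain ⟨hab, rfl | rfl⟩ := he
    · exact ⟨a, hne a hab, rfl⟩
    · exact ⟨b, hne b hab.symm, Sym2.eq_swap⟩

section Finite

variable [Finite V]

lemma Valid.isTree (hs : Valid H r s) (huniv : s.verts = Set.univ) :
    (parentGraph s.parent).IsTree := by
  have hreach : ∀ v, (parentGraph s.parent).Reachable v r := fun v =>
    hs.reachable_root (huniv ▸ Set.mem_univ v)
  have : Nonempty V := ⟨r⟩
  have hconn : (parentGraph s.parent).Connected := ⟨fun a b => (hreach a).trans (hreach b).symm⟩
  have hcard := (Set.ncard_le_ncard (edgeSet_parentGraph_subset hs.root_parent)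
    (Set.toFinite _)).trans (Set.ncard_image_le (Set.toFinite _))
  rw [Set.ncard_compl, Set.ncard_singleton] at hcard
  have hge := hconn.card_vert_le_card_edgeSet_add_one
  have hpos : 0 < Nat.card V := Nat.card_pos
  refine SimpleGraph.isTree_iff_connected_and_card.2 ⟨hconn, ?_⟩
  rw [Nat.card_coe_set_eq] at hge ⊢
  omega

end Finite

variable [Fintype V]

lemma tips_subset_leaves (s : State V) : (tips s : Set V) ⊆ leaves (parentGraph s.parent) := by
  intro u hu
  have hsub : (parentGraph s.parent).neighborSet u ⊆ {s.parent u} := by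
    intro w hw
    obtain ⟨hne, hwu | hwu⟩ := parentGraph_adj.1 hw
    · exact hwu.symm
    · exact absurd ((mem_tips.1 hu).2 w hwu).symm hne
  exact (Set.ncard_le_ncard hsub (Set.toFinite _)).trans (Set.ncard_singleton _).le

/- A leaf with a child is the root, whose children are all its neighbours in `H`. -/
lemma Valid.mem_tips_of_mem_leaves (hs : Valid H r s) (huniv : s.verts = Set.univ)
    (hu : u ∈ leaves (parentGraph s.parent)) (hux : H.Adj u x) (huy : H.Adj u y) (hxy : x ≠ y) :
    u ∈ tips s := by
  have hmem : ∀ v, v ∈ s.verts := fun v => huniv ▸ Set.mem_univ v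
  refine mem_tips.2 ⟨hmem u, fun w hwu => ?_⟩
  by_contra hne
  by_cases hur : u = r
  · subst hur
    rcases hs.root_children with hverts | hchild
    · exact hne (hverts ▸ hmem w : w ∈ ({u} : Set V))
    · have hadj : ∀ z, H.Adj u z → (parentGraph s.parent).Adj u z := fun z hz =>
        parentGraph_adj.2 ⟨hz.ne, Or.inr (hchild z hz)⟩
      exact hxy (eq_of_mem_leaves hu (hadj x hux) (hadj y huy))
  · have hwr : w ≠ r := by
      rintro rfl
      exact hne (hs.root_parent.symm.trans hwu)
    have hparent : s.parent u = w :=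
      eq_of_mem_leaves hu (hs.parentGraph_adj_parent (hmem u) hur)
        (parentGraph_adj.2 ⟨Ne.symm hne, Or.inr hwu⟩)
    have hlt := hs.stamp_parent_lt u (hmem u) hur
    have hlt' := hs.stamp_parent_lt w (hmem w) hwr
    rw [hparent] at hlt
    rw [hwu] at hlt'
    exact hlt.asymm hlt'

end Branching

/-! ### Disjoint cycles -/

section Cycles

variable {V : Type u} {G : SimpleGraph V} {u : V}

lemma getElem_tail_support {a b : V} (p : G.Walk a b) {j : ℕ} (hj : j < p.support.tail.length) :
    p.support.tail[j] = p.getVert (j + 1) := by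
  have hlen : p.support.tail.length = p.length := by simp
  rw [p.getVert_eq_support_getElem (by omega), List.getElem_tail]

open Classical in
lemma adj_formPerm_tail_support {a : V} {p : G.Walk a a} (hp : p.IsCycle)
    (hu : u ∈ p.support.tail) : G.Adj u (p.support.tail.formPerm u) := by
  have hlen : p.support.tail.length = p.length := by simp
  obtain ⟨j, hj, rfl⟩ := List.getElem_of_mem hu
  rw [List.formPerm_apply_getElem _ hp.support_nodup, getElem_tail_support,
    getElem_tail_support]
  rcases (show j + 1 ≤ _ from hj).lt_or_eq with hlt | heq
  · rw [Nat.mod_eq_of_lt hlt]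
    exact p.adj_getVert_succ (by omega)
  · rw [heq, Nat.mod_self, hlen, p.getVert_length]
    simpa using p.adj_getVert_succ (i := 0) (by omega)

open Classical in
lemma formPerm_formPerm_ne {α : Type*} {l : List α} (hl : l.Nodup) (hlen : 3 ≤ l.length) {u : α}
    (hu : u ∈ l) : l.formPerm (l.formPerm u) ≠ u := by
  obtain ⟨j, hj, rfl⟩ := List.getElem_of_mem hu
  rw [List.formPerm_apply_getElem _ hl, List.formPerm_apply_getElem _ hl, Ne, hl.getElem_inj_iff,
    Nat.mod_add_mod]
  intro h
  rcases lt_or_ge (j + 2) l.length with hlt | hge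
  · rw [Nat.mod_eq_of_lt hlt] at h
    omega
  · rw [Nat.mod_eq_sub_mod hge, Nat.mod_eq_of_lt (by omega)] at h
    omega

/-- `σ` moves every vertex of `K` to a neighbour, with orbits of length at least `3` on `K`: this
is how a set `K` covered by disjoint cycles is encoded. -/
structure PermutesCycles (G : SimpleGraph V) (K : Finset V) (σ : Equiv.Perm V) : Prop where
  mem : ∀ u ∈ K, σ u ∈ K
  adj : ∀ u ∈ K, G.Adj u (σ u)
  apply_apply_ne : ∀ u ∈ K, σ (σ u) ≠ u

namespace PermutesCycles

variable {K : Finset V} {σ : Equiv.Perm V}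

lemma symm_mem (hσ : PermutesCycles G K σ) (hu : u ∈ K) : σ.symm u ∈ K :=
  Equiv.Perm.perm_symm_on_of_perm_on_finset hσ.mem hu

lemma adj_symm (hσ : PermutesCycles G K σ) (hu : u ∈ K) : G.Adj u (σ.symm u) := by
  have hadj := hσ.adj _ (hσ.symm_mem hu)
  rw [σ.apply_symm_apply] at hadj
  exact hadj.symm

lemma apply_ne_symm (hσ : PermutesCycles G K σ) (hu : u ∈ K) : σ u ≠ σ.symm u := fun h =>
  hσ.apply_apply_ne u hu (by rw [h, σ.apply_symm_apply])

open Classical in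
lemma union_list (hσ : PermutesCycles G K σ) (hfix : ∀ u ∉ K, σ u = u) {l : List V}
    (hKl : ∀ u ∈ K, u ∉ l) (hl : l.Nodup) (hlen : 3 ≤ l.length)
    (hadj : ∀ u ∈ l, G.Adj u (l.formPerm u)) :
    PermutesCycles G (K ∪ l.toFinset) (l.formPerm * σ) := by
  have hKσ : ∀ u ∈ K, (l.formPerm * σ) u = σ u := fun u hu =>
    List.formPerm_apply_of_notMem (hKl _ (hσ.mem u hu))
  have hlσ : ∀ u ∈ l, (l.formPerm * σ) u = l.formPerm u := fun u hu =>
    congrArg l.formPerm (hfix u fun huK => hKl u huK hu)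
  have hmem : ∀ {u}, u ∈ K ∪ l.toFinset ↔ u ∈ K ∨ u ∈ l := by simp
  refine ⟨fun u hu => hmem.2 ?_, fun u hu => ?_, fun u hu => ?_⟩ <;>
    rcases hmem.1 hu with hu | hu
  · exact Or.inl (hKσ u hu ▸ hσ.mem u hu)
  · exact Or.inr (hlσ u hu ▸ List.formPerm_apply_mem_of_mem hu)
  · exact hKσ u hu ▸ hσ.adj u hu
  · exact hlσ u hu ▸ hadj u hu
  · rw [hKσ u hu, hKσ _ (hσ.mem u hu)]
    exact hσ.apply_apply_ne u hu
  · rw [hlσ u hu, hlσ _ (List.formPerm_apply_mem_of_mem hu)]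
    exact formPerm_formPerm_ne hl hlen hu

end PermutesCycles

/- On every cycle, the permutation is the rotation by one vertex. -/
lemma exists_perm_of_isCycle {k : ℕ} {a : Fin k → V} (c : ∀ i, G.Walk (a i) (a i))
    (hc : ∀ i, (c i).IsCycle) (hdisj : ∀ i j, i ≠ j → (c i).support.Disjoint (c j).support) :
    ∃ (K : Finset V) (σ : Equiv.Perm V), 3 * k ≤ K.card ∧ (∀ u ∈ K, ∃ i, u ∈ (c i).support) ∧
      (∀ u ∉ K, σ u = u) ∧ PermutesCycles G K σ := by
  classical
  induction k with
  | zero => exact ⟨∅, 1, by simp, by simp, by simp, by simp, by simp, by simp⟩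
  | succ k ih =>
    obtain ⟨K, σ, hcard, hcover, hfix, hσ⟩ := ih (fun i => c i.castSucc) (fun i => hc _)
      fun i j hij => hdisj _ _ ((Fin.castSucc_injective k).ne hij)
    set l := (c (Fin.last k)).support.tail with hl
    have hnodup : l.Nodup := (hc _).support_nodup
    have hlen : 3 ≤ l.length := by simpa [hl] using (hc (Fin.last k)).three_le_length
    have hKl : ∀ u ∈ K, u ∉ l := fun u hu hul =>
      let ⟨i, hi⟩ := hcover u hu
      hdisj _ _ i.castSucc_lt_last.ne hi (List.mem_of_mem_tail hul)
    refine ⟨K ∪ l.toFinset, l.formPerm * σ, ?_, ?_, fun u hu => ?_, hσ.union_list hfix hKl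
      hnodup hlen fun u => adj_formPerm_tail_support (hc _)⟩
    · rw [Finset.card_union_of_disjoint
        (Finset.disjoint_left.2 fun u hu hul => hKl u hu (List.mem_toFinset.1 hul)),
        List.toFinset_card_of_nodup hnodup]
      omega
    · intro u hu
      rcases Finset.mem_union.1 hu with hu | hu
      · exact (hcover u hu).imp' Fin.castSucc fun i hi => hi
      · exact ⟨Fin.last k, List.mem_of_mem_tail (List.mem_toFinset.1 hu)⟩
    · rw [Finset.notMem_union, List.mem_toFinset] at hu
      rw [Equiv.Perm.mul_apply, hfix u hu.1, List.formPerm_apply_of_notMem hu.2]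

lemma HasDisjointCycles.exists_perm {S : Set V} {k : ℕ} (h : HasDisjointCycles (G.induce S) k) :
    ∃ (K : Finset V) (σ : Equiv.Perm V), 3 * k ≤ K.card ∧ ↑K ⊆ S ∧
      PermutesCycles G K σ := by
  obtain ⟨a, c, hc, hdisj⟩ := h
  let φ : G.induce S →g G := (SimpleGraph.Embedding.induce S).toHom
  have hφ : Function.Injective φ := Subtype.val_injective
  obtain ⟨K, σ, hcard, hcover, -, hσ⟩ := exists_perm_of_isCycle (fun i => (c i).map φ)
    (fun i => (hc i).map hφ) fun i j hij => by
      simpa only [SimpleGraph.Walk.support_map] using (List.disjoint_map hφ (hdisj i j hij))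
  refine ⟨K, σ, hcard, fun u hu => ?_, hσ⟩
  obtain ⟨i, hi⟩ := hcover u hu
  rw [SimpleGraph.Walk.support_map] at hi
  obtain ⟨w, -, rfl⟩ := List.mem_map.1 hi
  exact w.2

lemma isManyLeafTree_of_card [Fintype V] {T : SimpleGraph V} (hle : T ≤ G) (hT : T.IsTree)
    (h : ∀ (K : Finset V) (σ : Equiv.Perm V), ↑K ⊆ leaves T → PermutesCycles G K σ →
      Fintype.card V + K.card ≤ 4 * (leaves T).ncard) : IsManyLeafTree G T := by
  refine ⟨hle, hT, fun k hk => ?_⟩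
  obtain ⟨K, σ, hcard, hK, hσ⟩ := hk.exists_perm
  have hle : Fintype.card V + 3 * k ≤ 4 * (leaves T).ncard :=
    (Nat.add_le_add_left hcard _).trans (h K σ hK hσ)
  rw [ge_iff_le, div_le_iff₀' (by norm_num)]
  exact_mod_cast hle

end Cycles

namespace Branching

variable {V : Type u} {G H : SimpleGraph V} {f s : State V} {K : Finset V} {r u z : V}

/-- The cycles of a permutation, as a cycle cover. -/
def CycleCover.ofPerm {σ : Equiv.Perm V} (hσ : PermutesCycles H K σ)
    (hK : ∀ u ∈ K, ∃ p, p ∉ K ∧ H.Adj u p) : CycleCover H where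
  support := K
  next := σ
  prev := σ.symm
  next_mem := hσ.mem
  prev_mem _ := hσ.symm_mem
  adj_next := hσ.adj
  adj_prev _ := hσ.adj_symm
  next_prev u _ := σ.apply_symm_apply u
  prev_next u _ := σ.symm_apply_apply u
  next_ne_prev _ := hσ.apply_ne_symm
  exists_adj_notMem := hK

variable [Fintype V]

lemma Valid.exists_adj_notMem_of_subset_tips (hs : Valid H r s) (huniv : s.verts = Set.univ)
    (hK : K ⊆ tips s) (hu : u ∈ K) (hz : H.Adj u z) : ∃ p, p ∉ K ∧ H.Adj u p := by
  have hmem : ∀ v, v ∈ s.verts := fun v => huniv ▸ Set.mem_univ v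
  have htip : ∀ w, s.parent w ∈ K → s.parent w = w := fun w hw =>
    ((mem_tips.1 (hK hw)).2 w rfl).symm
  by_cases hur : u = r
  · subst hur
    exfalso
    rcases hs.root_children with hverts | hchild
    · exact hz.ne (hverts ▸ hmem z : z ∈ ({u} : Set V)).symm
    · exact hz.ne ((hchild z hz).symm.trans (htip z (by rwa [hchild z hz])))
  · have hadj := hs.parent_adj u (hmem u) hur
    exact ⟨s.parent u, fun hp => hadj.ne (htip u hp), hadj.symm⟩

theorem IsResult.isManyLeafTree (hG : NoTwoVertexSeparator G) (ht : ¬ IsTriangle G)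
    (hf : IsResult (simplify G) r f) : IsManyLeafTree G (parentGraph f.parent) := by
  have huniv := hf.verts_eq_univ hG ht
  have hs := (valid_init (simplify G) r).of_reflTransGen hf.1
  have htree := hs.isTree huniv
  refine isManyLeafTree_of_card (hs.parentGraph_le.trans (simplify_le G)) htree
    fun K σ hK hσ => ?_
  have hσ' : PermutesCycles (simplify G) K σ :=
    ⟨hσ.mem, fun u hu => simplify_adj_of_mem_leaves htree.connected hs.parentGraph_le (hK hu)
      (hK (hσ.symm_mem hu)) (hσ.adj u hu) (hσ.adj_symm hu) (hσ.apply_ne_symm hu), hσ.apply_apply_ne⟩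
  have htips : K ⊆ tips f := fun u hu => hs.mem_tips_of_mem_leaves huniv (hK hu) (hσ'.adj u hu)
    (hσ'.adj_symm hu) (hσ'.apply_ne_symm hu)
  have hmain := card_add_card_le_four_mul hf huniv (.ofPerm hσ' fun u hu =>
    hs.exists_adj_notMem_of_subset_tips huniv htips hu (hσ'.adj u hu)) htips
  have hleaves : (tips f).card ≤ (leaves (parentGraph f.parent)).ncard := by
    rw [← Set.ncard_coe_finset]
    exact Set.ncard_le_ncard (tips_subset_leaves f) (Set.toFinite _)
  exact hmain.trans (Nat.mul_le_mul_left 4 hleaves)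

lemma isManyLeafTree_of_isTriangle (hG : IsTriangle G) (r : V) :
    IsManyLeafTree G (parentGraph fun _ => r) := by
  obtain ⟨hcard, rfl⟩ := hG
  set s := expand (⊤ : SimpleGraph V) (init r) r
  have hs : Valid ⊤ r s := (valid_init ⊤ r).expand rfl
  have houter : ∀ w, w ≠ r → w ∈ outer ⊤ (init r) r := fun w hw => ⟨hw.symm, hw⟩
  have huniv : s.verts = Set.univ :=
    Set.eq_univ_iff_forall.2 fun w => (em (w = r)).imp id (houter w)
  have hparent : s.parent = fun _ => r := by
    funext w
    by_cases hw : w = r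
    · rw [hw, hs.root_parent]
    · exact expand_parent_of_mem (houter w hw)
  have htree := hs.isTree huniv
  have hsub := tips_subset_leaves s
  rw [hparent] at htree hsub
  refine isManyLeafTree_of_card le_top htree fun K _ hK _ => ?_
  have hKcard := Set.ncard_le_ncard hK (Set.toFinite _)
  rw [Set.ncard_coe_finset] at hKcard
  obtain ⟨w, hw⟩ := Fintype.exists_ne_of_one_lt_card (by omega : 1 < Fintype.card V) r
  have hleaf : w ∈ leaves (parentGraph fun _ : V => r) := by
    refine hsub (mem_tips.2 ⟨huniv ▸ Set.mem_univ w, fun z hz => ?_⟩)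
    rw [hparent] at hz
    exact absurd hz.symm hw
  have hpos := (Set.ncard_pos (Set.toFinite _)).2 ⟨w, hleaf⟩
  omega

theorem exists_and_forall_isManyLeafTree (hconn : G.Connected) (hG : NoTwoVertexSeparator G) :
    (∃ T : SimpleGraph V, IsManyLeafTree G T) ∧
      (¬ IsTriangle G → ∀ r : V, (∃ s, IsResult (simplify G) r s) ∧
        ∀ s, IsResult (simplify G) r s → IsManyLeafTree G (parentGraph s.parent)) := by
  refine ⟨?_, fun ht r => ⟨exists_isResult _ r, fun s hs => hs.isManyLeafTree hG ht⟩⟩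
  obtain ⟨r⟩ := hconn.nonempty
  by_cases ht : IsTriangle G
  · exact ⟨_, isManyLeafTree_of_isTriangle ht r⟩
  · obtain ⟨s, hs⟩ := exists_isResult (simplify G) r
    exact ⟨_, hs.isManyLeafTree hG ht⟩

end Branching

/-! ### Reasoning about programs -/

namespace RAM

variable {p q : Prog} {b : Test} {s s' : Store} {c c' : ℕ} {Q Q' : Store → Prop}

/-- Total correctness with a time bound: started with memory `s`, the program `p` halts after at
most `c` steps, and `Q` holds then. -/
def Runs (p : Prog) (s : Store) (c : ℕ) (Q : Store → Prop) : Prop :=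
  ∃ s' t, Exec p s s' t ∧ t ≤ c ∧ Q s'

lemma Runs.mono (h : Runs p s c Q) (hc : c ≤ c') (hQ : ∀ s', Q s' → Q' s') : Runs p s c' Q' :=
  let ⟨s', t, hexec, ht, hs'⟩ := h
  ⟨s', t, hexec, ht.trans hc, hQ s' hs'⟩

lemma Runs.mono_time (h : Runs p s c Q) (hc : c ≤ c') : Runs p s c' Q := h.mono hc fun _ => id

lemma Runs.skip (h : Q s) : Runs .skip s 1 Q := ⟨s, 1, .skip s, le_rfl, h⟩

lemma Runs.instr {i : Instr} (h : Q (i.run s)) : Runs (.instr i) s 1 Q :=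
  ⟨_, 1, .instr i s, le_rfl, h⟩

lemma Runs.seq (h : Runs p s c (fun s' => Runs q s' c' Q)) : Runs (.seq p q) s (c + c') Q :=
  let ⟨_, t, hp, ht, s'', t', hq, ht', hs''⟩ := h
  ⟨s'', t + t', .seq hp hq, add_le_add ht ht', hs''⟩

lemma Runs.cond (htrue : b.holds s → Runs p s c Q) (hfalse : ¬ b.holds s → Runs q s c Q) :
    Runs (.cond b p q) s (c + 1) Q := by
  by_cases hb : b.holds s
  · obtain ⟨s', t, hexec, ht, hs'⟩ := htrue hb
    exact ⟨s', t + 1, .condTrue hb hexec, Nat.succ_le_succ ht, hs'⟩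
  · obtain ⟨s', t, hexec, ht, hs'⟩ := hfalse hb
    exact ⟨s', t + 1, .condFalse hb hexec, Nat.succ_le_succ ht, hs'⟩

lemma Runs.loop_of_potential {α : Type*} {I : α → Store → Prop} (φ : α → ℕ)
    (hbody : ∀ a s, I a s → b.holds s → ∃ a' c, Runs p s c (I a') ∧ c + 1 + φ a' ≤ φ a) (a : α)
    (s : Store) (hs : I a s) :
    Runs (.loop b p) s (φ a + 1) fun s' => ∃ a', I a' s' ∧ ¬ b.holds s' := by
  induction hk : φ a using Nat.strong_induction_on generalizing a s with
  | _ k ih =>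
    by_cases hb : b.holds s
    · obtain ⟨a', c, ⟨s', t, hexec, ht, hs'⟩, hφ⟩ := hbody a s hs hb
      obtain ⟨s'', t', hexec', ht', hs''⟩ := ih (φ a') (by omega) a' s' hs' rfl
      exact ⟨s'', t + t' + 1, .loopTrue hb hexec hexec', by omega, hs''⟩
    · exact ⟨s, 1, .loopFalse hb, by omega, a, hs, hb⟩

lemma Runs.loop_list {α : Type*} {l : List α} {f : α → ℕ} {I : List α → Store → Prop}
    (htest : ∀ done rest s, l = done ++ rest → I done s → (b.holds s ↔ rest ≠ []))
    (hbody : ∀ done a rest s, l = done ++ a :: rest → I done s →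
      Runs p s (f a) (I (done ++ [a])))
    (hs : I [] s) : Runs (.loop b p) s ((l.map fun a => f a + 1).sum + 1) (I l) := by
  suffices h : ∀ rest done s, l = done ++ rest → I done s →
      Runs (.loop b p) s ((rest.map fun a => f a + 1).sum + 1) (I l) from h l [] s rfl hs
  intro rest
  induction rest with
  | nil =>
    intro done s hl hI
    have hb : ¬ b.holds s := fun hb => (htest done [] s hl hI).1 hb rfl
    rw [List.append_nil] at hl
    exact ⟨s, 1, .loopFalse hb, le_add_self, hl ▸ hI⟩
  | cons a rest ih =>
    intro done s hl hI
    obtain ⟨s', t, hexec, ht, hI'⟩ := hbody done a rest s hl hI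
    obtain ⟨s'', t', hexec', ht', hI''⟩ := ih (done ++ [a]) s' (by simp [hl]) hI'
    refine ⟨s'', t + t' + 1, .loopTrue ((htest done _ s hl hI).2 (List.cons_ne_nil a rest)) hexec
      hexec', ?_, hI''⟩
    rw [List.map_cons, List.sum_cons]
    omega

/-- Instructions to be executed one after the other. -/
def block : List Instr → Prog
  | [] => .skip
  | i :: l => .seq (.instr i) (block l)

lemma Runs.block : ∀ (l : List Instr) {s : Store},
    Q (l.foldl (fun s i => i.run s) s) → Runs (block l) s (l.length + 1) Q
  | [], _, h => .skip h
  | i :: l, s, h => by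
    have htail : Runs (RAM.block l) (i.run s) (l.length + 1) Q := Runs.block l h
    exact (Runs.seq (.instr htail)).mono_time (Nat.add_comm _ _).le

attribute [simp] Instr.run Test.holds

@[simp]
lemma Store.setReg_reg (s : Store) (x k y : ℕ) :
    (s.setReg x k).reg y = if y = x then k else s.reg y := Function.update_apply _ _ _ _

@[simp]
lemma Store.setReg_arr (s : Store) (x k : ℕ) : (s.setReg x k).arr = s.arr := rfl

@[simp]
lemma Store.setArr_reg (s : Store) (a i k : ℕ) : (s.setArr a i k).reg = s.reg := rfl

@[simp]
lemma Store.setArr_arr (s : Store) (a i k b : ℕ) :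
    (s.setArr a i k).arr b = if b = a then Function.update (s.arr a) i k else s.arr b :=
  Function.update_apply _ _ _ _

/-! ### Adjacency lists -/

section Input

variable {n : ℕ} (L : Fin n → List (Fin n)) (v : Fin n)

lemma inputStore_arr_zero :
    (inputStore L).arr 0 v = ((List.ofFn L).take v).flatten.length := by
  simp [inputStore, v.2.le]

lemma inputStore_arr_zero_succ :
    (inputStore L).arr 0 (v + 1) = (inputStore L).arr 0 v + (L v).length := by
  have hsucc : (v : ℕ) + 1 ≤ n := v.2
  simp [inputStore, hsucc, v.2.le, List.take_add_one]

lemma flatten_ofFn_eq_append : (List.ofFn L).flatten =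
    ((List.ofFn L).take v).flatten ++ (L v ++ ((List.ofFn L).drop (v + 1)).flatten) := by
  conv_lhs => rw [← List.take_append_drop v (List.ofFn L),
    List.drop_eq_getElem_cons (show (v : ℕ) < (List.ofFn L).length by simp)]
  simp

lemma inputStore_arr_one {j : ℕ} (hj : j < (L v).length) :
    (inputStore L).arr 1 ((inputStore L).arr 0 v + j) = ((L v)[j] : ℕ) := by
  change ((List.ofFn L).flatten.map Fin.val).getD _ 0 = _
  rw [inputStore_arr_zero, flatten_ofFn_eq_append L v]
  generalize ((List.ofFn L).take v).flatten = before
  generalize ((List.ofFn L).drop (v + 1)).flatten = after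
  rw [List.getD_eq_getElem _ _ (by simp only [List.length_map, List.length_append]; omega)]
  simp [List.getElem_append_right, List.getElem_append_left, hj]

/-- The members of `l` that do not form a pair of vertices of degree `2` with `v`. -/
def kept (l : List (Fin n)) : List (Fin n) :=
  l.filter fun w => ¬ ((L v).length = 2 ∧ (L w).length = 2)

/-- The adjacency list of `v` in the graph from which all edges between two vertices of degree `2`
have been deleted. -/
def nbrs : List (Fin n) := kept L v (L v)

end Input

/-! ### The memory of the program

Registers: `0` the number of vertices, `1` the constant `1`, `2` the constant `0`, `3` the current
level, `4` the number of vertices of the tree, `5` the next free list cell; the others are for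
temporary use. Arrays: `2` parents, `3` membership in the tree, `4` numbers of neighbours outside
the tree, `5` the first cells of the stacks, `6` and `7` the links and contents of the cells, `8`
marks of the vertices of degree `2`, `9` the vertices of the tree in the order in which they were
added. -/

variable {n : ℕ}

/-- The data that the program maintains. -/
structure Mem (n : ℕ) where
  /-- the vertex set of the tree -/
  tree : Finset (Fin n)
  /-- the parents -/
  par : Fin n → ℕ
  /-- the number of neighbours outside the tree -/
  cnt : Fin n → ℕ
  /-- the stacks, one for each level -/
  stk : ℕ → List (Fin n)
  /-- the current level -/
  cur : ℕ
  /-- the vertices of the tree in the order in which they were added -/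
  ord : List (Fin n)

/-- The cell `p` is the first of a linked list with contents `l`, where `nx` gives the links and
`vl` the contents of the cells. All cells are below `f`, and `0` stands for the empty list. -/
def Chain (nx vl : ℕ → ℕ) (f : ℕ) : ℕ → List (Fin n) → Prop
  | p, [] => p = 0
  | p, u :: l => 0 < p ∧ p < f ∧ vl p = u ∧ Chain nx vl f (nx p) l

lemma Chain.update {nx vl : ℕ → ℕ} {f a b : ℕ} : ∀ {p : ℕ} {l : List (Fin n)},
    Chain nx vl f p l → Chain (Function.update nx f a) (Function.update vl f b) (f + 1) p l
  | _, [], hp => hp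
  | p, u :: l, ⟨hpos, hlt, hval, hnext⟩ => by
    refine ⟨hpos, hlt.trans f.lt_succ_self, ?_, ?_⟩
    · rw [Function.update_of_ne hlt.ne, hval]
    · rw [Function.update_of_ne hlt.ne]
      exact hnext.update

/-- The store `s` holds the data `m` and the adjacency lists `L`. -/
structure Rep (L : Fin n → List (Fin n)) (m : Mem n) (s : Store) : Prop where
  size : s.reg 0 = n
  one : s.reg 1 = 1
  zero : s.reg 2 = 0
  cur : s.reg 3 = m.cur
  top : s.reg 4 = m.ord.length
  free : 0 < s.reg 5
  off : s.arr 0 = (inputStore L).arr 0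
  adj : s.arr 1 = (inputStore L).arr 1
  par : ∀ v : Fin n, s.arr 2 v = m.par v
  tree : ∀ v : Fin n, s.arr 3 v = if v ∈ m.tree then 1 else 0
  cnt : ∀ v : Fin n, s.arr 4 v = m.cnt v
  stk : ∀ j, Chain (s.arr 6) (s.arr 7) (s.reg 5) (s.arr 5 j) (m.stk j)
  two : ∀ v : Fin n, s.arr 8 v = if (L v).length = 2 then 1 else 0
  ord : ∀ i (h : i < m.ord.length), s.arr 9 i = m.ord[i]

lemma update_fin {α : Type*} (f : ℕ → α) (w v : Fin n) (k : α) :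
    Function.update f (w : ℕ) k v = if v = w then k else f v := by
  rw [Function.update_apply]
  simp only [Fin.val_inj]

section Rep

variable {L : Fin n → List (Fin n)} {m : Mem n}

lemma Rep.congr (h : Rep L m s) (harr : s'.arr = s.arr) (hreg : ∀ x < 6, s'.reg x = s.reg x) :
    Rep L m s' := by
  constructor <;> (try simp only [harr]) <;> (try rw [hreg _ (by norm_num)])
  exacts [h.size, h.one, h.zero, h.cur, h.top, h.free, h.off, h.adj, h.par, h.tree, h.cnt, h.stk,
    h.two, h.ord]

lemma Rep.setReg (h : Rep L m s) {x : ℕ} (hx : 6 ≤ x) (k : ℕ) : Rep L m (s.setReg x k) :=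
  h.congr rfl fun y hy => by rw [Store.setReg_reg, if_neg (hy.trans_le hx).ne]

lemma Rep.setCnt (h : Rep L m s) (w : Fin n) (k : ℕ) :
    Rep L { m with cnt := Function.update m.cnt w k } (s.setArr 4 w k) :=
  { h with
    cnt := fun v => by
      change _ = Function.update m.cnt w k v
      rw [Store.setArr_arr, if_pos rfl, update_fin, Function.update_apply, h.cnt] }

lemma Rep.setPar (h : Rep L m s) (w : Fin n) (k : ℕ) :
    Rep L { m with par := Function.update m.par w k } (s.setArr 2 w k) :=
  { h with
    par := fun v => by
      change _ = Function.update m.par w k v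
      rw [Store.setArr_arr, if_pos rfl, update_fin, Function.update_apply, h.par] }

lemma Rep.setTree (h : Rep L m s) (w : Fin n) :
    Rep L { m with tree := insert w m.tree } (s.setArr 3 w 1) :=
  { h with
    tree := fun v => by by_cases hv : v = w <;> simp [update_fin, hv, h.tree] }

lemma Rep.pushOrd (h : Rep L m s) (w : Fin n) :
    Rep L { m with ord := m.ord ++ [w] }
      ((s.setArr 9 m.ord.length w).setReg 4 (m.ord.length + 1)) :=
  { h with
    top := by simp
    ord := fun i hi => by
      rw [Store.setReg_arr, Store.setArr_arr, if_pos rfl, Function.update_apply]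
      rw [List.length_append, List.length_singleton, Nat.lt_succ_iff_lt_or_eq] at hi
      rcases hi with hi | rfl
      · rw [if_neg hi.ne, h.ord i hi, List.getElem_append_left hi]
      · simp }

lemma Rep.setCur (h : Rep L m s) (k : ℕ) : Rep L { m with cur := k } (s.setReg 3 k) :=
  { h with cur := rfl }

lemma Rep.push (h : Rep L m s) (j : ℕ) (u : Fin n) :
    Rep L { m with stk := Function.update m.stk j (u :: m.stk j) }
      ((((s.setArr 7 (s.reg 5) u).setArr 6 (s.reg 5) (s.arr 5 j)).setArr 5 j (s.reg 5)).setReg 5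
        (s.reg 5 + 1)) :=
  { h with
    free := Nat.succ_pos _
    stk := fun i => by
      simp only [Store.setReg_arr, Store.setReg_reg, Store.setArr_arr, Nat.reduceEqDiff, if_true,
        if_false]
      by_cases hi : i = j
      · subst hi
        simp only [Function.update_self]
        refine ⟨h.free, Nat.lt_succ_self _, Function.update_self .., ?_⟩
        rw [Function.update_self]
        exact (h.stk i).update
      · simp only [Function.update_of_ne hi]
        exact (h.stk i).update }

lemma Rep.pop (h : Rep L m s) {j : ℕ} {u : Fin n} {l : List (Fin n)} (hj : m.stk j = u :: l) :
    Rep L { m with stk := Function.update m.stk j l }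
      (s.setArr 5 j (s.arr 6 (s.arr 5 j))) :=
  { h with
    stk := fun i => by
      simp only [Store.setArr_reg, Store.setArr_arr, Nat.reduceEqDiff, if_true, if_false]
      by_cases hi : i = j
      · subst hi
        simp only [Function.update_self]
        have hchain := h.stk i
        rw [hj] at hchain
        exact hchain.2.2.2
      · simp only [Function.update_of_ne hi]
        exact h.stk i }

end Rep

/-! ### Visiting the neighbours of a vertex -/

lemma runs_cond_cond_skip {body : Prog} {x y z : ℕ} {P P' : Prop}
    (hx : s.reg x = s.reg z ↔ P) (hy : s.reg y = s.reg z ↔ P') (hskip : P ∧ P' → Q s)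
    (hbody : ¬ (P ∧ P') → Runs body s c Q) :
    Runs (.cond (.eq x z) (.cond (.eq y z) .skip body) body) s (c + 3) Q := by
  refine .cond (c := c + 2) (fun hP => ?_) fun hP => ?_
  · refine .cond (c := c + 1) (fun hP' => ?_) fun hP' => ?_
    · exact (Runs.skip (hskip ⟨hx.1 hP, hy.1 hP'⟩)).mono_time le_add_self
    · exact (hbody fun h => hP' (hy.2 h.2)).mono_time (Nat.le_succ _)
  · exact (hbody fun h => hP (hx.2 h.1)).mono_time (Nat.le_add_right _ _)

/-- Go to the neighbour at the current position of the adjacency list, execute `body` unless both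
ends of the edge have degree `2`, and advance the position. -/
def forNbrBody (body : Prog) : Prog :=
  .seq (block [.load 11 1 9, .load 12 8 8, .load 13 8 11])
    (.seq (.cond (.eq 12 1) (.cond (.eq 13 1) .skip body) body) (.instr (.succ 9)))

/-- Execute `body` for each neighbour, in register `11`, of the vertex in register `8`. Registers
`9` and `10` hold the current position in the adjacency list and its end. -/
def forNbr (body : Prog) : Prog :=
  .seq (block [.load 9 0 8, .copy 10 8, .succ 10, .load 10 0 10])
    (.loop (.lt 9 10) (forNbrBody body))

section forNbr

variable {L : Fin n → List (Fin n)} {body : Prog} {v : Fin n} {I : List (Fin n) → Store → Prop}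

/-- The loop invariant of `forNbr`, when `done` is the part of the adjacency list of `v` that has
been treated. -/
def NbrInv (L : Fin n → List (Fin n)) (v : Fin n) (I : List (Fin n) → Store → Prop)
    (done : List (Fin n)) (s : Store) : Prop :=
  I (kept L v done) s ∧ s.reg 9 = (inputStore L).arr 0 v + done.length ∧
    s.reg 10 = (inputStore L).arr 0 v + (L v).length

lemma runs_forNbrBody {done rest : List (Fin n)} {w : Fin n}
    (hstab : ∀ l s s', I l s → s'.arr = s.arr → (∀ x, x < 9 ∨ 13 < x → s'.reg x = s.reg x) →
      I l s')
    (hrep : ∀ l s, I l s → s.reg 8 = v ∧ ∃ m, Rep L m s)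
    (hbody : ∀ s, nbrs L v = kept L v done ++ w :: kept L v rest → I (kept L v done) s →
      s.reg 11 = w → Runs body s c (fun s' => I (kept L v done ++ [w]) s' ∧
        s'.reg 9 = s.reg 9 ∧ s'.reg 10 = s.reg 10))
    (hL : L v = done ++ w :: rest) (hs : NbrInv L v I done s) :
    Runs (forNbrBody body) s (4 + (c + 3 + 1)) (NbrInv L v I (done ++ [w])) := by
  obtain ⟨hI, h9, h10⟩ := hs
  obtain ⟨h8, m, hm⟩ := hrep _ _ hI
  have hload : s.arr 1 (s.reg 9) = w := by
    rw [hm.adj, h9, inputStore_arr_one L v (by simp [hL])]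
    simp [hL]
  refine .seq (.block _ (.seq ?_))
  simp only [List.foldl_cons, List.foldl_nil, Instr.run, Store.setReg_arr, Store.setReg_reg,
    Nat.reduceEqDiff, if_true, if_false, hload, h8]
  set s₁ := ((s.setReg 11 w).setReg 12 (s.arr 8 v)).setReg 13 (s.arr 8 w)
  have hI₁ : I (kept L v done) s₁ := hstab _ _ _ hI rfl fun x hx => by
    simp [s₁, show x ≠ 11 by omega, show x ≠ 12 by omega, show x ≠ 13 by omega]
  have hnext : ∀ s₂, I (kept L v (done ++ [w])) s₂ → s₂.reg 9 = s₁.reg 9 →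
      s₂.reg 10 = s₁.reg 10 → Runs (.instr (.succ 9)) s₂ 1 (NbrInv L v I (done ++ [w])) := by
    refine fun s₂ hI₂ h9' h10' => .instr ⟨hstab _ _ _ hI₂ rfl fun x hx => ?_, ?_, ?_⟩
    · simp [show x ≠ 9 by omega]
    · simp [h9', s₁, h9, add_assoc]
    · simp [h10', s₁, h10]
  refine runs_cond_cond_skip (P := (L v).length = 2) (P' := (L w).length = 2)
    (by simp [s₁, hm.one, hm.two]) (by simp [s₁, hm.one, hm.two])
    (fun hskip => hnext s₁ ?_ rfl rfl) fun hkeep => ?_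
  · simpa [kept, List.filter_append, hskip] using hI₁
  · have hkept : ∀ l, kept L v (w :: l) = w :: kept L v l := fun l =>
      List.filter_cons_of_pos (by exact decide_eq_true hkeep)
    have hsplit : nbrs L v = kept L v done ++ w :: kept L v rest := by
      rw [← hkept, nbrs, hL]
      exact List.filter_append ..
    have hdone : kept L v (done ++ [w]) = kept L v done ++ [w] :=
      (List.filter_append ..).trans (congrArg _ (hkept []))
    refine (hbody s₁ hsplit hI₁ (by simp [s₁])).mono le_rfl ?_
    rintro s₂ ⟨hI₂, h9', h10'⟩
    exact hnext s₂ (hdone ▸ hI₂) h9' h10'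

lemma runs_forNbr
    (hstab : ∀ l s s', I l s → s'.arr = s.arr → (∀ x, x < 9 ∨ 13 < x → s'.reg x = s.reg x) →
      I l s')
    (hrep : ∀ l s, I l s → s.reg 8 = v ∧ ∃ m, Rep L m s)
    (hbody : ∀ done (w : Fin n) rest s, nbrs L v = done ++ w :: rest → I done s → s.reg 11 = w →
      Runs body s c (fun s' => I (done ++ [w]) s' ∧ s'.reg 9 = s.reg 9 ∧ s'.reg 10 = s.reg 10))
    (hs : I [] s) : Runs (forNbr body) s ((c + 10) * (L v).length + 10) (I (nbrs L v)) := by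
  have htest : ∀ done rest s, L v = done ++ rest → NbrInv L v I done s →
      ((Test.lt 9 10).holds s ↔ rest ≠ []) := by
    rintro done rest s hL ⟨-, h9, h10⟩
    rw [Test.holds, h9, h10, hL, List.length_append, ← List.length_pos_iff]
    omega
  obtain ⟨hv, m, hm⟩ := hrep _ _ hs
  refine (Runs.seq (.block _ ((Runs.loop_list htest (fun done w rest s hL hI =>
    runs_forNbrBody hstab hrep (hbody _ w _) hL hI) ⟨?_, ?_, ?_⟩).mono le_rfl
    fun s' hs' => hs'.1))).mono_time ?_
  · refine hstab _ _ _ hs rfl fun x hx => ?_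
    simp [show x ≠ 9 by omega, show x ≠ 10 by omega]
  · simp [hv, hm.off]
  · simp [hv, hm.off, inputStore_arr_zero_succ]
  · simp only [List.length_cons, List.length_nil, List.map_const', List.sum_replicate, smul_eq_mul]
    ring_nf
    omega

end forNbr

end RAM

namespace RAM

variable {n : ℕ} {L : Fin n → List (Fin n)} {m : Mem n} {s : Store} {pre new l : List (Fin n)}
  {u v w : Fin n}

/-! ### Visiting the new vertices -/

/-- Execute `body` for each vertex of the tree, in register `8`, starting with the one whose number
is in register `6`. -/
def forOrd (body : Prog) : Prog :=
  .loop (.lt 6 4) (.seq (.instr (.load 8 9 6)) (.seq body (.instr (.succ 6))))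

lemma runs_forOrd {body : Prog} {c : Fin n → ℕ} {I : List (Fin n) → Store → Prop}
    (hstab : ∀ l s s', I l s → s'.arr = s.arr → (∀ x, x ≠ 6 → x ≠ 8 → s'.reg x = s.reg x) →
      I l s')
    (hrep : ∀ l s, I l s → ∃ m, Rep L m s ∧ m.ord = pre ++ new)
    (hbody : ∀ done (u : Fin n) rest s, new = done ++ u :: rest → I done s → s.reg 8 = u →
      Runs body s (c u) (fun s' => I (done ++ [u]) s' ∧ s'.reg 6 = s.reg 6))
    (hs : I [] s) (h6 : s.reg 6 = pre.length) :
    Runs (forOrd body) s ((new.map fun u => c u + 3).sum + 1) (I new) := by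
  refine (Runs.loop_list (f := fun u => c u + 2)
    (I := fun done s => I done s ∧ s.reg 6 = pre.length + done.length) ?_ ?_
    ⟨hs, by simpa using h6⟩).mono le_rfl fun _ h => h.1
  · rintro done rest s hnew ⟨hI, h6⟩
    obtain ⟨m, hm, hord⟩ := hrep _ _ hI
    rw [Test.holds, h6, hm.top, hord, hnew, ← List.length_pos_iff]
    simp only [List.length_append]
    omega
  · rintro done u rest s hnew ⟨hI, h6⟩
    obtain ⟨m, hm, hord⟩ := hrep _ _ hI
    have hload : s.arr 9 (s.reg 6) = u := by
      have hlt : pre.length + done.length < m.ord.length := by simp [hord, hnew]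
      rw [h6, hm.ord _ hlt]
      simp [hord, hnew]
    have hI' : I done (s.setReg 8 u) := hstab _ _ _ hI rfl fun x _ hx => by simp [hx]
    refine (Runs.seq (c' := c u + 1) (.instr (.seq ?_))).mono_time (by omega)
    simp only [Instr.run, hload]
    refine (hbody done u rest _ hnew hI' (by simp)).mono le_rfl ?_
    rintro s' ⟨hI'', h6'⟩
    refine .instr ⟨hstab _ _ _ hI'' rfl fun x hx _ => by simp [hx], ?_⟩
    simp [h6', h6, add_assoc]

/-! ### Expanding a vertex -/

/-- Add the vertices of `l` outside the tree as children of `v`. -/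
def Mem.add (m : Mem n) (v : Fin n) (l : List (Fin n)) : Mem n :=
  { m with
    tree := m.tree ∪ l.toFinset
    par := fun w => if w ∈ l ∧ w ∉ m.tree then v else m.par w
    ord := m.ord ++ l.filter (· ∉ m.tree) }

lemma Mem.add_nil : m.add v [] = m := by simp [Mem.add]

lemma Mem.add_append_of_mem (hw : w ∈ m.tree) : m.add v (l ++ [w]) = m.add v l := by
  simp only [Mem.add, Mem.mk.injEq, true_and]
  refine ⟨?_, ?_, by simp [hw]⟩
  · rw [List.toFinset_append, ← Finset.union_assoc]
    exact Finset.union_eq_left.2 (by simp [hw])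
  · funext z
    by_cases hz : z = w
    · simp [hz, hw]
    · simp [hz]

lemma Rep.add_append_of_notMem (h : Rep L (m.add v l) s) (hw : w ∉ m.tree) :
    Rep L (m.add v (l ++ [w])) ((((s.setArr 3 w 1).setArr 2 w v).setArr 9 (m.add v l).ord.length
      w).setReg 4 ((m.add v l).ord.length + 1)) := by
  convert ((h.setTree w).setPar w v).pushOrd w using 1
  simp only [Mem.add, Mem.mk.injEq, true_and]
  refine ⟨?_, ?_, by simp [hw]⟩
  · ext z
    simp
  · funext z
    by_cases hz : z = w
    · simp [hz, hw]
    · simp [hz]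

/-- Add the vertex in register `11` to the tree as a child of the one in register `8`, unless it
already belongs to the tree. -/
def addNbr : Prog :=
  .seq (.instr (.load 14 3 11))
    (.cond (.eq 14 2) (block [.store 3 11 1, .store 2 11 8, .store 9 4 11, .succ 4]) .skip)

lemma runs_addNbr (h : Rep L (m.add v l) s) (h8 : s.reg 8 = v) (h11 : s.reg 11 = w)
    (hw : w ∉ l) : Runs addNbr s 7 fun s' =>
      Rep L (m.add v (l ++ [w])) s' ∧ ∀ x, 6 ≤ x → x < 14 → s'.reg x = s.reg x := by
  have hrep := h.setReg (x := 14) (by norm_num) (s.arr 3 (s.reg 11))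
  have htest : (Test.eq 14 2).holds (s.setReg 14 (s.arr 3 (s.reg 11))) ↔ w ∉ m.tree := by
    simp [h11, h.zero, h.tree, Mem.add, hw]
  refine .seq (c := 1) (.instr (.cond (c := 5) (fun hnew => .block _ ?_) fun hold => ?_))
  · simp only [List.foldl_cons, List.foldl_nil, Instr.run, Store.setReg_reg, Store.setArr_reg,
      Nat.reduceEqDiff, if_false, h11, h8, h.one, h.top]
    rw [h11] at hrep
    refine ⟨hrep.add_append_of_notMem (htest.1 hnew), fun x hx hx' => ?_⟩
    simp [show x ≠ 4 by omega, show x ≠ 14 by omega]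
  · rw [Mem.add_append_of_mem (not_not.1 fun hnew => hold (htest.2 hnew))]
    refine (Runs.skip ⟨hrep, fun x _ hx' => ?_⟩).mono_time (by norm_num)
    simp [show x ≠ 14 by omega]

/-- Add the neighbours of the vertex in register `8` to the tree. -/
def addNbrs : Prog := forNbr addNbr

lemma notMem_of_nodup_of_eq_append (hnd : l.Nodup) (hl : l = pre ++ w :: new) : w ∉ pre :=
  fun hw => List.disjoint_of_nodup_append (hl ▸ hnd) hw List.mem_cons_self

lemma runs_addNbrs (h : Rep L m s) (h8 : s.reg 8 = v) (hnd : (L v).Nodup) :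
    Runs addNbrs s (17 * (L v).length + 10)
      (fun s' => Rep L (m.add v (nbrs L v)) s' ∧ s'.reg 7 = s.reg 7) := by
  refine (runs_forNbr (c := 7) (v := v) (L := L) (I := fun l s' => Rep L (m.add v l) s' ∧
    s'.reg 8 = v ∧ s'.reg 7 = s.reg 7) ?_ ?_ ?_ ⟨by rwa [Mem.add_nil], h8, rfl⟩).mono le_rfl ?_
  · rintro l s s' ⟨hrep, h8, h7⟩ harr hreg
    exact ⟨hrep.congr harr fun x hx => hreg x (by omega), (hreg 8 (by norm_num)).trans h8,
      (hreg 7 (by norm_num)).trans h7⟩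
  · exact fun l s ⟨hrep, h8, _⟩ => ⟨h8, _, hrep⟩
  · rintro done w rest s' hsplit ⟨hrep, h8, h7⟩ h11
    refine (runs_addNbr hrep h8 h11
      (notMem_of_nodup_of_eq_append (hnd.filter _) hsplit)).mono le_rfl ?_
    rintro s'' ⟨hrep', hreg⟩
    exact ⟨⟨hrep', (hreg 8 (by norm_num) (by norm_num)).trans h8,
      (hreg 7 (by norm_num) (by norm_num)).trans h7⟩, hreg 9 (by norm_num) (by norm_num),
      hreg 10 (by norm_num) (by norm_num)⟩
  · exact fun s' ⟨hrep, _, h7⟩ => ⟨hrep, h7⟩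

/-- Take into account that the vertices of `l` are in the tree. -/
def Mem.decr (L : Fin n → List (Fin n)) (m : Mem n) (l : List (Fin n)) : Mem n :=
  { m with cnt := fun z => m.cnt z - l.countP fun u => z ∈ nbrs L u }

/-- Update the numbers of neighbours outside the tree. -/
def decrNbrs : Prog := forNbr (block [.load 14 4 11, .pred 14, .store 4 11 14])

lemma runs_decrNbrs (h : Rep L m s) (h8 : s.reg 8 = u) (hnd : (L u).Nodup) :
    Runs decrNbrs s (14 * (L u).length + 10) (fun s' =>
      Rep L { m with cnt := fun z => m.cnt z - if z ∈ nbrs L u then 1 else 0 } s' ∧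
        s'.reg 6 = s.reg 6 ∧ s'.reg 7 = s.reg 7) := by
  refine (runs_forNbr (c := 4) (v := u) (L := L) (I := fun l s' =>
    Rep L { m with cnt := fun z => m.cnt z - if z ∈ l then 1 else 0 } s' ∧
    s'.reg 8 = u ∧ s'.reg 6 = s.reg 6 ∧ s'.reg 7 = s.reg 7) ?_ ?_ ?_
    ⟨by simpa using h, h8, rfl, rfl⟩).mono le_rfl ?_
  · rintro l s s' ⟨hrep, h8, h6, h7⟩ harr hreg
    exact ⟨hrep.congr harr fun x hx => hreg x (by omega), (hreg 8 (by norm_num)).trans h8,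
      (hreg 6 (by norm_num)).trans h6, (hreg 7 (by norm_num)).trans h7⟩
  · exact fun l s ⟨hrep, h8, _⟩ => ⟨h8, _, hrep⟩
  · rintro done w rest s' hsplit ⟨hrep, h8, h6, h7⟩ h11
    have hw : w ∉ done := notMem_of_nodup_of_eq_append (hnd.filter _) hsplit
    refine .block _ ?_
    simp only [List.foldl_cons, List.foldl_nil, Instr.run, Store.setReg_reg, Store.setArr_reg,
      Nat.reduceEqDiff, if_true, if_false, h11, hrep.cnt, hw]
    refine ⟨⟨?_, by simp [h8], by simp [h6], by simp [h7]⟩, by simp, by simp⟩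
    convert ((hrep.setReg (x := 14) (by norm_num) (m.cnt w - 0)).setReg (x := 14) (by norm_num)
      (m.cnt w - 0 - 1)).setCnt w (m.cnt w - 0 - 1) using 1
    simp only [Mem.mk.injEq, true_and, and_true]
    funext z
    by_cases hz : z = w
    · simp [hz]
    · simp [hz]
  · exact fun s' ⟨hrep, _, h67⟩ => ⟨hrep, h67⟩

lemma runs_forOrd_decrNbrs (h : Rep L m s) (hord : m.ord = pre ++ new)
    (h6 : s.reg 6 = pre.length) (hnd : ∀ u, (L u).Nodup) :
    Runs (forOrd decrNbrs) s ((new.map fun u => 14 * (L u).length + 10 + 3).sum + 1)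
      (fun s' => Rep L (m.decr L new) s' ∧ s'.reg 7 = s.reg 7) := by
  refine runs_forOrd (L := L) (c := fun u => 14 * (L u).length + 10) (pre := pre) (I := fun l s' =>
    Rep L (m.decr L l) s' ∧ s'.reg 7 = s.reg 7) ?_ ?_ ?_ ⟨by simpa [Mem.decr] using h, rfl⟩ h6
  · rintro l s s' ⟨hrep, h7⟩ harr hreg
    exact ⟨hrep.congr harr fun x hx => hreg x (by omega) (by omega),
      (hreg 7 (by norm_num) (by norm_num)).trans h7⟩
  · exact fun l s ⟨hrep, _⟩ => ⟨_, hrep, hord⟩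
  · rintro done u rest s' - ⟨hrep, h7⟩ h8
    refine (runs_decrNbrs hrep h8 (hnd u)).mono le_rfl ?_
    rintro s'' ⟨hrep', h6', h7'⟩
    refine ⟨⟨?_, h7'.trans h7⟩, h6'⟩
    convert hrep' using 1
    simp only [Mem.decr, Mem.mk.injEq, true_and, and_true]
    funext z
    rw [List.countP_append, List.countP_singleton, Nat.sub_add_eq]
    simp

/-- Push each vertex `u` of `l` onto the stacks of the levels from `1` to `cnt u`. -/
def Mem.push (m : Mem n) (l : List (Fin n)) : Mem n :=
  { m with
    stk := fun j => (l.filter fun u => 1 ≤ j ∧ j ≤ m.cnt u).reverse ++ m.stk j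
    cur := l.foldl (fun c u => max c (m.cnt u)) m.cur }

/-- Push `u` onto the stacks of the levels from `1` to `k`. -/
def Mem.pushTo (m : Mem n) (u : Fin n) (k : ℕ) : Mem n :=
  { m with stk := fun i => if 1 ≤ i ∧ i ≤ k then u :: m.stk i else m.stk i }

lemma Mem.pushTo_zero : m.pushTo u 0 = m := by
  simp only [Mem.pushTo]
  congr 1
  funext i
  exact if_neg (by omega)

lemma Mem.pushTo_succ (k : ℕ) : m.pushTo u (k + 1) = { m.pushTo u k with
    stk := Function.update (m.pushTo u k).stk (k + 1) (u :: (m.pushTo u k).stk (k + 1)) } := by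
  simp only [Mem.pushTo, Mem.mk.injEq, true_and, and_true]
  funext i
  by_cases hi : i = k + 1
  · simp [hi]
  · rw [Function.update_of_ne hi]
    exact if_congr (by omega) rfl rfl

lemma Mem.push_singleton :
    m.push [u] = { m.pushTo u (m.cnt u) with cur := max m.cur (m.cnt u) } := by
  simp only [Mem.push, Mem.pushTo, Mem.mk.injEq, true_and, and_true]
  refine ⟨?_, rfl⟩
  funext i
  by_cases hi : 1 ≤ i ∧ i ≤ m.cnt u <;> simp [hi]

/-- Push the vertex in register `8` onto the stacks of the levels from the one after the content of
register `15` to the content of register `14`. -/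
def pushLoop : Prog :=
  .loop (.lt 15 14)
    (block [.succ 15, .store 7 5 8, .load 12 5 15, .store 6 5 12, .store 5 15 5, .succ 5])

/-- Push the vertex in register `8` onto the stacks. -/
def pushStacks : Prog :=
  .seq (block [.load 14 4 8, .const 15 0])
    (.seq pushLoop (.cond (.lt 3 14) (.instr (.copy 3 14)) .skip))

lemma runs_pushLoop {k : ℕ} (h : Rep L m s) (h8 : s.reg 8 = u) (h14 : s.reg 14 = k)
    (h15 : s.reg 15 = 0) : Runs pushLoop s (8 * k + 1) fun s' =>
      Rep L (m.pushTo u k) s' ∧ s'.reg 6 = s.reg 6 ∧ s'.reg 14 = k := by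
  have hloop := Runs.loop_list (b := .lt 15 14) (l := List.range k) (f := fun _ => 7)
    (p := block [.succ 15, .store 7 5 8, .load 12 5 15, .store 6 5 12, .store 5 15 5, .succ 5])
    (I := fun done s' => Rep L (m.pushTo u done.length) s' ∧ s'.reg 8 = u ∧
      s'.reg 6 = s.reg 6 ∧ s'.reg 14 = k ∧ s'.reg 15 = done.length) (s := s) ?_ ?_
    ⟨by rwa [List.length_nil, Mem.pushTo_zero], h8, rfl, h14, h15⟩
  · refine hloop.mono (by simp; omega) ?_
    rintro s' ⟨hrep, -, h6', h14', -⟩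
    rw [List.length_range] at hrep
    exact ⟨hrep, h6', h14'⟩
  · rintro done rest s' hk ⟨-, -, -, h14', h15'⟩
    have hlength := congrArg List.length hk
    rw [List.length_range, List.length_append] at hlength
    rw [Test.holds, h14', h15', ← List.length_pos_iff]
    omega
  · rintro done - rest s' - ⟨hrep, h8', h6', h14', h15'⟩
    refine .block _ ?_
    simp only [List.foldl_cons, List.foldl_nil, Instr.run, Store.setReg_arr, Store.setReg_reg,
      Store.setArr_reg, Store.setArr_arr, Nat.reduceEqDiff, if_true, if_false, h8', h15',
      List.length_append, List.length_singleton, h14', h6', and_true]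
    rw [Mem.pushTo_succ]
    refine ((hrep.setReg (x := 15) (by norm_num) (done.length + 1)).push (done.length + 1)
      u).congr rfl fun x hx => ?_
    simp [show x ≠ 12 by omega, show x ≠ 15 by omega]

lemma runs_pushStacks (h : Rep L m s) (h8 : s.reg 8 = u) :
    Runs pushStacks s (8 * m.cnt u + 6) (fun s' => Rep L (m.push [u]) s' ∧
      s'.reg 6 = s.reg 6) := by
  refine (Runs.seq (c := 3) (.block _ (.seq (c := 8 * m.cnt u + 1) (c' := 2) ?_))).mono_time
    (by omega)
  simp only [List.foldl_cons, List.foldl_nil, Instr.run, h8, h.cnt]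
  refine (runs_pushLoop (k := m.cnt u) ((h.setReg (x := 14) (by norm_num) (m.cnt u)).setReg
    (x := 15) (by norm_num) 0) (by simpa using h8) (by simp) (by simp)).mono le_rfl ?_
  rintro s' ⟨hrep, h6', h14⟩
  have hcur : s'.reg 3 = m.cur := hrep.cur
  rw [Mem.push_singleton]
  refine .cond (c := 1) (fun hlt => .instr ⟨?_, by simpa using h6'⟩)
    fun hle => .skip ⟨?_, by simpa using h6'⟩
  · rw [Test.holds, hcur, h14] at hlt
    rw [max_eq_right hlt.le, Instr.run, h14]
    exact hrep.setCur _
  · rw [Test.holds, hcur, h14] at hle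
    rw [max_eq_left (not_lt.1 hle)]
    exact hrep

lemma runs_forOrd_pushStacks (h : Rep L m s) (hord : m.ord = pre ++ new)
    (h6 : s.reg 6 = pre.length) :
    Runs (forOrd pushStacks) s ((new.map fun u => 8 * m.cnt u + 6 + 3).sum + 1)
      (Rep L (m.push new)) := by
  refine runs_forOrd (L := L) (c := fun u => 8 * m.cnt u + 6) (pre := pre) (I := fun l s' =>
    Rep L (m.push l) s') ?_ ?_ ?_ (by simpa [Mem.push] using h) h6
  · intro l s s' hrep harr hreg
    exact hrep.congr harr fun x hx => hreg x (by omega) (by omega)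
  · exact fun l s hrep => ⟨_, hrep, hord⟩
  · intro done u rest s' _ hrep h8
    refine (runs_pushStacks hrep h8).mono le_rfl ?_
    rintro s'' ⟨hrep', h6'⟩
    refine ⟨?_, h6'⟩
    convert hrep' using 1
    simp only [Mem.push, Mem.mk.injEq, true_and, and_true]
    refine ⟨?_, by simp⟩
    funext j
    rw [List.filter_append, List.reverse_append, List.append_assoc]
    rfl

/-- Take into account the vertices of the tree added last, starting with the one whose number is in
register `7`. -/
def processNew : Prog :=
  .seq (.instr (.copy 6 7)) (.seq (forOrd decrNbrs)
    (.seq (.instr (.copy 6 7)) (forOrd pushStacks)))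

lemma sum_processNew_le {f : Fin n → ℕ} (hf : ∀ u, f u ≤ (L u).length) :
    (l.map fun u => 14 * (L u).length + 10 + 3).sum + (l.map fun u => 8 * f u + 6 + 3).sum ≤
      22 * (l.map fun u => (L u).length + 1).sum := by
  rw [← List.sum_map_add, ← List.sum_map_mul_left]
  refine List.sum_le_sum fun u _ => ?_
  have hfu := hf u
  omega

lemma runs_processNew (h : Rep L m s) (hord : m.ord = pre ++ new) (h7 : s.reg 7 = pre.length)
    (hnd : ∀ u, (L u).Nodup) (hcnt : ∀ u, m.cnt u ≤ (L u).length) :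
    Runs processNew s (22 * (new.map fun u => (L u).length + 1).sum + 4)
      (Rep L ((m.decr L new).push new)) := by
  have hcost := sum_processNew_le (l := new) (f := (m.decr L new).cnt)
    fun u => (Nat.sub_le _ _).trans (hcnt u)
  have hdecr := runs_forOrd_decrNbrs (h.setReg (x := 6) (by norm_num) (s.reg 7)) hord (by simpa) hnd
  refine (Runs.seq (c := 1) (c' := (new.map fun u => 14 * (L u).length + 10 + 3).sum + 1 +
    (1 + ((new.map fun u => 8 * (m.decr L new).cnt u + 6 + 3).sum + 1))) (.instr
    (.seq (hdecr.mono le_rfl ?_)))).mono_time (by omega)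
  rintro s' ⟨hrep, h7'⟩
  have h7'' : s'.reg 7 = pre.length := by simpa [h7] using h7'
  exact .seq (.instr (runs_forOrd_pushStacks (hrep.setReg (by norm_num) _) hord (by simpa)))

end RAM

namespace RAM

open Branching

/-! ### The correctness of the program -/

section Inv

variable {n : ℕ} {G H : SimpleGraph (Fin n)} {L : Fin n → List (Fin n)} {m : Mem n}
  {σ : State (Fin n)} {r u v w x : Fin n} {l : List (Fin n)} {j k : ℕ}

lemma ncard_setOf_mem_and (hl : l.Nodup) (p : Fin n → Bool) :
    {u | u ∈ l ∧ p u}.ncard = l.countP p := by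
  have hset : {u | u ∈ l ∧ p u} = ((l.filter p).toFinset : Set (Fin n)) := by
    ext u
    simp
  rw [hset, Set.ncard_coe_finset, List.toFinset_card_of_nodup (hl.filter _),
    List.countP_eq_length_filter]

lemma ncard_neighborSet_eq_length (hl : l.Nodup) (hadj : ∀ w, w ∈ l ↔ G.Adj v w) :
    (G.neighborSet v).ncard = l.length := by
  have hset : G.neighborSet v = {w | w ∈ l ∧ true} := by
    ext w
    simp [hadj]
  rw [hset, ncard_setOf_mem_and hl fun _ => true, List.countP_true]

lemma IsAdjLists.length_eq (hL : IsAdjLists G L) (v : Fin n) : (L v).length = deg G v :=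
  (ncard_neighborSet_eq_length (hL v).1 (hL v).2).symm

lemma IsAdjLists.mem_nbrs (hL : IsAdjLists G L) (v w : Fin n) :
    w ∈ nbrs L v ↔ (simplify G).Adj v w := by
  simp only [nbrs, kept, List.mem_filter, (hL v).2 w, simplify, hL.length_eq, decide_eq_true_eq]

lemma IsAdjLists.nodup_nbrs (hL : IsAdjLists G L) (v : Fin n) : (nbrs L v).Nodup :=
  (hL v).1.filter _

/-- The neighbours of `v` outside the tree. -/
def Mem.new (L : Fin n → List (Fin n)) (m : Mem n) (v : Fin n) : List (Fin n) :=
  (nbrs L v).filter (· ∉ m.tree)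

/-- The data after the expansion of `v`. -/
def Mem.expand (L : Fin n → List (Fin n)) (m : Mem n) (v : Fin n) : Mem n :=
  ((m.add v (nbrs L v)).decr L (m.new L v)).push (m.new L v)

/-- Replace the stack of the current level. -/
def Mem.setStk (m : Mem n) (l : List (Fin n)) : Mem n :=
  { m with stk := Function.update m.stk m.cur l }

lemma Mem.setStk_stk_cur (m : Mem n) (l : List (Fin n)) : (m.setStk l).stk m.cur = l :=
  Function.update_self _ _ _

lemma Mem.setStk_stk_of_ne (hj : j ≠ m.cur) : (m.setStk l).stk j = m.stk j :=
  Function.update_of_ne hj _ _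

lemma Mem.setStk_stk_sublist (hs : m.stk m.cur = v :: l) (j : ℕ) :
    ((m.setStk l).stk j).Sublist (m.stk j) := by
  by_cases hj : j = m.cur
  · rw [hj, Mem.setStk_stk_cur, hs]
    exact List.sublist_cons_self v l
  · rw [Mem.setStk_stk_of_ne hj]

lemma Mem.mem_setStk_stk (hs : m.stk m.cur = v :: l) (hw : w ∈ m.stk j)
    (hne : j = m.cur → w ≠ v) : w ∈ (m.setStk l).stk j := by
  by_cases hj : j = m.cur
  · rw [hj, hs] at hw
    rw [hj, Mem.setStk_stk_cur]
    exact List.mem_of_ne_of_mem (hne hj) hw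
  · rwa [Mem.setStk_stk_of_ne hj]

lemma Mem.mem_push_stk :
    w ∈ (m.push l).stk j ↔ (w ∈ l ∧ 1 ≤ j ∧ j ≤ m.cnt w) ∨ w ∈ m.stk j := by
  simp [Mem.push]

lemma foldl_max_le_iff {α : Type*} {f : α → ℕ} {l : List α} {c : ℕ} :
    l.foldl (fun c u => max c (f u)) c ≤ k ↔ c ≤ k ∧ ∀ u ∈ l, f u ≤ k := by
  induction l generalizing c with
  | nil => simp
  | cons a l ih => simp [ih, and_assoc]

lemma Mem.push_cur_le_iff : (m.push l).cur ≤ k ↔ m.cur ≤ k ∧ ∀ u ∈ l, m.cnt u ≤ k :=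
  foldl_max_le_iff

lemma Mem.cur_le_push_cur : m.cur ≤ (m.push l).cur := (Mem.push_cur_le_iff.1 le_rfl).1

lemma Mem.cnt_le_push_cur (hw : w ∈ l) : m.cnt w ≤ (m.push l).cur :=
  (Mem.push_cur_le_iff.1 le_rfl).2 w hw

/-- The state `σ` is reached by operations, or O3 is being performed. -/
def Reached (H : SimpleGraph (Fin n)) (r : Fin n) (σ : State (Fin n)) : Prop :=
  Relation.ReflTransGen (Step H) (init r) σ ∨
    ∃ s v x, Relation.ReflTransGen (Step H) (init r) s ∧ NoO1 H s ∧ O3 H s v x ∧ Latest H s v ∧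
      σ = Branching.expand H s v

/-- The data `m` describe the state `σ` of BRANCHING. Each vertex with `k` neighbours outside the
tree lies on the stacks of the levels from `1` to `k`; only doomed vertices may be missing from
level `1`. The current level is at least as high as all these levels. -/
structure Inv (H : SimpleGraph (Fin n)) (L : Fin n → List (Fin n)) (r : Fin n) (m : Mem n)
    (σ : State (Fin n)) : Prop where
  valid : Valid H r σ
  reached : Reached H r σ
  tree : ∀ v, v ∈ m.tree ↔ v ∈ σ.verts
  par : ∀ v ∈ σ.verts, m.par v = σ.parent v
  par_of_notMem : ∀ v, v ∉ σ.verts → m.par v = r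
  cnt : ∀ v, m.cnt v = (outer H σ v).ncard
  mem : ∀ j, ∀ v ∈ m.stk j, v ∈ σ.verts
  full : ∀ j, 2 ≤ j → ∀ v ∈ σ.verts, j ≤ m.cnt v → v ∈ m.stk j
  full_one : ∀ v ∈ σ.verts, 1 ≤ m.cnt v → v ∈ m.stk 1 ∨ Doomed H σ v
  sorted : ∀ j, (m.stk j).Pairwise fun a b => σ.stamp b ≤ σ.stamp a
  cnt_le_cur : ∀ v ∈ σ.verts, 2 ≤ m.cnt v → m.cnt v ≤ m.cur
  one_le_cur : ∀ v ∈ σ.verts, 1 ≤ m.cnt v → 1 ≤ m.cur ∨ Doomed H σ v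

lemma Inv.pred (h : Inv H L r m σ) (hs : m.stk m.cur = []) :
    Inv H L r { m with cur := m.cur - 1 } σ :=
  { h with
    cnt_le_cur := fun v hv hcnt => by
      have hle := h.cnt_le_cur v hv hcnt
      refine Nat.le_sub_one_of_lt (hle.lt_of_ne fun heq => ?_)
      exact List.not_mem_nil (hs ▸ h.full m.cur (heq ▸ hcnt) v hv heq.ge)
    one_le_cur := fun v hv hcnt => by
      refine or_iff_not_imp_right.2 fun hd => Nat.le_sub_one_of_lt ?_
      refine ((h.one_le_cur v hv hcnt).resolve_right hd).lt_of_ne fun heq => ?_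
      exact List.not_mem_nil (hs ▸ heq ▸ (h.full_one v hv hcnt).resolve_right hd) }

lemma Inv.pop (h : Inv H L r m σ) (hs : m.stk m.cur = v :: l)
    (hcnt : 2 ≤ m.cur → m.cnt v < m.cur) (hd : m.cur = 1 → Doomed H σ v) :
    Inv H L r (m.setStk l) σ :=
  { h with
    mem := fun j w hw => h.mem j w ((Mem.setStk_stk_sublist hs j).subset hw)
    full := fun j hj w hw hc => by
      refine Mem.mem_setStk_stk hs (h.full j hj w hw hc) ?_
      rintro rfl rfl
      exact (hcnt hj).not_ge hc
    full_one := fun w hw hc => by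
      refine or_iff_not_imp_right.2 fun hdw => ?_
      refine Mem.mem_setStk_stk hs ((h.full_one w hw hc).resolve_right hdw) ?_
      rintro hj rfl
      exact hdw (hd hj.symm)
    sorted := fun j => (h.sorted j).sublist (Mem.setStk_stk_sublist hs j) }

lemma Inv.mem_new (h : Inv H L r m σ) (hadj : ∀ v w, w ∈ nbrs L v ↔ H.Adj v w) :
    w ∈ m.new L v ↔ w ∈ outer H σ v := by
  simp [Mem.new, mem_outer, hadj, h.tree]

lemma Inv.mem_tree_expand (h : Inv H L r m σ) (hadj : ∀ v w, w ∈ nbrs L v ↔ H.Adj v w) :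
    w ∈ (m.expand L v).tree ↔ w ∈ (Branching.expand H σ v).verts := by
  change w ∈ m.tree ∪ (nbrs L v).toFinset ↔ _
  simp only [Finset.mem_union, h.tree, List.mem_toFinset, hadj, mem_expand_verts, mem_outer]
  tauto

lemma Inv.par_expand_of_mem (h : Inv H L r m σ) (hadj : ∀ v w, w ∈ nbrs L v ↔ H.Adj v w)
    (hw : w ∈ outer H σ v) : (m.expand L v).par w = v :=
  if_pos (List.mem_filter.1 ((h.mem_new hadj).2 hw) |>.imp_right of_decide_eq_true)

lemma Inv.par_expand_of_notMem (h : Inv H L r m σ) (hadj : ∀ v w, w ∈ nbrs L v ↔ H.Adj v w)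
    (hw : w ∉ outer H σ v) : (m.expand L v).par w = m.par w :=
  if_neg fun hnew => hw ((h.mem_new hadj).1 (List.mem_filter.2 (hnew.imp_right decide_eq_true)))

lemma Mem.expand_cnt_le : (m.expand L v).cnt w ≤ m.cnt w := Nat.sub_le _ _

lemma Mem.cur_le_expand_cur : m.cur ≤ (m.expand L v).cur :=
  Mem.cur_le_push_cur (m := (m.add v (nbrs L v)).decr L (m.new L v))

lemma Mem.expand_cnt_le_cur (hw : w ∈ m.new L v) : (m.expand L v).cnt w ≤ (m.expand L v).cur :=
  Mem.cnt_le_push_cur (m := (m.add v (nbrs L v)).decr L (m.new L v)) hw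

lemma Inv.cnt_expand (h : Inv H L r m σ) (hadj : ∀ v w, w ∈ nbrs L v ↔ H.Adj v w)
    (hnd : ∀ v, (nbrs L v).Nodup) :
    (m.expand L v).cnt w = (outer H (Branching.expand H σ v) w).ncard := by
  have hset : {u | u ∈ m.new L v ∧ decide (w ∈ nbrs L u) = true} =
      outer H σ w ∩ outer H σ v := by
    ext u
    simp only [Set.mem_ofPred_eq, h.mem_new hadj, decide_eq_true_eq, hadj, Set.mem_inter_iff,
      mem_outer, H.adj_comm u w]
    tauto
  change m.cnt w - (m.new L v).countP (fun u => w ∈ nbrs L u) = _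
  rw [← ncard_setOf_mem_and (l := m.new L v) ((hnd v).filter _), hset, h.cnt, outer_expand,
    ← Set.sdiff_inter_self_eq_sdiff, Set.inter_comm, Set.ncard_sdiff Set.inter_subset_right]

lemma Inv.cnt_expand_self (h : Inv H L r m σ) (hadj : ∀ v w, w ∈ nbrs L v ↔ H.Adj v w)
    (hnd : ∀ v, (nbrs L v).Nodup) : (m.expand L v).cnt v = 0 := by
  rw [h.cnt_expand hadj hnd, outer_expand_self, Set.ncard_empty]

lemma Inv.mem_stk_expand (h : Inv H L r m σ) (hadj : ∀ v w, w ∈ nbrs L v ↔ H.Adj v w) :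
    w ∈ ((m.setStk l).expand L v).stk j ↔
      (w ∈ outer H σ v ∧ 1 ≤ j ∧ j ≤ (m.expand L v).cnt w) ∨ w ∈ (m.setStk l).stk j :=
  Mem.mem_push_stk.trans (or_congr_left (and_congr_left' (h.mem_new hadj)))

lemma Inv.mem_stk_expand_of_le_cnt (h : Inv H L r m σ) (hadj : ∀ v w, w ∈ nbrs L v ↔ H.Adj v w)
    (hnd : ∀ v, (nbrs L v).Nodup) (hs : m.stk m.cur = v :: l) (hj : 1 ≤ j)
    (hw : w ∈ outer H σ v ∨ w ∈ m.stk j) (hc : j ≤ (m.expand L v).cnt w) :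
    w ∈ ((m.setStk l).expand L v).stk j := by
  refine (h.mem_stk_expand hadj).2 (hw.imp (fun hw => ⟨hw, hj, hc⟩) fun hw => ?_)
  refine Mem.mem_setStk_stk hs hw ?_
  rintro - rfl
  rw [h.cnt_expand_self hadj hnd] at hc
  omega

lemma Inv.sorted_expand (h : Inv H L r m σ) (hadj : ∀ v w, w ∈ nbrs L v ↔ H.Adj v w)
    (hs : m.stk m.cur = v :: l) (j : ℕ) : (((m.setStk l).expand L v).stk j).Pairwise
      fun a b => (Branching.expand H σ v).stamp b ≤ (Branching.expand H σ v).stamp a := by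
  have hmem : ∀ w ∈ (m.setStk l).stk j, w ∈ σ.verts := fun w hw =>
    h.mem j w ((Mem.setStk_stk_sublist hs j).subset hw)
  have hstamp : ∀ w ∈ (m.setStk l).stk j,
      (Branching.expand H σ v).stamp w = σ.stamp w := fun w hw =>
    expand_stamp_of_notMem (notMem_outer (hmem w hw))
  have hstamp_new : ∀ p : Fin n → Bool, ∀ w ∈ ((m.new L v).filter p).reverse,
      (Branching.expand H σ v).stamp w = σ.clock + 1 := fun p w hw =>
    expand_stamp_of_mem ((h.mem_new hadj).1 (List.mem_filter.1 (List.mem_reverse.1 hw)).1)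
  refine List.pairwise_append.2 ⟨?_, ?_, fun a ha b hb => ?_⟩
  · refine List.pairwise_of_forall_mem_list fun a ha b hb => ?_
    rw [hstamp_new _ a ha, hstamp_new _ b hb]
  · refine ((h.sorted j).sublist (Mem.setStk_stk_sublist hs j)).imp_of_mem fun ha hb hab => ?_
    rwa [hstamp _ ha, hstamp _ hb]
  · rw [hstamp_new _ a ha, hstamp b hb]
    exact (h.valid.stamp_le b (hmem b hb)).trans (Nat.le_succ _)

protected lemma Inv.expand (h : Inv H L r m σ) (hadj : ∀ v w, w ∈ nbrs L v ↔ H.Adj v w)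
    (hnd : ∀ v, (nbrs L v).Nodup) (hs : m.stk m.cur = v :: l)
    (hreach : Reached H r (Branching.expand H σ v)) :
    Inv H L r ((m.setStk l).expand L v) (Branching.expand H σ v) where
  valid := h.valid.expand (h.mem m.cur v (hs ▸ List.mem_cons_self))
  reached := hreach
  tree _ := h.mem_tree_expand hadj
  par w hw := by
    by_cases hwo : w ∈ outer H σ v
    · exact (h.par_expand_of_mem hadj hwo).trans (congrArg _ (expand_parent_of_mem hwo).symm)
    · rw [expand_parent_of_notMem hwo, ← h.par w (hw.resolve_right hwo)]
      exact h.par_expand_of_notMem hadj hwo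
  par_of_notMem w hw :=
    (h.par_expand_of_notMem hadj fun hwo => hw (Or.inr hwo)).trans
      (h.par_of_notMem w fun hwσ => hw (Or.inl hwσ))
  cnt _ := h.cnt_expand hadj hnd
  mem j w hw := by
    rcases (h.mem_stk_expand hadj).1 hw with hw | hw
    · exact Or.inr hw.1
    · exact Or.inl (h.mem j w ((Mem.setStk_stk_sublist hs j).subset hw))
  full j hj w hw hc :=
    h.mem_stk_expand_of_le_cnt hadj hnd hs (one_le_two.trans hj) (hw.symm.imp_right fun hw =>
      h.full j hj w hw (hc.trans Mem.expand_cnt_le)) hc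
  full_one w hw hc := by
    rcases hw with hw | hw
    · exact (h.full_one w hw (hc.trans Mem.expand_cnt_le)).imp
        (fun hstk => h.mem_stk_expand_of_le_cnt hadj hnd hs le_rfl (Or.inr hstk) hc)
        fun hd => hd.expand hw (h.valid.stamp_le w hw)
    · exact Or.inl (h.mem_stk_expand_of_le_cnt hadj hnd hs le_rfl (Or.inl hw) hc)
  sorted := h.sorted_expand hadj hs
  cnt_le_cur w hw hc := by
    rcases hw with hw | hw
    · exact Mem.expand_cnt_le.trans
        ((h.cnt_le_cur w hw (hc.trans Mem.expand_cnt_le)).trans Mem.cur_le_expand_cur)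
    · exact Mem.expand_cnt_le_cur ((h.mem_new hadj).2 hw)
  one_le_cur w hw hc := by
    rcases hw with hw | hw
    · exact (h.one_le_cur w hw (hc.trans Mem.expand_cnt_le)).imp
        (fun hcur => hcur.trans Mem.cur_le_expand_cur) fun hd =>
          hd.expand hw (h.valid.stamp_le w hw)
    · exact Or.inl (hc.trans (Mem.expand_cnt_le_cur ((h.mem_new hadj).2 hw)))

lemma Inv.stamp_le_of_mem_stk (h : Inv H L r m σ) (hs : m.stk m.cur = v :: l)
    (hw : w ∈ m.stk m.cur) : σ.stamp w ≤ σ.stamp v := by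
  have hsorted := h.sorted m.cur
  rw [hs] at hw hsorted
  rcases List.mem_cons.1 hw with rfl | hw
  · exact le_rfl
  · exact (List.pairwise_cons.1 hsorted).1 w hw

/- At a level above `1`, the first vertex of the stack is chosen by O1 or is the second vertex of
O3. -/
lemma Inv.reached_of_two_le_cur (h : Inv H L r m σ) (hs : m.stk m.cur = v :: l)
    (hcur : 2 ≤ m.cur) (hcnt : m.cur ≤ m.cnt v) : Reached H r (Branching.expand H σ v) := by
  have hv : v ∈ σ.verts := h.mem m.cur v (hs ▸ List.mem_cons_self)
  have hO1 : O1 H σ v := ⟨hv, (hcur.trans hcnt).trans_eq (h.cnt v)⟩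
  left
  rcases h.reached with hσ | ⟨s, u, x, hreach, hN, hO3, hlatest, rfl⟩
  · have hmax : ∀ w, O1 H σ w → (outer H σ w).ncard ≤ m.cur := fun w hw =>
      h.cnt w ▸ h.cnt_le_cur w hw.1 ((h.cnt w).symm ▸ hw.2)
    refine hσ.tail (Step.o1 σ v hO1 (fun w hw => ?_) fun w hw heq => ?_)
    · exact (hmax w hw).trans (hcnt.trans_eq (h.cnt v))
    · refine h.stamp_le_of_mem_stk hs (h.full m.cur hcur w hw.1 ?_)
      rwa [h.cnt, heq, ← h.cnt]
  · have hvs : v ∉ s.verts := fun hvs =>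
      hN v ⟨hvs, hO1.2.trans (ncard_outer_anti verts_subset_expand)⟩
    obtain rfl : v = x := hO3.2.1.subset (hv.resolve_left hvs)
    exact hreach.tail (Step.o3 s u v hN hO3 hlatest)

lemma Inv.noO1 (h : Inv H L r m σ) (hcur : m.cur ≤ 1) : NoO1 H σ := fun w hw =>
  ((h.cnt_le_cur w hw.1 ((h.cnt w).symm ▸ hw.2)).trans hcur).not_gt ((h.cnt w).symm ▸ hw.2)

lemma Inv.reflTransGen (h : Inv H L r m σ) (hcur : m.cur ≤ 1) :
    Relation.ReflTransGen (Step H) (init r) σ := by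
  rcases h.reached with hσ | ⟨s, u, x, -, -, hO3, -, rfl⟩
  · exact hσ
  · refine absurd ⟨hO3.mem_verts_expand, ?_⟩ (h.noO1 hcur x)
    rw [outer_expand_of_eq_singleton hO3.2.1]
    exact hO3.2.2

lemma Inv.one_le_cnt (h : Inv H L r m σ) (hx : outer H σ v = {x}) : 1 ≤ m.cnt v := by
  rw [h.cnt, hx, Set.ncard_singleton]

/- The first vertex of the stack of level `1` was added no earlier than any vertex that is not
doomed. A doomed vertex at which O2 applies does not matter either, since O2 then applies at a later
vertex too. -/
lemma Inv.latest (h : Inv H L r m σ) (hs : m.stk m.cur = v :: l) (hcur : m.cur = 1) :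
    Latest H σ v := by
  have hstamp : ∀ w y, w ∈ σ.verts → outer H σ w = {y} → ¬ Doomed H σ w →
      σ.stamp w ≤ σ.stamp v := fun w y hw hy hd =>
    h.stamp_le_of_mem_stk hs (hcur ▸ (h.full_one w hw (h.one_le_cnt hy)).resolve_right hd)
  rintro w y (hw | hw)
  · by_cases hd : Doomed H σ w
    · obtain ⟨z, hz, hlt, hdz⟩ := hw.exists_later (h.noO1 hcur.le) hd
      exact hlt.le.trans (hstamp z y hz.1 hz.2.1 hdz)
    · exact hstamp w y hw.1 hw.2.1 hd
  · exact hstamp w y hw.1 hw.2.1 hw.not_doomed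

lemma Inv.reached_of_cur_eq_one (h : Inv H L r m σ) (hs : m.stk m.cur = v :: l)
    (hcur : m.cur = 1) (hx : O2 H σ v x ∨ O3 H σ v x) :
    Reached H r (Branching.expand H σ v) := by
  rcases hx with hx | hx
  · exact Or.inl ((h.reflTransGen hcur.le).tail
      (Step.o2 σ v x (h.noO1 hcur.le) hx (h.latest hs hcur)))
  · exact Or.inr ⟨σ, v, x, h.reflTransGen hcur.le, h.noO1 hcur.le, hx, h.latest hs hcur, rfl⟩

lemma Inv.isResult (h : Inv H L r m σ) (hcur : m.cur = 0) : IsResult H r σ := by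
  have hN : NoO1 H σ := h.noO1 (hcur.trans_le zero_le_one)
  have hd : ∀ w y, w ∈ σ.verts → outer H σ w = {y} → Doomed H σ w := fun w y hw hy =>
    (h.one_le_cur w hw (h.one_le_cnt hy)).resolve_left (by omega)
  refine ⟨h.reflTransGen (hcur.trans_le zero_le_one), fun t ht => ?_⟩
  cases ht with
  | o1 v hv => exact hN v hv
  | o2 v x _ hv hlatest => exact hv.not_doomed hN hlatest (hd v x hv.1 hv.2.1)
  | o3 v x _ hv => exact hv.not_doomed (hd v x hv.1 hv.2.1)

lemma doomed_of_deg_eq_two (hx : outer (simplify G) σ v = {x}) (hv : v ∈ σ.verts)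
    (hone : (outer (simplify G) σ x).ncard = 1) (hdeg : deg G x = 2) :
    Doomed (simplify G) σ v := by
  obtain ⟨w, hw⟩ := Set.ncard_eq_one.1 hone
  have hxw : w ∈ outer (simplify G) σ x := hw.superset rfl
  have hvx : x ∈ outer (simplify G) σ v := hx.superset rfl
  have hwv : w ≠ v := fun hwv => hxw.2 (hwv ▸ hv)
  have hsub : {v, w} ⊆ (simplify G).neighborSet x :=
    Set.pair_subset (mem_outer.1 hvx).1.symm hxw.1
  refine Or.inr ⟨x, w, hx, (Set.eq_of_subset_of_ncard_le hsub ?_ (Set.toFinite _)).symm, hwv,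
    Or.inl hxw.2⟩
  rw [Set.ncard_pair hwv.symm, ← hdeg]
  exact Set.ncard_le_ncard (fun z hz => hz.1) (Set.toFinite _)

lemma O2_or_O3_of_deg_ne_two (hx : outer (simplify G) σ v = {x}) (hv : v ∈ σ.verts)
    (h : ¬ ((outer (simplify G) σ x).ncard = 1 ∧ deg G x = 2)) :
    O2 (simplify G) σ v x ∨ O3 (simplify G) σ v x := by
  refine or_iff_not_imp_right.2 fun hO3 => ⟨hv, hx, or_iff_not_imp_left.2 fun hne => ?_⟩
  have hpos : 0 < (outer (simplify G) σ x).ncard :=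
    (Set.ncard_pos (Set.toFinite _)).2 (Set.nonempty_iff_ne_empty.2 hne)
  have hlt : (outer (simplify G) σ x).ncard < 2 := not_le.1 fun hle => hO3 ⟨hv, hx, hle⟩
  have hdeg : deg G x ≠ 2 := fun hdeg => h ⟨by omega, hdeg⟩
  have hvx : x ∈ outer (simplify G) σ v := hx.superset rfl
  have hinner : 0 < ((simplify G).neighborSet x ∩ σ.verts).ncard :=
    (Set.ncard_pos (Set.toFinite _)).2 ⟨v, (mem_outer.1 hvx).1.symm, hv⟩
  have hsum : ((simplify G).neighborSet x ∩ σ.verts).ncard + (outer (simplify G) σ x).ncard =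
      deg G x := by
    rw [outer, Set.ncard_inter_add_ncard_sdiff_eq_ncard _ _ (Set.toFinite _),
      neighborSet_simplify hdeg, deg]
  omega

lemma ncard_outer_init (hadj : ∀ v w, w ∈ nbrs L v ↔ H.Adj v w) (hnd : ∀ v, (nbrs L v).Nodup) :
    (outer H (init r) w).ncard = (nbrs L w).length - [r].countP (fun u => w ∈ nbrs L u) := by
  rw [← ncard_neighborSet_eq_length (hnd w) (hadj w), List.countP_singleton]
  change (H.neighborSet w \ {r}).ncard = _
  by_cases hw : H.Adj w r
  · rw [Set.ncard_sdiff_singleton_of_mem ((H.mem_neighborSet w r).2 hw)]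
    simp [hadj, hw.symm]
  · rw [Set.sdiff_singleton_eq_self (by simpa)]
    simp [hadj, mt SimpleGraph.Adj.symm hw]

lemma Inv.init (hadj : ∀ v w, w ∈ nbrs L v ↔ H.Adj v w) (hnd : ∀ v, (nbrs L v).Nodup)
    (htree : m.tree = {r}) (hpar : ∀ v, m.par v = r) (hcnt : ∀ v, m.cnt v = (nbrs L v).length)
    (hstk : ∀ j, m.stk j = []) : Inv H L r ((m.decr L [r]).push [r]) (init r) := by
  have hverts : ∀ w, w ∈ (Branching.init r).verts ↔ w ∈ [r] := fun w =>
    List.mem_singleton.symm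
  have hmem : ∀ j w, w ∈ ((m.decr L [r]).push [r]).stk j ↔
      w ∈ (Branching.init r).verts ∧ 1 ≤ j ∧ j ≤ ((m.decr L [r]).push [r]).cnt w := fun j w => by
    rw [Mem.mem_push_stk, hverts, Mem.decr, hstk, or_iff_left List.not_mem_nil]
    rfl
  have hcur : ∀ w ∈ (Branching.init r).verts,
      ((m.decr L [r]).push [r]).cnt w ≤ ((m.decr L [r]).push [r]).cur := fun w hw =>
    Mem.cnt_le_push_cur (m := m.decr L [r]) ((hverts w).1 hw)
  exact
    { valid := valid_init H r
      reached := Or.inl .refl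
      tree := fun w => by rw [hverts, List.mem_singleton, ← Finset.mem_singleton, ← htree]; rfl
      par := fun w hw => (hpar w).trans (congrArg _ (List.mem_singleton.1 ((hverts w).1 hw)).symm)
      par_of_notMem := fun w _ => hpar w
      cnt := fun w => by rw [ncard_outer_init hadj hnd, ← hcnt]; rfl
      mem := fun j w hw => ((hmem j w).1 hw).1
      full := fun j hj w hw hc => (hmem j w).2 ⟨hw, one_le_two.trans hj, hc⟩
      full_one := fun w hw hc => Or.inl ((hmem 1 w).2 ⟨hw, le_rfl, hc⟩)
      sorted := fun _ => List.pairwise_of_forall fun _ _ => le_rfl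
      cnt_le_cur := fun w hw _ => hcur w hw
      one_le_cur := fun w hw hc => Or.inl (hc.trans (hcur w hw)) }

end Inv

end RAM

namespace RAM

open Branching

/-! ### The running time -/

section Potential

variable {n : ℕ} {L : Fin n → List (Fin n)} {m : Mem n} {r v : Fin n} {l : List (Fin n)}

/-- The weight of a list of vertices: their number plus the sum of their degrees. -/
def weight (L : Fin n → List (Fin n)) (l : List (Fin n)) : ℕ :=
  (l.map fun u => (L u).length + 1).sum

/-- The total length of the stacks. -/
def Mem.height (L : Fin n → List (Fin n)) (m : Mem n) : ℕ :=
  ∑ j ∈ Finset.range (∑ v, (L v).length + 1), (m.stk j).length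

/-- The weight of the vertices outside the tree. -/
def Mem.outside (L : Fin n → List (Fin n)) (m : Mem n) : ℕ :=
  ∑ v ∈ Finset.univ \ m.tree, ((L v).length + 1)

/-- The weight of the vertices with neighbours outside the tree. -/
def Mem.active (L : Fin n → List (Fin n)) (m : Mem n) : ℕ :=
  ∑ v with 0 < m.cnt v, ((L v).length + 1)

/-- A bound for the number of steps to go. An expansion of `v` is paid for by the weight of the
new vertices and by `v` ceasing to be active; a test of a vertex popped from level `1` is paid for
by its weight there. -/
def Mem.pot (L : Fin n → List (Fin n)) (m : Mem n) : ℕ :=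
  50 * m.cur + 50 * m.height L + 172 * m.outside L + 50 * m.active L + 50 * weight L (m.stk 1)

lemma weight_append (l l' : List (Fin n)) : weight L (l ++ l') = weight L l + weight L l' := by
  simp [weight]

lemma weight_reverse (l : List (Fin n)) : weight L l.reverse = weight L l := by
  simp [weight, List.sum_reverse]

lemma weight_filter_le (p : Fin n → Bool) (l : List (Fin n)) :
    weight L (l.filter p) ≤ weight L l :=
  (List.filter_sublist.map _).sum_le_sum fun _ _ => Nat.zero_le _

lemma weight_eq_sum (hl : l.Nodup) : weight L l = ∑ v ∈ l.toFinset, ((L v).length + 1) :=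
  (List.sum_toFinset _ hl).symm

lemma weight_le_sum (hl : l.Nodup) : weight L l ≤ ∑ v, ((L v).length + 1) :=
  (weight_eq_sum hl).trans_le (Finset.sum_le_sum_of_subset (Finset.subset_univ _))

lemma length_le_weight (hv : v ∈ l) : (L v).length ≤ weight L l :=
  (Nat.le_succ _).trans (List.single_le_sum (fun _ _ => Nat.zero_le _) _
    (List.mem_map_of_mem (f := fun u => (L u).length + 1) hv))

lemma sum_map_le_weight {f : Fin n → ℕ} (hf : ∀ u, f u ≤ (L u).length) (l : List (Fin n)) :
    (l.map f).sum ≤ weight L l :=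
  List.sum_le_sum fun u _ => (hf u).trans (Nat.le_succ _)

lemma Mem.pot_pred (hcur : 0 < m.cur) : Mem.pot L { m with cur := m.cur - 1 } + 50 ≤ m.pot L := by
  change 50 * (m.cur - 1) + 50 * m.height L + 172 * m.outside L + 50 * m.active L +
    50 * weight L (m.stk 1) + 50 ≤ 50 * m.cur + 50 * m.height L + 172 * m.outside L +
    50 * m.active L + 50 * weight L (m.stk 1)
  omega

lemma Mem.height_setStk (hs : m.stk m.cur = v :: l) (hcur : m.cur ≤ ∑ v, (L v).length) :
    (m.setStk l).height L + 1 = m.height L := by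
  have hmem : m.cur ∈ Finset.range (∑ v, (L v).length + 1) :=
    Finset.mem_range.2 (Nat.lt_succ_of_le hcur)
  have hne : ∀ j ∈ (Finset.range (∑ v, (L v).length + 1)).erase m.cur,
      ((m.setStk l).stk j).length = (m.stk j).length := fun j hj => by
    rw [Mem.setStk_stk_of_ne (Finset.ne_of_mem_erase hj)]
  rw [Mem.height, Mem.height, ← Finset.add_sum_erase _ _ hmem, ← Finset.add_sum_erase _ _ hmem,
    Finset.sum_congr rfl hne, Mem.setStk_stk_cur, hs, List.length_cons]
  ring

lemma Mem.weight_setStk (hs : m.stk m.cur = v :: l) :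
    weight L ((m.setStk l).stk 1) + (if m.cur = 1 then (L v).length + 1 else 0) =
      weight L (m.stk 1) := by
  split_ifs with hcur
  · have hcons := m.setStk_stk_cur l
    rw [hcur] at hcons hs
    rw [hcons, hs, ← List.singleton_append, weight_append, add_comm]
    simp [weight]
  · rw [Mem.setStk_stk_of_ne (Ne.symm hcur), add_zero]

lemma Mem.pot_setStk (hs : m.stk m.cur = v :: l) (hcur : m.cur ≤ ∑ v, (L v).length) :
    (m.setStk l).pot L + 50 + (if m.cur = 1 then 50 * ((L v).length + 1) else 0) ≤ m.pot L := by
  have hheight := Mem.height_setStk hs hcur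
  have hweight := Mem.weight_setStk (L := L) hs
  change 50 * m.cur + 50 * (m.setStk l).height L + 172 * m.outside L + 50 * m.active L +
    50 * weight L ((m.setStk l).stk 1) + 50 + _ ≤ 50 * m.cur + 50 * m.height L +
    172 * m.outside L + 50 * m.active L + 50 * weight L (m.stk 1)
  split_ifs at hweight ⊢ <;> omega

lemma Mem.push_cur_le_sum (hcnt : ∀ u, m.cnt u ≤ (L u).length) (l : List (Fin n))
    (hcur : m.cur ≤ ∑ v, (L v).length) : (m.push l).cur ≤ ∑ v, (L v).length :=
  Mem.push_cur_le_iff.2 ⟨hcur, fun u _ => (hcnt u).trans (Finset.single_le_sum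
    (f := fun v => (L v).length) (fun _ _ => Nat.zero_le _) (Finset.mem_univ u))⟩

lemma Mem.push_cur_le (hcnt : ∀ u, m.cnt u ≤ (L u).length) (l : List (Fin n)) :
    (m.push l).cur ≤ m.cur + weight L l :=
  Mem.push_cur_le_iff.2 ⟨Nat.le_add_right _ _, fun u hu =>
    ((hcnt u).trans (length_le_weight hu)).trans (Nat.le_add_left _ _)⟩

lemma card_filter_range_le (N k : ℕ) : ((Finset.range N).filter fun j => 1 ≤ j ∧ j ≤ k).card ≤ k :=
  calc ((Finset.range N).filter fun j => 1 ≤ j ∧ j ≤ k).card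
      ≤ (Finset.Icc 1 k).card :=
        Finset.card_le_card fun j hj => Finset.mem_Icc.2 (Finset.mem_filter.1 hj).2
    _ = k := by simp

lemma sum_length_filter_le {α : Type*} (f : α → ℕ) (N : ℕ) (l : List α) :
    ∑ j ∈ Finset.range N, (l.filter fun u => 1 ≤ j ∧ j ≤ f u).length ≤ (l.map f).sum := by
  induction l with
  | nil => simp
  | cons a l ih =>
    have hcons : ∀ j, ((a :: l).filter fun u => 1 ≤ j ∧ j ≤ f u).length =
        (if 1 ≤ j ∧ j ≤ f a then 1 else 0) + (l.filter fun u => 1 ≤ j ∧ j ≤ f u).length := by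
      intro j
      simp only [List.filter_cons, decide_eq_true_eq]
      split_ifs <;> simp [add_comm]
    simp only [hcons, Finset.sum_add_distrib, List.map_cons, List.sum_cons,
      ← Finset.card_filter]
    exact Nat.add_le_add (card_filter_range_le N (f a)) ih

lemma Mem.height_push_le (hcnt : ∀ u, m.cnt u ≤ (L u).length) (l : List (Fin n)) :
    (m.push l).height L ≤ m.height L + weight L l := by
  have hnew := (sum_length_filter_le m.cnt (∑ v, (L v).length + 1) l).trans
    (sum_map_le_weight hcnt l)
  simp only [Mem.height, Mem.push, List.length_append, List.length_reverse,
    Finset.sum_add_distrib]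
  omega

lemma Mem.weight_push_le (m : Mem n) (l : List (Fin n)) :
    weight L ((m.push l).stk 1) ≤ weight L (m.stk 1) + weight L l := by
  simp only [Mem.push, weight_append, weight_reverse]
  rw [add_comm]
  exact Nat.add_le_add_left (weight_filter_le _ l) _

lemma Mem.outside_expand (hnd : (nbrs L v).Nodup) :
    (m.expand L v).outside L + weight L (m.new L v) = m.outside L := by
  have houtside : Finset.univ \ (m.expand L v).tree =
      (Finset.univ \ m.tree) \ (m.new L v).toFinset := by
    ext w
    change w ∈ Finset.univ \ (m.tree ∪ (nbrs L v).toFinset) ↔ _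
    simp only [Finset.mem_sdiff, Finset.mem_univ, Finset.mem_union, List.mem_toFinset, Mem.new,
      List.mem_filter, decide_eq_true_eq, true_and]
    tauto
  have hsub : (m.new L v).toFinset ⊆ Finset.univ \ m.tree := fun w hw => by
    simpa using (List.mem_filter.1 (List.mem_toFinset.1 hw)).2
  rw [Mem.outside, weight_eq_sum (l := m.new L v) (hnd.filter _), houtside,
    Finset.sum_sdiff hsub, Mem.outside]

lemma Mem.active_expand (hpos : 0 < m.cnt v) (hzero : (m.expand L v).cnt v = 0) :
    (m.expand L v).active L + ((L v).length + 1) ≤ m.active L := by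
  have hmem : v ∈ ({u | 0 < m.cnt u} : Finset (Fin n)) := by simpa using hpos
  rw [Mem.active, Mem.active, ← Finset.sum_erase_add _ _ hmem]
  refine Nat.add_le_add_right (Finset.sum_le_sum_of_subset fun u hu => ?_) _
  simp only [Finset.mem_filter, Finset.mem_univ, true_and, Finset.mem_erase] at hu ⊢
  refine ⟨?_, hu.trans_le Mem.expand_cnt_le⟩
  rintro rfl
  exact hu.ne' hzero

lemma Mem.pot_expand (hnd : (nbrs L v).Nodup) (hcnt : ∀ u, m.cnt u ≤ (L u).length)
    (hpos : 0 < m.cnt v) (hzero : (m.expand L v).cnt v = 0) :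
    (m.expand L v).pot L + 50 * ((L v).length + 1) + 22 * weight L (m.new L v) ≤ m.pot L := by
  let m' := (m.add v (nbrs L v)).decr L (m.new L v)
  have hcnt' : ∀ u, m'.cnt u ≤ (L u).length := fun u => (Nat.sub_le _ _).trans (hcnt u)
  have hcur : (m.expand L v).cur ≤ m.cur + weight L (m.new L v) := Mem.push_cur_le hcnt' _
  have hheight : (m.expand L v).height L ≤ m.height L + weight L (m.new L v) :=
    Mem.height_push_le hcnt' _
  have hweight : weight L ((m.expand L v).stk 1) ≤ weight L (m.stk 1) + weight L (m.new L v) :=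
    m'.weight_push_le _
  have houtside := Mem.outside_expand (m := m) hnd
  have hactive := Mem.active_expand hpos hzero
  simp only [Mem.pot]
  omega

lemma Mem.pot_push_singleton_le (hcnt : ∀ u, m.cnt u ≤ (L u).length) (hcur : m.cur = 0)
    (hstk : ∀ j, m.stk j = []) : (m.push [r]).pot L ≤ 372 * ∑ v, ((L v).length + 1) := by
  have hroot := weight_le_sum (L := L) (List.nodup_singleton r)
  have hcur' := Mem.push_cur_le hcnt [r]
  have hheight := Mem.height_push_le hcnt [r]
  have hweight := m.weight_push_le (L := L) [r]
  have hheight_zero : m.height L = 0 := by simp [Mem.height, hstk]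
  have hweight_zero : weight L (m.stk 1) = 0 := by simp [weight, hstk]
  have houtside : (m.push [r]).outside L ≤ ∑ v, ((L v).length + 1) :=
    Finset.sum_le_sum_of_subset (Finset.subset_univ _)
  have hactive : (m.push [r]).active L ≤ ∑ v, ((L v).length + 1) :=
    Finset.sum_le_sum_of_subset (Finset.subset_univ _)
  simp only [Mem.pot]
  omega

end Potential

end RAM

namespace RAM

open Branching

/-! ### The main loop -/

section MainLoop

variable {n : ℕ} {G : SimpleGraph (Fin n)} {L : Fin n → List (Fin n)} {m : Mem n}
  {σ : State (Fin n)} {r u v w x : Fin n} {l : List (Fin n)} {s : Store} {body : Prog} {c : ℕ}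
  {Q : Store → Prop}

/-- Expand the vertex in register `16`. -/
def expandProg : Prog := .seq (block [.copy 7 4, .copy 8 16]) (.seq addNbrs processNew)

lemma runs_expandProg (h : Rep L m s) (h16 : s.reg 16 = v) (hnd : ∀ u, (L u).Nodup)
    (hcnt : ∀ u, m.cnt u ≤ (L u).length) :
    Runs expandProg s (17 * (L v).length + 22 * weight L (m.new L v) + 17)
      (Rep L (m.expand L v)) := by
  refine (Runs.seq (c := 3) (c' := 17 * (L v).length + 10 + (22 * weight L (m.new L v) + 4))
    (.block _ (.seq ?_))).mono_time (by omega)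
  have hrep := (h.setReg (x := 7) (by norm_num) (s.reg 4)).setReg (x := 8) (by norm_num) (s.reg 16)
  refine (runs_addNbrs (v := v) hrep (by simp [h16]) (hnd v)).mono le_rfl ?_
  rintro s' ⟨hrep', h7⟩
  exact runs_processNew hrep' (pre := m.ord) rfl (by simp [h7, h.top]) hnd hcnt

/-- Copy register `11` to register `17` if it holds a vertex outside the tree. -/
def copyNew : Prog :=
  .seq (.instr (.load 14 3 11)) (.cond (.eq 14 2) (.instr (.copy 17 11)) .skip)

lemma runs_copyNew (h : Rep L m s) (h11 : s.reg 11 = w) : Runs copyNew s 3 fun s' =>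
    Rep L m s' ∧ (s'.reg 17 = if w ∈ m.tree then s.reg 17 else w) ∧
      ∀ y, y ≠ 14 → y ≠ 17 → s'.reg y = s.reg y := by
  have hrep := h.setReg (x := 14) (by norm_num) (s.arr 3 (s.reg 11))
  have htest : (Test.eq 14 2).holds (s.setReg 14 (s.arr 3 (s.reg 11))) ↔ w ∉ m.tree := by
    simp [h11, h.zero, h.tree]
  refine .seq (c := 1) (.instr (.cond (c := 1) (fun hnew => .instr ?_) fun hold => .skip ?_))
  · exact ⟨hrep.setReg (by norm_num) _, by simp [htest.1 hnew, h11],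
      fun y hy hy' => by simp [hy, hy']⟩
  · exact ⟨hrep, by simp [not_not.1 (mt htest.2 hold)], fun y hy _ => by simp [hy]⟩

lemma runs_forNbr_copyNew (h : Rep L m s) (h8 : s.reg 8 = v) (hx : m.new L v = [x]) :
    Runs (forNbr copyNew) s (13 * (L v).length + 10) fun s' =>
      Rep L m s' ∧ s'.reg 17 = x ∧ s'.reg 16 = s.reg 16 := by
  have hnew : ∀ {w}, w ∈ nbrs L v → w ∉ m.tree → w = x := fun hw hwt =>
    List.mem_singleton.1 (hx ▸ List.mem_filter.2 ⟨hw, decide_eq_true hwt⟩)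
  have hxmem := List.mem_filter.1 (show x ∈ m.new L v from hx ▸ List.mem_singleton_self x)
  refine (runs_forNbr (c := 3) (v := v) (L := L) (I := fun done s' => Rep L m s' ∧
    s'.reg 8 = v ∧ s'.reg 16 = s.reg 16 ∧ (x ∈ done → s'.reg 17 = x)) ?_ ?_ ?_
    ⟨h, h8, rfl, by simp⟩).mono le_rfl fun s' ⟨hrep, _, h16, h17⟩ => ⟨hrep, h17 hxmem.1, h16⟩
  · rintro done s₁ s₂ ⟨hrep, h8, h16, h17⟩ harr hreg
    exact ⟨hrep.congr harr fun y hy => hreg y (by omega), (hreg 8 (by norm_num)).trans h8,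
      (hreg 16 (by norm_num)).trans h16, fun hd => (hreg 17 (by norm_num)).trans (h17 hd)⟩
  · exact fun done s₁ ⟨hrep, h8, _⟩ => ⟨h8, _, hrep⟩
  · rintro done w rest s₁ hsplit ⟨hrep, h8, h16, h17⟩ h11
    refine (runs_copyNew hrep h11).mono le_rfl ?_
    rintro s₂ ⟨hrep', h17', hreg⟩
    refine ⟨⟨hrep', (hreg 8 (by norm_num) (by norm_num)).trans h8,
      (hreg 16 (by norm_num) (by norm_num)).trans h16, fun hd => ?_⟩,
      hreg 9 (by norm_num) (by norm_num), hreg 10 (by norm_num) (by norm_num)⟩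
    rw [h17']
    split_ifs with hwt
    · refine h17 ((List.mem_append.1 hd).resolve_right fun hxw => ?_)
      rw [List.mem_singleton.1 hxw] at hxmem
      exact of_decide_eq_true hxmem.2 hwt
    · rw [hnew (hsplit ▸ by simp) hwt]

/-- Execute `body` unless the only neighbour outside the tree of the vertex in register `16` has
degree `2` and exactly one neighbour outside the tree. -/
def unlessDoomed (body : Prog) : Prog :=
  .seq (.instr (.copy 8 16)) (.seq (forNbr copyNew)
    (.seq (block [.load 12 4 17, .load 13 8 17])
      (.cond (.eq 12 1) (.cond (.eq 13 1) .skip body) body)))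

lemma runs_unlessDoomed (h : Rep L m s) (h16 : s.reg 16 = v) (hx : m.new L v = [x])
    (hskip : m.cnt x = 1 ∧ (L x).length = 2 → ∀ s', Rep L m s' → Q s')
    (hbody : ¬ (m.cnt x = 1 ∧ (L x).length = 2) → ∀ s', Rep L m s' → s'.reg 16 = v →
      Runs body s' c Q) :
    Runs (unlessDoomed body) s (13 * (L v).length + 17 + c) Q := by
  refine (Runs.seq (c := 1) (c' := 13 * (L v).length + 10 + (3 + (c + 3)))
    (.instr (.seq ?_))).mono_time (by omega)
  refine (runs_forNbr_copyNew (h.setReg (x := 8) (by norm_num) (s.reg 16)) (v := v) (by simp [h16])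
    hx).mono le_rfl ?_
  rintro s₁ ⟨hrep, h17, h16'⟩
  refine .seq (.block _ ?_)
  have hrep' := (hrep.setReg (x := 12) (by norm_num) (s₁.arr 4 (s₁.reg 17))).setReg (x := 13)
    (by norm_num) (s₁.arr 8 (s₁.reg 17))
  exact runs_cond_cond_skip (P := m.cnt x = 1) (P' := (L x).length = 2)
    (by simp [h17, hrep.cnt, hrep.one]) (by simp [h17, hrep.two, hrep.one])
    (fun hd => hskip hd _ (by simpa using hrep'))
    fun hd => hbody hd _ (by simpa using hrep') (by simp [h16', h16])

/-- The vertex `v` need not be expanded at the current level: it has too few neighbours outside the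
tree, or the level is `1` and `v` is doomed. -/
def Mem.Skips (L : Fin n → List (Fin n)) (m : Mem n) (v : Fin n) : Prop :=
  m.cnt v < m.cur ∨
    m.cur = 1 ∧ ∃ x, m.new L v = [x] ∧ m.cnt x = 1 ∧ (L x).length = 2

/-- Execute `body` unless the vertex in register `16`, whose number of neighbours outside the tree
is in register `14`, need not be expanded. -/
def unlessSkips (body : Prog) : Prog :=
  .cond (.lt 14 3) .skip (.cond (.eq 3 1) (unlessDoomed body) body)

lemma runs_unlessSkips (h : Rep L m s) (h16 : s.reg 16 = v) (h14 : s.reg 14 = m.cnt v)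
    (hnew : m.cur = 1 → m.cur ≤ m.cnt v → ∃ x, m.new L v = [x])
    (hskip : m.Skips L v → ∀ s', Rep L m s' → Q s')
    (hbody : ¬ m.Skips L v → ∀ s', Rep L m s' → s'.reg 16 = v → Runs body s' c Q) :
    Runs (unlessSkips body) s ((if m.cur = 1 then 13 * (L v).length + 17 else 0) + c + 2) Q := by
  have hlt : (Test.lt 14 3).holds s ↔ m.cnt v < m.cur := by simp [h14, h.cur]
  have hone : (Test.eq 3 1).holds s ↔ m.cur = 1 := by simp [h.cur, h.one]
  refine .cond (fun hb => ?_) fun hb => .cond (fun hb' => ?_) fun hb' => ?_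
  · exact (Runs.skip (hskip (Or.inl (hlt.1 hb)) s h)).mono_time le_add_self
  · obtain ⟨x, hx⟩ := hnew (hone.1 hb') (not_lt.1 (mt hlt.2 hb))
    rw [if_pos (hone.1 hb')]
    refine runs_unlessDoomed h h16 hx (fun hd => hskip (Or.inr ⟨hone.1 hb', x, hx, hd⟩))
      fun hd => hbody ?_
    rintro (hcnt | ⟨-, y, hy, hdy⟩)
    · exact hb (hlt.2 hcnt)
    · obtain rfl : x = y := List.singleton_injective (hx.symm.trans hy)
      exact hd hdy
  · refine (hbody ?_ s h h16).mono_time le_add_self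
    exact fun hskips => hskips.elim (mt hlt.2 hb) fun hd => hb' (hone.2 hd.1)

/-- The body of the main loop: treat the first vertex of the stack of the current level. -/
def mainBody : Prog :=
  .seq (.instr (.load 19 5 3))
    (.cond (.eq 19 2) (.instr (.pred 3))
      (.seq (block [.load 16 7 19, .load 12 6 19, .store 5 3 12, .load 14 4 16])
        (unlessSkips expandProg)))

lemma runs_mainBody_nil (h : Rep L m s) (hs : m.stk m.cur = []) :
    Runs mainBody s 3 (Rep L { m with cur := m.cur - 1 }) := by
  have hhead : s.arr 5 m.cur = 0 := by simpa [hs, Chain] using h.stk m.cur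
  refine .seq (c := 1) (.instr (.cond (c := 1) (fun _ => .instr ?_) fun hb => ?_))
  · simpa [h.cur] using
      (h.setReg (x := 19) (by norm_num) (s.arr 5 (s.reg 3))).setCur (m.cur - 1)
  · simp [h.cur, h.zero, hhead] at hb

lemma runs_mainBody_cons (h : Rep L m s) (hs : m.stk m.cur = v :: l)
    (hnew : m.cur = 1 → m.cur ≤ m.cnt v → ∃ x, m.new L v = [x])
    (hskip : m.Skips L v → ∀ s', Rep L (m.setStk l) s' → Q s')
    (hexpand : ¬ m.Skips L v → ∀ s', Rep L (m.setStk l) s' → s'.reg 16 = v →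
      Runs expandProg s' c Q) :
    Runs mainBody s ((if m.cur = 1 then 13 * (L v).length + 17 else 0) + c + 9) Q := by
  have hhead := h.stk m.cur
  rw [hs] at hhead
  obtain ⟨hpos, -, hval, -⟩ := hhead
  refine (Runs.seq (c := 1)
    (c' := 5 + ((if m.cur = 1 then 13 * (L v).length + 17 else 0) + c + 2) + 1)
    (.instr (.cond (fun hb => ?_) fun _ => .seq (.block _
      (runs_unlessSkips (m := m.setStk l) (v := v) ?_ ?_ ?_ hnew hskip hexpand))))).mono_time
        (by omega)
  · simp only [Test.holds, Instr.run, Store.setReg_reg, Nat.reduceEqDiff, if_true, if_false,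
      h.cur, h.zero] at hb
    exact absurd hb hpos.ne'
  · have hpop := ((h.setReg (x := 19) (by norm_num) (s.arr 5 m.cur)).setReg (x := 16)
      (by norm_num) v).setReg (x := 12) (by norm_num) (s.arr 6 (s.arr 5 m.cur))
    simpa [h.cur, hval, h.cnt, Mem.setStk] using
      (hpop.pop hs).setReg (x := 14) (by norm_num) (m.cnt v)
  · simp [h.cur, hval]
  · simp [h.cur, hval, h.cnt, Mem.setStk]

lemma Inv.cnt_le_length (h : Inv (simplify G) L r m σ) (hL : IsAdjLists G L) (u : Fin n) :
    m.cnt u ≤ (L u).length := by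
  rw [h.cnt, hL.length_eq]
  exact Set.ncard_le_ncard (fun w hw => hw.1.1) (Set.toFinite _)

lemma Inv.length_new (h : Inv (simplify G) L r m σ) (hL : IsAdjLists G L) (v : Fin n) :
    (m.new L v).length = m.cnt v := by
  have hset : outer (simplify G) σ v = {u | u ∈ m.new L v ∧ true} := by
    ext u
    simp [h.mem_new hL.mem_nbrs]
  rw [h.cnt, hset, ncard_setOf_mem_and (l := m.new L v) ((hL.nodup_nbrs v).filter _) fun _ => true,
    List.countP_true]

lemma Inv.outer_eq_singleton (h : Inv (simplify G) L r m σ) (hL : IsAdjLists G L)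
    (hx : m.new L v = [x]) : outer (simplify G) σ v = {x} := by
  ext w
  rw [← h.mem_new hL.mem_nbrs, hx, List.mem_singleton, Set.mem_singleton_iff]

lemma Inv.exists_new_eq_singleton (h : Inv (simplify G) L r m σ) (hL : IsAdjLists G L)
    (hv : v ∈ σ.verts) (hcur : m.cur = 1) (hcnt : m.cur ≤ m.cnt v) : ∃ x, m.new L v = [x] := by
  refine List.length_eq_one_iff.1 (le_antisymm ?_ ?_)
  · rw [h.length_new hL, h.cnt]
    exact (h.noO1 hcur.le).ncard_le_one hv
  · rw [h.length_new hL, ← hcur]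
    exact hcnt

lemma Inv.pop_of_skips (h : Inv (simplify G) L r m σ) (hL : IsAdjLists G L)
    (hs : m.stk m.cur = v :: l) (hskip : m.Skips L v) :
    Inv (simplify G) L r (m.setStk l) σ := by
  refine h.pop hs (fun hcur => hskip.resolve_right fun hone => by omega) fun hcur => ?_
  rcases hskip with hcnt | ⟨-, x, hx, hone, hdeg⟩
  · rw [hcur, h.cnt, Nat.lt_one_iff, Set.ncard_eq_zero] at hcnt
    exact Or.inl hcnt
  · rw [h.cnt] at hone
    exact doomed_of_deg_eq_two (h.outer_eq_singleton hL hx)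
      (h.mem m.cur v (hs ▸ List.mem_cons_self)) hone (hL.length_eq x ▸ hdeg)

lemma Inv.reached_of_not_skips (h : Inv (simplify G) L r m σ) (hL : IsAdjLists G L)
    (hs : m.stk m.cur = v :: l) (hpos : 0 < m.cur) (hskip : ¬ m.Skips L v) :
    Reached (simplify G) r (Branching.expand (simplify G) σ v) := by
  have hcnt : m.cur ≤ m.cnt v := not_lt.1 fun hlt => hskip (Or.inl hlt)
  have hv : v ∈ σ.verts := h.mem m.cur v (hs ▸ List.mem_cons_self)
  by_cases hcur : m.cur = 1
  · obtain ⟨x, hx⟩ := h.exists_new_eq_singleton hL hv hcur hcnt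
    refine h.reached_of_cur_eq_one hs hcur
      (O2_or_O3_of_deg_ne_two (h.outer_eq_singleton hL hx) hv ?_)
    rw [← h.cnt, ← hL.length_eq]
    exact fun hd => hskip (Or.inr ⟨hcur, x, hx, hd⟩)
  · exact h.reached_of_two_le_cur hs (by omega) hcnt

/-- The invariant of the main loop: the memory holds data that describe a state of BRANCHING. The
bound for the level makes the height of the stacks count the current one. -/
def LoopInv (G : SimpleGraph (Fin n)) (L : Fin n → List (Fin n)) (r : Fin n)
    (m : Mem n) (σ : State (Fin n)) (s : Store) : Prop :=
  Rep L m s ∧ Inv (simplify G) L r m σ ∧ m.cur ≤ ∑ v, (L v).length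

lemma LoopInv.exists_runs_of_nil (h : LoopInv G L r m σ s) (hs : m.stk m.cur = [])
    (hpos : 0 < m.cur) :
    ∃ m' σ' c, Runs mainBody s c (LoopInv G L r m' σ') ∧ c + 1 + m'.pot L ≤ m.pot L := by
  obtain ⟨hrep, hinv, hcur⟩ := h
  refine ⟨{ m with cur := m.cur - 1 }, σ, 3, (runs_mainBody_nil hrep hs).mono le_rfl
    fun s' hrep' => ⟨hrep', hinv.pred hs, (Nat.sub_le _ _).trans hcur⟩, ?_⟩
  have hpot := Mem.pot_pred (L := L) hpos
  omega

lemma LoopInv.exists_runs_of_skips (h : LoopInv G L r m σ s) (hL : IsAdjLists G L)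
    (hs : m.stk m.cur = v :: l) (hskip : m.Skips L v) :
    ∃ m' σ' c, Runs mainBody s c (LoopInv G L r m' σ') ∧ c + 1 + m'.pot L ≤ m.pot L := by
  obtain ⟨hrep, hinv, hcur⟩ := h
  refine ⟨m.setStk l, σ, _, runs_mainBody_cons (c := 0) hrep hs
    (hinv.exists_new_eq_singleton hL (hinv.mem m.cur v (hs ▸ List.mem_cons_self)))
    (fun _ s' hrep' => ⟨hrep', hinv.pop_of_skips hL hs hskip, hcur⟩)
    fun hnot => absurd hskip hnot, ?_⟩
  have hpot := Mem.pot_setStk hs hcur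
  split_ifs at hpot ⊢ <;> omega

lemma LoopInv.exists_runs_of_not_skips (h : LoopInv G L r m σ s) (hL : IsAdjLists G L)
    (hs : m.stk m.cur = v :: l) (hpos : 0 < m.cur) (hskip : ¬ m.Skips L v) :
    ∃ m' σ' c, Runs mainBody s c (LoopInv G L r m' σ') ∧ c + 1 + m'.pot L ≤ m.pot L := by
  obtain ⟨hrep, hinv, hcur⟩ := h
  have hadj := hL.mem_nbrs
  have hcnt : ∀ u, m.cnt u ≤ (L u).length := hinv.cnt_le_length hL
  have hinv' := hinv.expand hadj hL.nodup_nbrs hs (hinv.reached_of_not_skips hL hs hpos hskip)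
  have hcur' : ((m.setStk l).expand L v).cur ≤ ∑ v, (L v).length :=
    Mem.push_cur_le_sum (m := ((m.setStk l).add v (nbrs L v)).decr L ((m.setStk l).new L v))
      (fun u => (Nat.sub_le _ _).trans (hcnt u)) _ hcur
  refine ⟨(m.setStk l).expand L v, _, _, runs_mainBody_cons hrep hs
    (hinv.exists_new_eq_singleton hL (hinv.mem m.cur v (hs ▸ List.mem_cons_self)))
    (fun hskip' => absurd hskip' hskip) fun _ s' hrep' h16 =>
    (runs_expandProg hrep' h16 (fun u => (hL u).1) hcnt).mono le_rfl
      fun s'' hrep'' => ⟨hrep'', hinv', hcur'⟩, ?_⟩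
  have hpot := Mem.pot_setStk hs hcur
  have hpot' := Mem.pot_expand (m := m.setStk l) (hL.nodup_nbrs v) hcnt
    (hpos.trans_le (not_lt.1 fun hlt => hskip (Or.inl hlt)))
    (hinv.cnt_expand_self hadj hL.nodup_nbrs)
  split_ifs at hpot ⊢ <;> omega

lemma runs_mainLoop (h : LoopInv G L r m σ s) (hL : IsAdjLists G L) :
    Runs (.loop (.lt 2 3) mainBody) s (m.pot L + 1) fun s' =>
      ∃ m σ, Rep L m s' ∧ Inv (simplify G) L r m σ ∧ m.cur = 0 := by
  have htest : ∀ {m σ s}, LoopInv G L r m σ s → ((Test.lt 2 3).holds s ↔ 0 < m.cur) :=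
    fun hI => by simp [hI.1.zero, hI.1.cur]
  refine (Runs.loop_of_potential (I := fun a => LoopInv G L r a.1 a.2) (fun a => a.1.pot L) ?_
    (m, σ) s h).mono le_rfl fun s' ⟨a, hI, hb⟩ =>
    ⟨a.1, a.2, hI.1, hI.2.1, Nat.eq_zero_of_not_pos (mt (htest hI).2 hb)⟩
  rintro ⟨m, σ⟩ s hI hb
  have hpos : 0 < m.cur := (htest hI).1 hb
  obtain ⟨m', σ', c, hrun, hpot⟩ :
      ∃ m' σ' c, Runs mainBody s c (LoopInv G L r m' σ') ∧ c + 1 + m'.pot L ≤ m.pot L := by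
    rcases hs : m.stk m.cur with _ | ⟨v, l⟩
    · exact hI.exists_runs_of_nil hs hpos
    · by_cases hskip : m.Skips L v
      · exact hI.exists_runs_of_skips hL hs hskip
      · exact hI.exists_runs_of_not_skips hL hs hpos hskip
  exact ⟨(m', σ'), c, hrun, hpot⟩

end MainLoop

/-! ### The initialization and the whole program -/

section Program

variable {n : ℕ} {G : SimpleGraph (Fin n)} {L : Fin n → List (Fin n)} {m : Mem n}
  {σ : State (Fin n)} {r v : Fin n} {s : Store}

/-- Execute `body` for each vertex, in register `6`. -/
def forVert (body : Prog) : Prog := .loop (.lt 6 0) (.seq body (.instr (.succ 6)))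

lemma runs_forVert {body : Prog} {c : Fin n → ℕ} {I : ℕ → Store → Prop}
    (hstab : ∀ i s k, I i s → I i (s.setReg 6 k)) (hsize : ∀ i s, I i s → s.reg 0 = n)
    (hbody : ∀ (v : Fin n) s, I v s → s.reg 6 = v →
      Runs body s (c v) fun s' => I (v + 1) s' ∧ s'.reg 6 = v)
    (hs : I 0 s) (h6 : s.reg 6 = 0) : Runs (forVert body) s (∑ v, (c v + 2) + 1) (I n) := by
  have hlength : ∀ {done rest : List (Fin n)}, List.finRange n = done ++ rest →
      n = done.length + rest.length := fun hsplit => by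
    rw [← List.length_append, ← hsplit, List.length_finRange]
  have hloop : Runs (forVert body) s (((List.finRange n).map fun v => c v + 2).sum + 1)
      fun s' => I (List.finRange n).length s' ∧ s'.reg 6 = (List.finRange n).length := by
    refine Runs.loop_list (f := fun v => c v + 1)
      (I := fun done s' => I done.length s' ∧ s'.reg 6 = done.length) ?_ ?_ ⟨hs, h6⟩
    · rintro done rest s₁ hsplit ⟨hI, h6⟩
      have hn := hlength hsplit
      simp only [Test.holds, h6, hsize _ _ hI, ← List.length_pos_iff]
      omega
    · rintro done v rest s₁ hsplit ⟨hI, h6⟩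
      have hv : (v : ℕ) = done.length := by
        have hget : (List.finRange n)[done.length]? = some v := by simp [hsplit]
        simpa using (congrArg Fin.val (List.getElem?_eq_some_iff.1 hget).2).symm
      rw [← hv] at hI h6
      refine .seq ((hbody v s₁ hI h6).mono le_rfl fun s₂ ⟨hI', h6'⟩ => .instr ?_)
      rw [List.length_append, List.length_singleton, ← hv]
      exact ⟨hstab _ _ _ hI', by simp [h6']⟩
  rw [Fin.sum_univ_def]
  exact hloop.mono le_rfl fun s' hs' => List.length_finRange (n := n) ▸ hs'.1

/-- Mark the vertex in register `6` if it has degree `2`. -/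
def markTwo : Prog :=
  .seq (block [.load 12 0 6, .succ 12, .succ 12, .copy 13 6, .succ 13, .load 13 0 13])
    (.cond (.eq 12 13) (.instr (.store 8 6 1)) .skip)

lemma runs_markTwo (hoff : s.arr 0 = (inputStore L).arr 0) (hone : s.reg 1 = 1)
    (h6 : s.reg 6 = v) : Runs markTwo s 9 fun s' =>
      (∀ x < 12, s'.reg x = s.reg x) ∧ (∀ a, a ≠ 8 → s'.arr a = s.arr a) ∧
        ∀ w : Fin n, s'.arr 8 w = if w = v ∧ (L v).length = 2 then 1 else s.arr 8 w := by
  refine (Runs.seq (c := 7) (c' := 2) (Runs.block _ ?_))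
  simp only [List.foldl_cons, List.foldl_nil, Instr.run, Store.setReg_arr, Store.setReg_reg,
    Nat.reduceEqDiff, if_true, if_false, h6, hoff, inputStore_arr_zero_succ]
  set s₁ := Store.setReg _ 13 _
  have htest : (Test.eq 12 13).holds s₁ ↔ (L v).length = 2 := by
    simp only [s₁, Test.holds, Store.setReg_reg, Nat.reduceEqDiff, if_true, if_false]
    omega
  have hreg : ∀ x < 12, s₁.reg x = s.reg x := fun x hx => by
    simp [s₁, show x ≠ 12 by omega, show x ≠ 13 by omega]
  refine .cond (c := 1) (fun hb => .instr ⟨hreg, fun a ha => ?_, fun w => ?_⟩)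
    fun hb => .skip ⟨hreg, fun a _ => rfl, fun w => ?_⟩
  · simp [s₁, ha]
  · simp [s₁, hone, h6, update_fin, htest.1 hb]
  · rw [if_neg fun hw => hb (htest.2 hw.2)]
    rfl

/-- The data before the root is added. -/
def Mem.empty (n : ℕ) : Mem n := ⟨∅, fun _ => 0, fun _ => 0, fun _ => [], 0, []⟩

lemma rep_empty (hreg : ∀ x < 6, s.reg x = (((inputStore L).setReg 1 1).setReg 5 1).reg x)
    (harr : ∀ a, a ≠ 8 → s.arr a = (inputStore L).arr a)
    (htwo : ∀ v : Fin n, s.arr 8 v = if (L v).length = 2 then 1 else 0) :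
    Rep L (Mem.empty n) s := by
  have hzero : ∀ a, 2 ≤ a → a ≠ 8 → ∀ i, s.arr a i = 0 := fun a ha ha' i => by
    simp [harr a ha', inputStore, show a ≠ 0 by omega, show a ≠ 1 by omega]
  exact
    { size := by simpa [inputStore] using hreg 0 (by norm_num)
      one := by simpa using hreg 1 (by norm_num)
      zero := by simpa [inputStore] using hreg 2 (by norm_num)
      cur := by simpa [inputStore, Mem.empty] using hreg 3 (by norm_num)
      top := by simpa [inputStore, Mem.empty] using hreg 4 (by norm_num)
      free := by simp [hreg 5 (by norm_num)]
      off := harr 0 (by norm_num)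
      adj := harr 1 (by norm_num)
      par := fun v => hzero 2 le_rfl (by norm_num) v
      tree := fun v => by simp [hzero 3, Mem.empty]
      cnt := fun v => hzero 4 (by norm_num) (by norm_num) v
      stk := fun j => hzero 5 (by norm_num) (by norm_num) j
      two := htwo
      ord := fun i hi => absurd hi (Nat.not_lt_zero i) }

lemma runs_forVert_markTwo : Runs (forVert markTwo) (((inputStore L).setReg 1 1).setReg 5 1)
    (11 * n + 1) (Rep L (Mem.empty n)) := by
  refine (runs_forVert (n := n) (c := fun _ => 9) (I := fun i s =>
    (∀ x < 6, s.reg x = (((inputStore L).setReg 1 1).setReg 5 1).reg x) ∧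
    (∀ a, a ≠ 8 → s.arr a = (inputStore L).arr a) ∧
    ∀ v : Fin n, s.arr 8 v = if v < i ∧ (L v).length = 2 then 1 else 0) ?_ ?_ ?_ ?_ ?_).mono
    ?_ fun s' ⟨hreg, harr, htwo⟩ => rep_empty hreg harr fun v => by simp [htwo]
  · rintro i s k ⟨hreg, harr, htwo⟩
    refine ⟨fun x hx => ?_, harr, htwo⟩
    rw [Store.setReg_reg, if_neg hx.ne, hreg x hx]
  · exact fun i s hI => by simpa [inputStore] using hI.1 0 (by norm_num)
  · rintro v s ⟨hreg, harr, htwo⟩ h6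
    refine (runs_markTwo (harr 0 (by norm_num)) (by simpa using hreg 1 (by norm_num)) h6).mono
      le_rfl ?_
    rintro s' ⟨hreg', harr', htwo'⟩
    refine ⟨⟨fun x hx => (hreg' x (by omega)).trans (hreg x hx),
      fun a ha => (harr' a ha).trans (harr a ha), fun w => ?_⟩, (hreg' 6 (by norm_num)).trans h6⟩
    rw [htwo', htwo]
    by_cases hw : w = v
    · simp [hw]
    · have hlt : (w : ℕ) < v + 1 ↔ (w : ℕ) < v := by have := Fin.val_ne_of_ne hw; omega
      simp [hw, hlt]
  · exact ⟨fun _ _ => rfl, fun _ _ => rfl, fun v => by simp [inputStore]⟩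
  · simp [inputStore]
  · simp; omega

/-- Count the neighbours of the vertex in register `6`. -/
def countNbrs : Prog :=
  .seq (.instr (.copy 8 6)) (forNbr (block [.load 14 4 8, .succ 14, .store 4 8 14]))

lemma runs_countNbrs (h : Rep L m s) (h6 : s.reg 6 = v) (hcnt : m.cnt v = 0) :
    Runs countNbrs s (14 * (L v).length + 11) fun s' =>
      Rep L { m with cnt := Function.update m.cnt v (nbrs L v).length } s' ∧ s'.reg 6 = v := by
  refine (Runs.seq (c := 1) (c' := 14 * (L v).length + 10) (.instr ?_)).mono_time (by omega)
  refine (runs_forNbr (c := 4) (v := v) (L := L) (I := fun l s' =>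
    Rep L { m with cnt := Function.update m.cnt v l.length } s' ∧
    s'.reg 8 = v ∧ s'.reg 6 = v) ?_ ?_ ?_ ?_).mono le_rfl fun s' ⟨hrep, _, h6⟩ => ⟨hrep, h6⟩
  · rintro l s₁ s₂ ⟨hrep, h8, h6⟩ harr hreg
    exact ⟨hrep.congr harr fun x hx => hreg x (by omega), (hreg 8 (by norm_num)).trans h8,
      (hreg 6 (by norm_num)).trans h6⟩
  · exact fun l s₁ ⟨hrep, h8, _⟩ => ⟨h8, _, hrep⟩
  · rintro done w rest s₁ - ⟨hrep, h8, h6⟩ -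
    refine .block _ ⟨⟨?_, ?_, ?_⟩, ?_, ?_⟩
    · simpa [h8, hrep.cnt] using
        ((hrep.setReg (x := 14) (by norm_num) done.length).setReg (x := 14) (by norm_num)
          (done.length + 1)).setCnt v (done.length + 1)
    all_goals simp [h6, h8]
  · refine ⟨?_, by simp [h6], by simp [h6]⟩
    rw [List.length_nil, ← hcnt, Function.update_eq_self]
    exact h.setReg (by norm_num) _

lemma runs_forVert_countNbrs (h : Rep L (Mem.empty n) s) (h6 : s.reg 6 = 0) :
    Runs (forVert countNbrs) s (∑ v, (14 * (L v).length + 13) + 1)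
      (Rep L { Mem.empty n with cnt := fun v => (nbrs L v).length }) := by
  refine (runs_forVert (c := fun v => 14 * (L v).length + 11) (I := fun i =>
    Rep L { Mem.empty n with cnt := fun v => if v < i then (nbrs L v).length else 0 })
    (fun i s k hrep => hrep.setReg le_rfl k) (fun i s hrep => hrep.size) ?_
    (by simpa [Mem.empty] using h) h6).mono le_rfl fun s' hrep => by simpa using hrep
  intro v s₁ hrep h6
  refine (runs_countNbrs hrep h6 (by simp)).mono le_rfl fun s₂ ⟨hrep', h6'⟩ => ⟨?_, h6'⟩
  convert hrep' using 2
  funext w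
  by_cases hw : w = v
  · simp [hw]
  · have hlt : (w : ℕ) < v + 1 ↔ (w : ℕ) < v := by have := Fin.val_ne_of_ne hw; omega
    simp only [Function.update_of_ne hw, hlt]

/-- The data with the root `r`, before its stacks are filled. -/
def Mem.root (L : Fin n → List (Fin n)) (r : Fin n) : Mem n :=
  ⟨{r}, fun _ => r, fun v => (nbrs L v).length, fun _ => [], 0, [r]⟩

/-- Make the vertex `0` the root. -/
def addRoot : Prog := block [.store 3 2 1, .store 9 4 2, .const 4 1, .const 7 0]

lemma runs_addRoot (h : Rep L { Mem.empty n with cnt := fun v => (nbrs L v).length } s)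
    (hr : (r : ℕ) = 0) :
    Runs addRoot s 5 fun s' => Rep L (Mem.root L r) s' ∧ s'.reg 7 = 0 := by
  have hrep := ((h.setTree r).pushOrd r).setReg (x := 7) (by norm_num) 0
  have htop : s.reg 4 = 0 := h.top
  refine .block _ ⟨?_, by simp⟩
  simpa [Mem.root, Mem.empty, hr, h.one, h.zero, htop] using hrep

/-- The program: prepare the tables, then run the main loop from the vertex `0`. -/
def prog : Prog :=
  .seq (block [.const 1 1, .const 5 1])
    (.seq (forVert markTwo)
      (.seq (.instr (.const 6 0))
        (.seq (forVert countNbrs)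
          (.seq addRoot (.seq processNew (.loop (.lt 2 3) mainBody))))))

lemma runs_processNew_mainLoop (hL : IsAdjLists G L) (h : Rep L (Mem.root L r) s)
    (h7 : s.reg 7 = 0) :
    Runs (.seq processNew (.loop (.lt 2 3) mainBody)) s (395 * ∑ v, ((L v).length + 1) + 5)
      fun s' => ∃ m σ, Rep L m s' ∧ Inv (simplify G) L r m σ ∧ m.cur = 0 := by
  have hcnt : ∀ u, (Mem.root L r).cnt u ≤ (L u).length := fun u => List.length_filter_le _ _
  have hcnt' : ∀ u, ((Mem.root L r).decr L [r]).cnt u ≤ (L u).length := fun u =>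
    (Nat.sub_le _ _).trans (hcnt u)
  have hweight : weight L [r] ≤ ∑ v, ((L v).length + 1) := weight_le_sum (List.nodup_singleton r)
  have hpot := Mem.pot_push_singleton_le (r := r) hcnt' rfl fun _ => rfl
  have hinv : Inv (simplify G) L r (((Mem.root L r).decr L [r]).push [r]) (Branching.init r) :=
    .init hL.mem_nbrs hL.nodup_nbrs rfl (fun _ => rfl) (fun _ => rfl) fun _ => rfl
  have hnew := runs_processNew (pre := []) (new := [r]) h rfl h7 (fun u => (hL u).1) hcnt
  refine (Runs.seq (hnew.mono le_rfl fun s' hrep => runs_mainLoop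
    ⟨hrep, hinv, Mem.push_cur_le_sum hcnt' _ (Nat.zero_le _)⟩ hL)).mono_time ?_
  change 22 * weight L [r] + 4 + _ ≤ _
  omega

lemma runs_prog (hL : IsAdjLists G L) (hr : (r : ℕ) = 0) :
    Runs prog (inputStore L) (600 * ∑ v, ((L v).length + 1))
      fun s' => ∃ m σ, Rep L m s' ∧ Inv (simplify G) L r m σ ∧ m.cur = 0 := by
  have hlength : ∑ v, (14 * (L v).length + 13) ≤ 14 * ∑ v, ((L v).length + 1) := by
    rw [Finset.mul_sum]
    exact Finset.sum_le_sum fun v _ => by omega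
  have hcard : n ≤ ∑ v, ((L v).length + 1) := by simp [Finset.sum_add_distrib]
  have hrun : Runs prog (inputStore L) (3 + (11 * n + 1 + (1 + (∑ v, (14 * (L v).length + 13) + 1 +
      (5 + (395 * ∑ v, ((L v).length + 1) + 5))))))
      fun s' => ∃ m σ, Rep L m s' ∧ Inv (simplify G) L r m σ ∧ m.cur = 0 := by
    refine .seq (.block _ (.seq (runs_forVert_markTwo.mono le_rfl fun s₁ hempty => ?_)))
    refine .seq (.instr (.seq ((runs_forVert_countNbrs (hempty.setReg (by norm_num) 0)
      (by simp)).mono le_rfl fun s₂ hcnt => ?_)))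
    exact .seq ((runs_addRoot hcnt hr).mono le_rfl fun s₃ ⟨hroot, h7⟩ =>
      runs_processNew_mainLoop hL hroot h7)
  exact hrun.mono_time (by have := r.pos; omega)

lemma sum_length_eq (hL : IsAdjLists G L) : ∑ v, (L v).length = 2 * G.edgeSet.ncard := by
  classical
  rw [← G.coe_edgeFinset, Set.ncard_coe_finset, ← G.sum_degrees_eq_twice_card_edges]
  refine Finset.sum_congr rfl fun v _ => ?_
  rw [hL.length_eq, deg, Set.ncard_eq_toFinset_card']
  rfl

lemma Inv.par_eq_of_isTriangle (h : Inv (simplify G) L r m σ) (ht : IsTriangle G) (v : Fin n) :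
    m.par v = r := by
  have hdeg : ∀ w, deg G w = 2 := fun w => by
    have hnbr : (⊤ : SimpleGraph (Fin n)).neighborSet w = {w}ᶜ := by ext; simp [eq_comm]
    rw [deg, ht.2, hnbr, Set.ncard_compl, Set.ncard_singleton,
      Nat.card_eq_fintype_card, ht.1]
  by_cases hv : v ∈ σ.verts
  · rw [h.par v hv]
    by_contra hne
    have hvr : v ≠ r := fun heq => hne (by rw [heq, h.valid.root_parent])
    exact (h.valid.parent_adj v hv hvr).2 ⟨hdeg _, hdeg _⟩
  · exact h.par_of_notMem v hv

theorem exists_prog : ∃ (prog : Prog) (c : ℕ), ∀ (n : ℕ) (G : SimpleGraph (Fin n))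
    (L : Fin n → List (Fin n)), G.Connected → NoTwoVertexSeparator G → IsAdjLists G L →
      ∃ (s : Store) (t : ℕ) (p : Fin n → Fin n),
        Exec prog (inputStore L) s t ∧ t ≤ c * (n + G.edgeSet.ncard) ∧ Outputs s p ∧
        IsManyLeafTree G (parentGraph p) ∧
        (¬ IsTriangle G → ∃ r s', IsResult (simplify G) r s' ∧ s'.parent = p) := by
  refine ⟨prog, 1200, fun n G L hconn hG hL => ?_⟩
  have hn : 0 < n := Fin.pos_iff_nonempty.2 hconn.nonempty
  obtain ⟨s, t, hexec, htime, m, σ, hrep, hinv, hcur⟩ := runs_prog (r := ⟨0, hn⟩) hL rfl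
  have htime' : t ≤ 1200 * (n + G.edgeSet.ncard) := by
    simp only [Finset.sum_add_distrib, sum_length_eq hL, Finset.sum_const, Finset.card_univ,
      Fintype.card_fin, smul_eq_mul, mul_one] at htime
    omega
  by_cases ht : IsTriangle G
  · exact ⟨s, t, fun _ => ⟨0, hn⟩, hexec, htime',
      fun v => by rw [hrep.par, hinv.par_eq_of_isTriangle ht],
      isManyLeafTree_of_isTriangle ht _, fun h => absurd ht h⟩
  · have hres := hinv.isResult hcur
    have huniv := hres.verts_eq_univ hG ht
    exact ⟨s, t, σ.parent, hexec, htime',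
      fun v => by rw [hrep.par, hinv.par v (huniv ▸ Set.mem_univ v)],
      hres.isManyLeafTree hG ht, fun _ => ⟨_, σ, hres, rfl⟩⟩

end Program

end RAM

theorem mainTheorem2 :
    -- existence of the tree, and every execution of BRANCHING finds one
    (∀ (V : Type u) [Fintype V] (G : SimpleGraph V), G.Connected → NoTwoVertexSeparator G →
      (∃ T : SimpleGraph V, IsManyLeafTree G T) ∧
      (¬ IsTriangle G → ∀ r : V,
        (∃ s, Branching.IsResult (simplify G) r s) ∧
        ∀ s, Branching.IsResult (simplify G) r s → IsManyLeafTree G (parentGraph s.parent))) ∧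
    -- linear time
    (∃ (prog : RAM.Prog) (c : ℕ), ∀ (n : ℕ) (G : SimpleGraph (Fin n)) (L : Fin n → List (Fin n)),
      G.Connected → NoTwoVertexSeparator G → RAM.IsAdjLists G L →
      ∃ (s : RAM.Store) (t : ℕ) (p : Fin n → Fin n),
        RAM.Exec prog (RAM.inputStore L) s t ∧
        t ≤ c * (n + G.edgeSet.ncard) ∧
        RAM.Outputs s p ∧
        IsManyLeafTree G (parentGraph p) ∧
        (¬ IsTriangle G → ∃ r s', Branching.IsResult (simplify G) r s' ∧ s'.parent = p)) := by
  exact ⟨fun V _ G hconn hG => Branching.exists_and_forall_isManyLeafTree hconn hG,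
    RAM.exists_prog⟩
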